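/- Let $\mathbf k$ be a commutative $\mathbb Q$-algebra, let $(\mu,\Phi)\in M(\mathbf k)$ be a Drinfeld associator, and let $S$ be a set. **Notation.** $B_n$ is the braid group with Artin generators $\sigma_1,\dots,\sigma_{n-1}$, with the morphism $B_n\to S_n$, $\sigma_i\mapsto(i,i+1)$ (and $B_0=B_1=1$). Set $\Gamma_{0,n}=B_n/\langle\!\langle(\sigma_1\cdots\sigma_{n-1})^n,\ \sigma_1\cdots\sigma_{n-2}\sigma_{n-1}^2\sigma_{n-2}\cdots\sigma_1\rangle\!\rangle$; the map to $S_n$ factors through $\Gamma_{0,n}$. Let $h_n=\sigma_1(\sigma_2\sigma_1)\cdots(\sigma_{n-1}\cdots\sigma_1)$ and $b_{n,m}=(\sigma_m\cdots\sigma_1)(\sigma_{m+1}\cdots\sigma_2)\cdots(\sigma_{n+m-1}\cdots\sigma_n)\in B_{n+m}$. The Lie algebra $\mathfrak t_n$ over $\mathbf k$ has generators $t_{ij}$ ($i\ne j\in[n]$) and relations $t_{ij}=t_{ji}$, $[t_{ij},t_{ik}+t_{jk}]=0$, $[t_{ij},t_{kl}]=0$ ($i,j,k,l$ distinct), and $\mathfrak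 p_n$ is its quotient by $\sum_{j\neq i}t_{ij}=0$ for all $i$. Hats denote degree completions, and $S_n$ acts by $\sigma(t_{ij})=t_{\sigma(i)\sigma(j)}$. For $I,J\subset[n]$ disjoint, $t_{IJ}=\sum_{i\in I,j\in J}t_{ij}$. $M(\mathbf k)$ is the set of pairs $(\mu,\Phi)\in\mathbf k\times\exp(\hat{\mathfrak f}_2)$, where $\mathfrak f_2$ is the free Lie algebra over $\mathbf k$ on $A,B$, such that $\Phi(B,A)=\Phi(A,B)^{-1}$; $e^{\mu A/2}\Phi(C,A)e^{\mu C/2}\Phi(B,C)e^{\mu B/2}\Phi(A,B)=1$ for $A+B+C=0$; and, in $\exp(\hat{\mathfrak t}_4)$, $\Phi(t_{12},t_{23}+t_{24})\,\Phi(t_{13}+t_{23},t_{34})=\Phi(t_{23},t_{34})\,\Phi(t_{12}+t_{13},t_{24}+t_{34})\,\Phi(t_{12},t_{23})$. $T_n$ is the set of parenthesizations of a word of length $n$ (one element for $n=0$; planar binary rooted trees with $n$ leaves for $n\ge1$). $PlT_n$ is the set of planar 3-valent (unrooted) trees with leaves labelled bijectively by $[n]$ compatibly with the cyclic orders (one element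 for $n\le 1$; for $n=2$, a single edge). The map $\pi:T_n\to PlT_n$ numbers the leaves from left to right and replaces the root and its two adjacent edges by a single edge. For a family of groups $G_n\to S_n$ and sets $X_n$, let $\mathcal C(G,X)$ be the category with objects $\sqcup_{n\ge0}X_n\times S^n$, where a morphism $(t,\underline s)\to(t',\underline s')$ is, if both objects have the same degree $n$, an element of $G_n$ whose image $f\in S_n$ satisfies $\underline s'f=\underline s$ (there is none otherwise), and composition is the product of $G_n$. Set $\mathbf{PaB}_S=\mathcal C(B,T)$, $\mathbf{PaCD}_S^\Phi=\mathcal C(\exp(\hat{\mathfrak t})\rtimes S,T)$, $\widetilde{\mathbf{PaDih}}_S=\mathcal C(\Gamma_0,PlT)$, $\widetilde{\mathbf{PaDih}}{}_S^{gr}=\mathcal C(\exp(\hat{\mathfrak p})\rtimes S,PlT)$. **Braided monoidal structures.** On objects of $\mathbf{PaB}_S$ and $\mathbf{PaCD}_S^\Phi$, $\otimes$ is concatenation of parenthesized words, with unit the empty word. In $\mathbf{PaB}_S$, $\otimes$ of morphisms is juxtaposition of braids, $\beta_{XY}=b_{n,m}$ and $a_{XYZ}=1$, where $n=|X|$, $m=|Y|$,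 $p=|Z|$. In $\mathbf{PaCD}_S^\Phi$, $\otimes$ of morphisms is induced by $(t_{ij},0)\mapsto t_{ij}$, $(0,t_{ij})\mapsto t_{n+i,n+j}$ and $S_n\times S_m\to S_{n+m}$; $\beta_{XY}=s_{n,m}\exp\bigl(\tfrac\mu2 t_{[n],\,n+[m]}\bigr)$, where $s_{n,m}(i)=m+i$ for $i\in[n]$ and $s_{n,m}(n+i)=i$ for $i\in[m]$; and $a_{XYZ}=\Phi(t_{[n],\,n+[m]},\,t_{n+[m],\,n+m+[p]})$. The unit constraints are identities. **Quotients and contractions.** Let $D=\langle r,s\mid s^2=(rs)^2=1\rangle$, with $D\to S_n$, $r\mapsto(i\mapsto i+1\bmod n)$, $s\mapsto(i\mapsto n+1-i)$, and its lift $D\to\Gamma_{0,n}$, $r\mapsto\sigma_1\cdots\sigma_{n-1}$, $s\mapsto h_n$. Through $D\to S_n$, $D$ acts on the objects $(t,\underline s)$ of $\widetilde{\mathbf{PaDih}}_S$ and $\widetilde{\mathbf{PaDih}}{}_S^{gr}$ by renumbering the leaves of $t$ and by $\underline s\mapsto\underline s\circ g^{-1}$. For an object $X$ of degree $n$, let $i^g_X:X\to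 gX$ be the image of $g$ in $\Gamma_{0,n}$, respectively in $S_n\subset\exp(\hat{\mathfrak p}_n)\rtimes S_n$. The category $\mathbf{PaDih}_S=\widetilde{\mathbf{PaDih}}_S/D$ (respectively $\mathbf{PaDih}_S^{gr}=\widetilde{\mathbf{PaDih}}{}_S^{gr}/D$) has as set of objects the set of $D$-orbits of objects, and is the universal category with a functor $F$ from $\widetilde{\mathbf{PaDih}}_S$ (respectively $\widetilde{\mathbf{PaDih}}{}_S^{gr}$) such that $F(gX)=F(X)$ and $F(i^g_X)=\mathrm{id}_{F(X)}$ for all $g,X$. Both have the set of objects $\sqcup_n(PlT_n\times S^n)/D$. The contractions $\langle-\rangle:\mathbf{PaB}_S\to\mathbf{PaDih}_S$ and $\langle-\rangle:\mathbf{PaCD}_S^\Phi\to\mathbf{PaDih}_S^{gr}$ are induced by $\pi$, by $B_n\to\Gamma_{0,n}$ and by $\mathfrak t_n\to\mathfrak p_n$, followed by the quotient functors. **Statement.** There is a unique functor $j_\Phi:\mathbf{PaB}_S\to\mathbf{PaCD}_S^\Phi$ which is the identity on objects and strictly compatible with tensor products, braidings and associativity constraints; and, for this $j_\Phi$, there exists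 a unique functor $k_\Phi:\mathbf{PaDih}_S\to\mathbf{PaDih}_S^{gr}$ which is the identity on objects and satisfies $$k_\Phi\circ\langle-\rangle=\langle-\rangle\circ j_\Phi .$$ -/

import Mathlib

open CategoryTheory

universe u v w

/-! ### Pro-unipotent groups attached to Lie algebras -/

section ExpGroup

attribute [local instance 100] LieRing.ofAssociativeRing

variable (K : Type u) [CommRing K] (L : Type v) [LieRing L] [LieAlgebra K L]

/-- In `U(L)`, any product of `N` elements of `L` is declared to be zero. -/
inductive TruncRel (N : ℕ) :
    UniversalEnvelopingAlgebra K L → UniversalEnvelopingAlgebra K L → Prop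
  | prod_eq_zero (l : List L) (h : l.length = N) :
      TruncRel N (l.map (UniversalEnvelopingAlgebra.ι K)).prod 0

/-- The quotient `U(L) / I^N`, where `I` is the augmentation ideal of the universal enveloping
algebra `U(L)`. -/
abbrev TruncU (N : ℕ) : Type (max u v) := RingQuot (TruncRel K L N)

noncomputable instance [Algebra ℚ K] (N : ℕ) : Algebra ℚ (TruncU K L N) :=
  Algebra.compHom _ (algebraMap ℚ K)

namespace TruncU

/-- The canonical map `L → U(L) / I^N`. -/
noncomputable def ι (N : ℕ) : L →ₗ⁅K⁆ TruncU K L N :=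
  ((RingQuot.mkAlgHom K (TruncRel K L N) :
      UniversalEnvelopingAlgebra K L →ₐ[K] TruncU K L N) :
      UniversalEnvelopingAlgebra K L →ₗ⁅K⁆ TruncU K L N).comp (UniversalEnvelopingAlgebra.ι K)

theorem prod_ι_eq_zero {N : ℕ} (l : List L) (h : l.length = N) :
    (l.map (ι K L N)).prod = 0 := by
  have := RingQuot.mkAlgHom_rel K (TruncRel.prod_eq_zero (K := K) l h)
  rw [map_list_prod, List.map_map, map_zero] at this
  exact this

variable {L}

theorem isNilpotent_ι {N : ℕ} (y : L) : IsNilpotent (ι K L N y) := by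
  refine ⟨N, ?_⟩
  have := prod_ι_eq_zero K L (N := N) (List.replicate N y) (by simp)
  simpa using this

/-- The universal property of `U(L) / I^N`. -/
noncomputable def lift {A : Type w} [Ring A] [Algebra K A] {N : ℕ} (f : L →ₗ⁅K⁆ A)
    (hf : ∀ l : List L, l.length = N → (l.map f).prod = 0) : TruncU K L N →ₐ[K] A :=
  RingQuot.liftAlgHom K ⟨UniversalEnvelopingAlgebra.lift K f, by
    rintro _ _ ⟨l, h⟩
    rw [map_list_prod, List.map_map, map_zero, UniversalEnvelopingAlgebra.ι_comp_lift]
    exact hf l h⟩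

theorem lift_ι {A : Type w} [Ring A] [Algebra K A] {N : ℕ} (f : L →ₗ⁅K⁆ A)
    (hf : ∀ l : List L, l.length = N → (l.map f).prod = 0) (y : L) :
    lift K f hf (ι K L N y) = f y := by
  have h1 : lift K f hf (ι K L N y) = UniversalEnvelopingAlgebra.lift K f
      (UniversalEnvelopingAlgebra.ι K y) := by
    unfold lift ι
    exact RingQuot.liftAlgHom_mkAlgHom_apply ..
  rw [h1, UniversalEnvelopingAlgebra.lift_ι_apply]

theorem hom_ext {A : Type w} [Ring A] [Algebra K A] {N : ℕ} {f g : TruncU K L N →ₐ[K] A}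
    (h : ∀ y, f (ι K L N y) = g (ι K L N y)) : f = g := by
  refine RingQuot.ringQuot_ext' K _ _ ?_
  refine UniversalEnvelopingAlgebra.hom_ext K ?_
  ext y
  exact h y

variable (L) in
/-- The projection `U(L) / I^(N+1) → U(L) / I^N`. -/
noncomputable def proj (N : ℕ) : TruncU K L (N + 1) →ₐ[K] TruncU K L N :=
  lift K (ι K L N) (by
    intro l h
    match l, h with
    | x :: l, h =>
      rw [List.map_cons, List.prod_cons, prod_ι_eq_zero K L l (by simpa using h), mul_zero])

variable {L' : Type v} [LieRing L'] [LieAlgebra K L']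
  {L'' : Type v} [LieRing L''] [LieAlgebra K L'']

/-- Functoriality of `U(L) / I^N` in `L`. -/
noncomputable def map (N : ℕ) (f : L →ₗ⁅K⁆ L') : TruncU K L N →ₐ[K] TruncU K L' N :=
  lift K ((ι K L' N).comp f) (by
    intro l h
    have := prod_ι_eq_zero K L' (l.map f) (by simpa using h)
    rw [List.map_map] at this
    exact this)

theorem map_ι (N : ℕ) (f : L →ₗ⁅K⁆ L') (y : L) :
    map K N f (ι K L N y) = ι K L' N (f y) := lift_ι ..

theorem proj_ι (N : ℕ) (y : L) : proj K L N (ι K L (N + 1) y) = ι K L N y := lift_ι ..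

theorem map_id (N : ℕ) : map K N (LieHom.id : L →ₗ⁅K⁆ L) = AlgHom.id K _ :=
  hom_ext K fun y => by simp [map_ι]

theorem map_comp (N : ℕ) (g : L' →ₗ⁅K⁆ L'') (f : L →ₗ⁅K⁆ L') :
    map K N (g.comp f) = (map K N g).comp (map K N f) :=
  hom_ext K fun y => by simp [map_ι]

theorem proj_map (N : ℕ) (f : L →ₗ⁅K⁆ L') :
    (proj K L' N).comp (map K (N + 1) f) = (map K N f).comp (proj K L N) :=
  hom_ext K fun y => by simp [map_ι, proj_ι]

end TruncU

variable [Algebra ℚ K]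

/-- The subgroup of `(U(L) / I^N)ˣ` generated by the exponentials of the elements of `L`. By the
Baker-Campbell-Hausdorff formula, these exponentials already form a subgroup. -/
noncomputable def expSubgroup (N : ℕ) : Subgroup (TruncU K L N)ˣ :=
  Subgroup.closure {x | ∃ y : L, (x : TruncU K L N) = IsNilpotent.exp (TruncU.ι K L N y)}

/-- For a Lie algebra `L` which is graded and generated in degree one, the group `exp(L^)`, where
`L^` is the degree completion of `L`: its elements are the compatible families of elements of the
groups `exp(L / L_{≥ N}) ⊆ (U(L) / I^N)ˣ`. -/
noncomputable def expGroup : Subgroup ((N : ℕ) → (TruncU K L N)ˣ) where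
  carrier := {x | (∀ N, x N ∈ expSubgroup K L N) ∧
    ∀ N, TruncU.proj K L N (x (N + 1)) = x N}
  mul_mem' hx hy := ⟨fun N => mul_mem (hx.1 N) (hy.1 N), fun N => by
    simp [hx.2 N, hy.2 N]⟩
  one_mem' := ⟨fun N => one_mem _, fun N => by simp⟩
  inv_mem' {x} hx := ⟨fun N => inv_mem (hx.1 N), fun N => by
    have h : Units.map (TruncU.proj K L N : _ →* _) (x (N + 1)) = x N := Units.ext (hx.2 N)
    have h2 := congrArg Units.val (congrArg Inv.inv h)
    rw [← map_inv] at h2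
    exact h2⟩

namespace expGroup

variable {L}

/-- The exponential of an element of `L`. -/
noncomputable def exp (y : L) : expGroup K L where
  val N :=
    { val := IsNilpotent.exp (TruncU.ι K L N y)
      inv := IsNilpotent.exp (-TruncU.ι K L N y)
      val_inv := IsNilpotent.exp_mul_exp_neg_self (TruncU.isNilpotent_ι K y)
      inv_val := IsNilpotent.exp_neg_mul_exp_self (TruncU.isNilpotent_ι K y) }
  property := by
    refine ⟨fun N => Subgroup.subset_closure ⟨y, rfl⟩, fun N => ?_⟩
    change TruncU.proj K L N (IsNilpotent.exp _) = IsNilpotent.exp _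
    rw [IsNilpotent.map_exp (TruncU.isNilpotent_ι K y), TruncU.proj_ι]

variable {L' : Type v} [LieRing L'] [LieAlgebra K L']
  {L'' : Type v} [LieRing L''] [LieAlgebra K L'']

/-- The group morphism `exp(L^) → exp(L'^)` induced by a Lie algebra morphism `L → L'`. -/
noncomputable def map (f : L →ₗ⁅K⁆ L') : expGroup K L →* expGroup K L' where
  toFun x := ⟨fun N => Units.map (TruncU.map K N f : _ →* _) (x.1 N), by
    refine ⟨fun N => ?_, fun N => ?_⟩
    · have hle : expSubgroup K L N ≤
          (expSubgroup K L' N).comap (Units.map (TruncU.map K N f : _ →* _)) := by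
        refine (Subgroup.closure_le _).2 ?_
        rintro z ⟨y, hy⟩
        refine Subgroup.subset_closure ⟨f y, ?_⟩
        change TruncU.map K N f (z : TruncU K L N) = _
        rw [hy, IsNilpotent.map_exp (TruncU.isNilpotent_ι K y), TruncU.map_ι]
      exact hle (x.2.1 N)
    · have h := DFunLike.congr_fun (TruncU.proj_map K N f) ((x.1 (N + 1) : TruncU K L (N + 1)))
      have h2 := x.2.2 N
      simp only [AlgHom.comp_apply] at h
      rw [h2] at h
      exact h⟩
  map_one' := by ext N; simp
  map_mul' x y := by ext N; simp

theorem map_id : map K (LieHom.id : L →ₗ⁅K⁆ L) = MonoidHom.id _ := by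
  ext x N
  change TruncU.map K N LieHom.id _ = _
  rw [TruncU.map_id]; rfl

theorem map_comp (g : L' →ₗ⁅K⁆ L'') (f : L →ₗ⁅K⁆ L') :
    map K (g.comp f) = (map K g).comp (map K f) := by
  ext x N
  change TruncU.map K N (g.comp f) _ = _
  rw [TruncU.map_comp]; rfl

end expGroup

end ExpGroup

/-! ### The Lie algebras `t_n` and `p_n` -/

section LieAlgebras

variable (K : Type u) [CommRing K]

/-- The Lie algebra over `K` with generators `X` and relations `R`. -/
def LiePres {X : Type v} (R : Set (FreeLieAlgebra K X)) : Type (max u v) :=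
  FreeLieAlgebra K X ⧸ LieSubmodule.lieSpan K (FreeLieAlgebra K X) R

noncomputable instance {X : Type v} (R : Set (FreeLieAlgebra K X)) : LieRing (LiePres K R) :=
  inferInstanceAs (LieRing (_ ⧸ LieSubmodule.lieSpan K (FreeLieAlgebra K X) R))

noncomputable instance {X : Type v} (R : Set (FreeLieAlgebra K X)) :
    LieAlgebra K (LiePres K R) :=
  inferInstanceAs (LieAlgebra K (_ ⧸ LieSubmodule.lieSpan K (FreeLieAlgebra K X) R))

namespace LiePres

variable {X : Type v} (R : Set (FreeLieAlgebra K X))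

/-- The projection from the free Lie algebra. -/
noncomputable def mk : FreeLieAlgebra K X →ₗ⁅K⁆ LiePres K R where
  toLinearMap := Submodule.mkQ _
  map_lie' := rfl

theorem mk_eq_zero {x : FreeLieAlgebra K X} (h : x ∈ R) : mk K R x = 0 :=
  (Submodule.Quotient.mk_eq_zero _).2 (LieSubmodule.subset_lieSpan h)

theorem mk_surjective : Function.Surjective (mk K R) := Submodule.mkQ_surjective _

variable {R} {L : Type w} [LieRing L] [LieAlgebra K L]

/-- The universal property of a Lie algebra given by generators and relations. -/
noncomputable def lift (f : X → L) (hf : ∀ x ∈ R, FreeLieAlgebra.lift K f x = 0) :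
    LiePres K R →ₗ⁅K⁆ L where
  toLinearMap := Submodule.liftQ _ (FreeLieAlgebra.lift K f : FreeLieAlgebra K X →ₗ[K] L) (by
    intro x hx
    have : LieSubmodule.lieSpan K (FreeLieAlgebra K X) R ≤ (FreeLieAlgebra.lift K f).ker :=
      LieSubmodule.lieSpan_le.2 fun x hx => by simpa using hf x hx
    simpa using this hx)
  map_lie' := by
    intro x y
    obtain ⟨x, rfl⟩ := mk_surjective K R x
    obtain ⟨y, rfl⟩ := mk_surjective K R y
    exact (FreeLieAlgebra.lift K f).map_lie x y

theorem lift_mk (f : X → L) (hf : ∀ x ∈ R, FreeLieAlgebra.lift K f x = 0)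
    (x : FreeLieAlgebra K X) : lift K f hf (mk K R x) = FreeLieAlgebra.lift K f x := rfl

theorem hom_ext {f g : LiePres K R →ₗ⁅K⁆ L}
    (h : ∀ x, f (mk K R (FreeLieAlgebra.of K x)) = g (mk K R (FreeLieAlgebra.of K x))) :
    f = g := by
  have : f.comp (mk K R) = g.comp (mk K R) := FreeLieAlgebra.hom_ext h
  ext x
  obtain ⟨x, rfl⟩ := mk_surjective K R x
  exact DFunLike.congr_fun this x

end LiePres

/-- Ordered pairs of distinct elements of `{1, …, n}`. -/
abbrev DistinctPair (n : ℕ) : Type := {q : Fin n × Fin n // q.1 ≠ q.2}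

/-- The generator `t_ij` of the free Lie algebra on the ordered pairs of distinct indices
(and `0` if `i = j`). -/
noncomputable def freeT {n : ℕ} (i j : Fin n) : FreeLieAlgebra K (DistinctPair n) :=
  if h : i ≠ j then FreeLieAlgebra.of K ⟨(i, j), h⟩ else 0

/-- The defining relations of `t_n`. -/
inductive TRel (n : ℕ) : Set (FreeLieAlgebra K (DistinctPair n))
  | symm (i j : Fin n) (hij : i ≠ j) : TRel n (freeT K j i - freeT K i j)
  | triple (i j k : Fin n) (hij : i ≠ j) (hik : i ≠ k) (hjk : j ≠ k) :
      TRel n ⁅freeT K i j, freeT K i k + freeT K j k⁆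
  | quad (i j k l : Fin n) (hij : i ≠ j) (hik : i ≠ k) (hil : i ≠ l) (hjk : j ≠ k)
      (hjl : j ≠ l) (hkl : k ≠ l) : TRel n ⁅freeT K i j, freeT K k l⁆

/-- The defining relations of `p_n`: those of `t_n`, and `∑_{j ≠ i} t_ij = 0` for all `i`. -/
inductive PRel (n : ℕ) : Set (FreeLieAlgebra K (DistinctPair n))
  | ofT {x : FreeLieAlgebra K (DistinctPair n)} (hx : TRel K n x) : PRel n x
  | sum (i : Fin n) : PRel n (∑ j ∈ Finset.univ.erase i, freeT K i j)

/-- The Lie algebra `t_n` over `K`. -/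
abbrev LieT (n : ℕ) : Type u := LiePres K (TRel K n)

/-- The Lie algebra `p_n` over `K`. -/
abbrev LieP (n : ℕ) : Type u := LiePres K (PRel K n)

/-- The element `t_ij` of `t_n`. -/
noncomputable def LieT.t {n : ℕ} (i j : Fin n) : LieT K n := LiePres.mk K _ (freeT K i j)

/-- The element `t_ij` of `p_n`. -/
noncomputable def LieP.t {n : ℕ} (i j : Fin n) : LieP K n := LiePres.mk K _ (freeT K i j)

theorem lift_freeT {n : ℕ} {L : Type w} [LieRing L] [LieAlgebra K L]
    (f : DistinctPair n → L) (g : Fin n → Fin n → L)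
    (hfg : ∀ q, f q = g q.1.1 q.1.2) {i j : Fin n} (h : i ≠ j) :
    FreeLieAlgebra.lift K f (freeT K i j) = g i j := by
  rw [freeT, dif_pos h, FreeLieAlgebra.lift_of_apply, hfg]

/-- Values of a map on the generators of `t_n` satisfying the relations kill all relators. -/
theorem lift_TRel {n : ℕ} {L : Type w} [LieRing L] [LieAlgebra K L] (g : Fin n → Fin n → L)
    (hs : ∀ i j, i ≠ j → g j i = g i j)
    (h3 : ∀ i j k, i ≠ j → i ≠ k → j ≠ k → ⁅g i j, g i k + g j k⁆ = 0)
    (h4 : ∀ i j k l, i ≠ j → i ≠ k → i ≠ l → j ≠ k → j ≠ l → k ≠ l → ⁅g i j, g k l⁆ = 0)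
    (x : FreeLieAlgebra K (DistinctPair n)) (hx : x ∈ TRel K n) :
    FreeLieAlgebra.lift K (fun q : DistinctPair n => g q.1.1 q.1.2) x = 0 := by
  have key : ∀ {i j : Fin n}, i ≠ j →
      FreeLieAlgebra.lift K (fun q : DistinctPair n => g q.1.1 q.1.2) (freeT K i j) = g i j :=
    fun h => lift_freeT K _ g (fun _ => rfl) h
  cases hx with
  | symm i j hij => rw [map_sub, key hij, key hij.symm, hs i j hij, sub_self]
  | triple i j k hij hik hjk =>
    rw [LieHom.map_lie, map_add, key hij, key hik, key hjk, h3 i j k hij hik hjk]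
  | quad i j k l hij hik hil hjk hjl hkl =>
    rw [LieHom.map_lie, key hij, key hkl, h4 i j k l hij hik hil hjk hjl hkl]

/-- The Lie algebra morphism `t_n → t_m`, `t_ij ↦ t_{e(i) e(j)}` for an injection `e`. -/
noncomputable def LieT.map {n m : ℕ} (e : Fin n ↪ Fin m) : LieT K n →ₗ⁅K⁆ LieT K m :=
  LiePres.lift K (fun q : DistinctPair n => LieT.t K (e q.1.1) (e q.1.2)) <| by
    have ne : ∀ {i j : Fin n}, i ≠ j → e i ≠ e j := fun h h' => h (e.injective h')
    refine lift_TRel K (fun i j => LieT.t K (e i) (e j)) ?_ ?_ ?_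
    · intro i j h
      have := LiePres.mk_eq_zero K _ (TRel.symm (K := K) (e i) (e j) (ne h))
      rw [map_sub, sub_eq_zero] at this
      exact this
    · intro i j k h1 h2 h3
      have := LiePres.mk_eq_zero K _ (TRel.triple (K := K) (e i) (e j) (e k) (ne h1) (ne h2) (ne h3))
      rw [LieHom.map_lie, map_add] at this
      exact this
    · intro i j k l h1 h2 h3 h4 h5 h6
      have := LiePres.mk_eq_zero K _ (TRel.quad (K := K) (e i) (e j) (e k) (e l)
        (ne h1) (ne h2) (ne h3) (ne h4) (ne h5) (ne h6))
      rw [LieHom.map_lie] at this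
      exact this

/-- The projection `t_n → p_n`, `t_ij ↦ t_ij`. -/
noncomputable def LieT.toP (n : ℕ) : LieT K n →ₗ⁅K⁆ LieP K n :=
  LiePres.lift K (fun q : DistinctPair n => LieP.t K q.1.1 q.1.2) <| by
    refine lift_TRel K (LieP.t K) ?_ ?_ ?_
    · intro i j h
      have := LiePres.mk_eq_zero K _ (PRel.ofT (TRel.symm (K := K) i j h))
      rw [map_sub, sub_eq_zero] at this
      exact this
    · intro i j k h1 h2 h3
      have := LiePres.mk_eq_zero K _ (PRel.ofT (TRel.triple (K := K) i j k h1 h2 h3))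
      rw [LieHom.map_lie, map_add] at this
      exact this
    · intro i j k l h1 h2 h3 h4 h5 h6
      have := LiePres.mk_eq_zero K _ (PRel.ofT (TRel.quad (K := K) i j k l h1 h2 h3 h4 h5 h6))
      rw [LieHom.map_lie] at this
      exact this

/-- The Lie algebra endomorphism `t_ij ↦ t_{σ(i) σ(j)}` of `p_n` for a permutation `σ`. -/
noncomputable def LieP.map {n : ℕ} (σ : Equiv.Perm (Fin n)) : LieP K n →ₗ⁅K⁆ LieP K n :=
  LiePres.lift K (fun q : DistinctPair n => LieP.t K (σ q.1.1) (σ q.1.2)) <| by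
    have ne : ∀ {i j : Fin n}, i ≠ j → σ i ≠ σ j := fun h h' => h (σ.injective h')
    intro x hx
    cases hx with
    | ofT hx =>
      refine lift_TRel K (fun i j => LieP.t K (σ i) (σ j)) ?_ ?_ ?_ x hx
      · intro i j h
        have := LiePres.mk_eq_zero K _ (PRel.ofT (TRel.symm (K := K) (σ i) (σ j) (ne h)))
        rw [map_sub, sub_eq_zero] at this
        exact this
      · intro i j k h1 h2 h3
        have := LiePres.mk_eq_zero K _ (PRel.ofT
          (TRel.triple (K := K) (σ i) (σ j) (σ k) (ne h1) (ne h2) (ne h3)))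
        rw [LieHom.map_lie, map_add] at this
        exact this
      · intro i j k l h1 h2 h3 h4 h5 h6
        have := LiePres.mk_eq_zero K _ (PRel.ofT (TRel.quad (K := K) (σ i) (σ j) (σ k) (σ l)
          (ne h1) (ne h2) (ne h3) (ne h4) (ne h5) (ne h6)))
        rw [LieHom.map_lie] at this
        exact this
    | sum i =>
      have := LiePres.mk_eq_zero K _ (PRel.sum (K := K) (σ i))
      rw [map_sum] at this ⊢
      rw [← this]
      refine Finset.sum_bij (fun j _ => σ j) ?_ ?_ ?_ ?_
      · intro j hj
        simpa using hj
      · intro a _ b _ h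
        exact σ.injective h
      · intro b hb
        refine ⟨σ.symm b, ?_, by simp⟩
        simp only [Finset.mem_erase, Finset.mem_univ, and_true] at hb ⊢
        rintro rfl
        simp at hb
      · intro j hj
        exact lift_freeT K _ (fun i j => LieP.t K (σ i) (σ j)) (fun _ => rfl)
          (Finset.ne_of_mem_erase hj).symm

theorem LieT.map_t {n m : ℕ} (e : Fin n ↪ Fin m) {i j : Fin n} (h : i ≠ j) :
    LieT.map K e (LieT.t K i j) = LieT.t K (e i) (e j) :=
  lift_freeT K _ (fun i j => LieT.t K (e i) (e j)) (fun _ => rfl) h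

theorem LieT.toP_t {n : ℕ} {i j : Fin n} (h : i ≠ j) :
    LieT.toP K n (LieT.t K i j) = LieP.t K i j :=
  lift_freeT K _ (LieP.t K) (fun _ => rfl) h

theorem LieP.map_t {n : ℕ} (σ : Equiv.Perm (Fin n)) {i j : Fin n} (h : i ≠ j) :
    LieP.map K σ (LieP.t K i j) = LieP.t K (σ i) (σ j) :=
  lift_freeT K _ (fun i j => LieP.t K (σ i) (σ j)) (fun _ => rfl) h

theorem LieT.hom_ext {n : ℕ} {L : Type w} [LieRing L] [LieAlgebra K L] {f g : LieT K n →ₗ⁅K⁆ L}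
    (h : ∀ i j, i ≠ j → f (LieT.t K i j) = g (LieT.t K i j)) : f = g :=
  LiePres.hom_ext K fun q => by
    have := h q.1.1 q.1.2 q.2
    rwa [LieT.t, freeT, dif_pos q.2] at this

theorem LieP.hom_ext {n : ℕ} {L : Type w} [LieRing L] [LieAlgebra K L] {f g : LieP K n →ₗ⁅K⁆ L}
    (h : ∀ i j, i ≠ j → f (LieP.t K i j) = g (LieP.t K i j)) : f = g :=
  LiePres.hom_ext K fun q => by
    have := h q.1.1 q.1.2 q.2
    rwa [LieP.t, freeT, dif_pos q.2] at this

variable [Algebra ℚ K]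

/-- The action by automorphisms attached to a compatible family of endomorphisms. -/
def actOf {P G : Type*} [Group P] [Group G] (F : P → (G →* G)) (h1 : F 1 = MonoidHom.id G)
    (hm : ∀ σ τ, F (σ * τ) = (F σ).comp (F τ)) : P →* MulAut G where
  toFun σ :=
    { toFun := F σ
      invFun := F σ⁻¹
      left_inv := fun x => by
        rw [← MonoidHom.comp_apply, ← hm, inv_mul_cancel, h1, MonoidHom.id_apply]
      right_inv := fun x => by
        rw [← MonoidHom.comp_apply, ← hm, mul_inv_cancel, h1, MonoidHom.id_apply]
      map_mul' := map_mul (F σ) }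
  map_one' := by ext x; exact DFunLike.congr_fun h1 x
  map_mul' σ τ := by ext x; exact DFunLike.congr_fun (hm σ τ) x

/-- The action of `S_n` on `exp(t_n^)` induced by `σ(t_ij) = t_{σ(i) σ(j)}`. -/
noncomputable def actT (n : ℕ) : Equiv.Perm (Fin n) →* MulAut (expGroup K (LieT K n)) :=
  actOf (fun σ => expGroup.map K (LieT.map K σ.toEmbedding))
    (by
      have : LieT.map K (1 : Equiv.Perm (Fin n)).toEmbedding = LieHom.id :=
        LieT.hom_ext K fun i j h => by rw [LieT.map_t K _ h]; rfl
      rw [this, expGroup.map_id])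
    (fun σ τ => by
      have : LieT.map K (σ * τ).toEmbedding =
          (LieT.map K σ.toEmbedding).comp (LieT.map K τ.toEmbedding) :=
        LieT.hom_ext K fun i j h => by
          rw [LieHom.comp_apply, LieT.map_t K _ h, LieT.map_t K _ h,
            LieT.map_t K _ (τ.toEmbedding.injective.ne h)]; rfl
      rw [this, expGroup.map_comp])

/-- The action of `S_n` on `exp(p_n^)` induced by `σ(t_ij) = t_{σ(i) σ(j)}`. -/
noncomputable def actP (n : ℕ) : Equiv.Perm (Fin n) →* MulAut (expGroup K (LieP K n)) :=
  actOf (fun σ => expGroup.map K (LieP.map K σ))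
    (by
      have : LieP.map K (1 : Equiv.Perm (Fin n)) = LieHom.id :=
        LieP.hom_ext K fun i j h => by rw [LieP.map_t K _ h]; rfl
      rw [this, expGroup.map_id])
    (fun σ τ => by
      have : LieP.map K (σ * τ) = (LieP.map K σ).comp (LieP.map K τ) :=
        LieP.hom_ext K fun i j h => by
          rw [LieHom.comp_apply, LieP.map_t K _ h, LieP.map_t K _ h,
            LieP.map_t K _ (τ.injective.ne h)]; rfl
      rw [this, expGroup.map_comp])

/-- The group `exp(t_n^) ⋊ S_n`. -/
abbrev GrpT (n : ℕ) : Type u := expGroup K (LieT K n) ⋊[actT K n] Equiv.Perm (Fin n)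

/-- The group `exp(p_n^) ⋊ S_n`. -/
abbrev GrpP (n : ℕ) : Type u := expGroup K (LieP K n) ⋊[actP K n] Equiv.Perm (Fin n)

/-- The projection `exp(t_n^) ⋊ S_n → exp(p_n^) ⋊ S_n`. -/
noncomputable def GrpT.toGrpP (n : ℕ) : GrpT K n →* GrpP K n :=
  SemidirectProduct.map (expGroup.map K (LieT.toP K n)) (MonoidHom.id _) (by
    intro σ
    have : (LieT.toP K n).comp (LieT.map K σ.toEmbedding) = (LieP.map K σ).comp (LieT.toP K n) :=
      LieT.hom_ext K fun i j h => by
        rw [LieHom.comp_apply, LieHom.comp_apply, LieT.map_t K _ h, LieT.toP_t K h,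
          LieP.map_t K _ h, LieT.toP_t K (σ.toEmbedding.injective.ne h)]; rfl
    change (expGroup.map K (LieT.toP K n)).comp (expGroup.map K (LieT.map K σ.toEmbedding)) =
      (expGroup.map K (LieP.map K σ)).comp (expGroup.map K (LieT.toP K n))
    rw [← expGroup.map_comp, this, expGroup.map_comp])

end LieAlgebras
/-! ### Words in the generators of braid groups -/

section Words

variable {G : Type*} [Group G] (s : ℕ → G)

/-- The product `s_0 s_1 ⋯ s_{N-1}`. -/
def upWord (N : ℕ) : G := ((List.range N).map s).prod

/-- The product `s_{N-1} ⋯ s_1 s_0`. -/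
def downWord (N : ℕ) : G := ((List.range N).reverse.map s).prod

/-- The product `s_0 (s_1 s_0) ⋯ (s_{N-1} ⋯ s_1 s_0)`. -/
def halfWord (N : ℕ) : G := ((List.range N).map fun i => downWord s (i + 1)).prod

/-- The product `(s_{m-1} ⋯ s_0) (s_m ⋯ s_1) ⋯ (s_{n+m-2} ⋯ s_{n-1})`. -/
def crossWord (n m : ℕ) : G :=
  ((List.range n).map fun i => downWord (fun j => s (i + j)) m).prod

@[simp] theorem upWord_zero : upWord s 0 = 1 := rfl
@[simp] theorem downWord_zero : downWord s 0 = 1 := rfl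
@[simp] theorem halfWord_zero : halfWord s 0 = 1 := rfl
@[simp] theorem crossWord_zero (m : ℕ) : crossWord s 0 m = 1 := rfl

theorem upWord_succ (N : ℕ) : upWord s (N + 1) = upWord s N * s N := by
  simp [upWord, List.range_succ]

theorem downWord_succ (N : ℕ) : downWord s (N + 1) = s N * downWord s N := by
  simp [downWord, List.range_succ]

theorem halfWord_succ (N : ℕ) : halfWord s (N + 1) = halfWord s N * downWord s (N + 1) := by
  simp [halfWord, List.range_succ]

theorem crossWord_succ (n m : ℕ) :
    crossWord s (n + 1) m = crossWord s n m * downWord (fun j => s (n + j)) m := by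
  simp [crossWord, List.range_succ]

theorem map_upWord {H : Type*} [Group H] (f : G →* H) (N : ℕ) :
    f (upWord s N) = upWord (fun i => f (s i)) N := by
  induction N with
  | zero => simp
  | succ N ih => rw [upWord_succ, upWord_succ, map_mul, ih]

theorem map_downWord {H : Type*} [Group H] (f : G →* H) (N : ℕ) :
    f (downWord s N) = downWord (fun i => f (s i)) N := by
  induction N with
  | zero => simp
  | succ N ih => rw [downWord_succ, downWord_succ, map_mul, ih]

theorem map_halfWord {H : Type*} [Group H] (f : G →* H) (N : ℕ) :
    f (halfWord s N) = halfWord (fun i => f (s i)) N := by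
  induction N with
  | zero => simp
  | succ N ih => rw [halfWord_succ, halfWord_succ, map_mul, ih, map_downWord]

theorem map_crossWord {H : Type*} [Group H] (f : G →* H) (n m : ℕ) :
    f (crossWord s n m) = crossWord (fun i => f (s i)) n m := by
  induction n with
  | zero => simp
  | succ n ih => rw [crossWord_succ, crossWord_succ, map_mul, ih, map_downWord]

/-- The Artin relations between `s_0, …, s_{N-1}`. -/
structure ArtinRels (N : ℕ) : Prop where
  braid : ∀ i, i + 1 < N → s i * s (i + 1) * s i = s (i + 1) * s i * s (i + 1)
  comm : ∀ i j, i + 1 < j → j < N → s i * s j = s j * s i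

namespace ArtinRels

variable {s}

theorem mono {N M : ℕ} (h : ArtinRels s N) (hM : M ≤ N) : ArtinRels s M :=
  ⟨fun i hi => h.braid i (by omega), fun i j hij hj => h.comm i j hij (by omega)⟩

theorem commute_up {N : ℕ} (h : ArtinRels s N) {j M : ℕ} (hM : M < j) (hj : j < N) :
    Commute (s j) (upWord s M) := by
  induction M with
  | zero => simp
  | succ M ih =>
    rw [upWord_succ]
    exact (ih (by omega)).mul_right (h.comm M j (by omega) hj).symm

theorem commute_down {N : ℕ} (h : ArtinRels s N) {j M : ℕ} (hM : M < j) (hj : j < N) :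
    Commute (s j) (downWord s M) := by
  induction M with
  | zero => simp
  | succ M ih =>
    rw [downWord_succ]
    exact Commute.mul_right (h.comm M j (by omega) hj).symm (ih (by omega))

theorem commute_half {N : ℕ} (h : ArtinRels s N) {j M : ℕ} (hM : M < j) (hj : j < N) :
    Commute (s j) (halfWord s M) := by
  induction M with
  | zero => simp
  | succ M ih =>
    rw [halfWord_succ]
    exact (ih (by omega)).mul_right (h.commute_down hM hj)

theorem up_mul {N : ℕ} (h : ArtinRels s N) {i : ℕ} (hi : i + 1 < N) :
    upWord s N * s i = s (i + 1) * upWord s N := by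
  induction N with
  | zero => omega
  | succ N ih =>
    by_cases hN : i + 1 < N
    · rw [upWord_succ, mul_assoc, ← h.comm i N hN (by omega), ← mul_assoc,
        ih (h.mono (by omega)) hN, mul_assoc]
    · obtain rfl : N = i + 1 := by omega
      have c := (h.commute_up (j := i + 1) (M := i) (by omega) (by omega)).eq
      rw [upWord_succ, upWord_succ, mul_assoc, mul_assoc, ← mul_assoc (s i), h.braid i hi,
        ← mul_assoc, ← mul_assoc, ← c]
      simp only [mul_assoc]

theorem down_mul {N : ℕ} (h : ArtinRels s N) {i : ℕ} (hi : i + 1 < N) :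
    downWord s N * s (i + 1) = s i * downWord s N := by
  induction N with
  | zero => omega
  | succ N ih =>
    by_cases hN : i + 1 < N
    · rw [downWord_succ, mul_assoc, ih (h.mono (by omega)) hN, ← mul_assoc,
        ← h.comm i N hN (by omega), mul_assoc]
    · obtain rfl : N = i + 1 := by omega
      have c := (h.commute_down (j := i + 1) (M := i) (by omega) (by omega)).eq
      have b := h.braid i hi
      rw [downWord_succ, downWord_succ, mul_assoc, mul_assoc, ← c, ← mul_assoc, ← mul_assoc,
        ← mul_assoc, ← b]
      simp only [mul_assoc]

theorem half_succ {N : ℕ} (h : ArtinRels s (N + 1)) :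
    halfWord s (N + 1) = upWord s (N + 1) * halfWord s N := by
  induction N with
  | zero => simp [halfWord_succ, downWord_succ, upWord_succ]
  | succ N ih =>
    have c := (h.commute_half (j := N + 1) (M := N) (by omega) (by omega)).eq
    have ih := ih (h.mono (by omega))
    rw [halfWord_succ s (N + 1), downWord_succ s (N + 1), upWord_succ s (N + 1), ih, mul_assoc,
      ← mul_assoc (halfWord s N), ← c, mul_assoc, mul_assoc, ← halfWord_succ, ih]

/-- The product `s_{N-1} s_{N-2} ⋯ s_{N-k}`. -/
theorem up_pow {N : ℕ} (h : ArtinRels s (N + 1)) (k : ℕ) (hk : k ≤ N + 1) :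
    upWord s (N + 1) ^ k = upWord s N ^ k * ((List.range k).map fun j => s (N - j)).prod := by
  induction k with
  | zero => simp
  | succ k ih =>
    have key : ∀ k, k ≤ N → ((List.range k).map fun j => s (N - j)).prod * upWord s (N + 1) =
        upWord s N * ((List.range (k + 1)).map fun j => s (N - j)).prod := by
      intro k hk
      induction k with
      | zero => simp [upWord_succ]
      | succ k ih =>
        have e : N - k = (N - (k + 1)) + 1 := by omega
        have u := h.up_mul (i := N - (k + 1)) (by omega)
        rw [← e] at u
        rw [List.range_succ, List.map_append, List.prod_append, List.map_singleton,
          List.prod_singleton, mul_assoc, ← u, ← mul_assoc, ih (by omega),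
          List.range_succ (n := k + 1), List.map_append, List.prod_append, List.map_singleton,
          List.prod_singleton, mul_assoc]
    rw [pow_succ, ih (by omega), mul_assoc, key k (by omega), ← mul_assoc, ← pow_succ]

theorem down_eq (N : ℕ) : ((List.range (N + 1)).map fun j => s (N - j)).prod =
    downWord s (N + 1) := by
  induction N with
  | zero => simp [downWord_succ]
  | succ N ih =>
    rw [List.range_succ_eq_map, List.map_cons, List.prod_cons, List.map_map, downWord_succ, ← ih]
    simp [Function.comp_def]

theorem half_sq_succ {N : ℕ} (h : ArtinRels s (N + 1)) :
    halfWord s (N + 1) ^ 2 = halfWord s N ^ 2 * (downWord s (N + 1) * upWord s (N + 1)) := by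
  have c : ∀ M, M ≤ N → Commute (downWord s (N + 1) * upWord s (N + 1)) (halfWord s M) := by
    have c1 : ∀ i, i < N → Commute (downWord s (N + 1) * upWord s (N + 1)) (s i) := by
      intro i hi
      change _ * _ = _ * _
      rw [mul_assoc, h.up_mul (by omega), ← mul_assoc, h.down_mul (by omega), mul_assoc]
    have c2 : ∀ M, M ≤ N → Commute (downWord s (N + 1) * upWord s (N + 1)) (downWord s M) := by
      intro M hM
      induction M with
      | zero => simp
      | succ M ih => rw [downWord_succ s M]; exact (c1 M (by omega)).mul_right (ih (by omega))
    intro M hM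
    induction M with
    | zero => simp
    | succ M ih => rw [halfWord_succ]; exact (ih (by omega)).mul_right (c2 _ hM)
  calc halfWord s (N + 1) ^ 2 = halfWord s (N + 1) * halfWord s (N + 1) := pow_two _
    _ = (halfWord s N * downWord s (N + 1)) * (upWord s (N + 1) * halfWord s N) := by
        rw [← h.half_succ, ← halfWord_succ]
    _ = halfWord s N * ((downWord s (N + 1) * upWord s (N + 1)) * halfWord s N) := by
        simp only [mul_assoc]
    _ = _ := by rw [(c N le_rfl).eq, ← mul_assoc, ← pow_two]

theorem half_sq {N : ℕ} (h : ArtinRels s N) : halfWord s N ^ 2 = upWord s N ^ (N + 1) := by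
  induction N with
  | zero => simp
  | succ N ih =>
    rw [h.half_sq_succ, ih (h.mono (by omega)), pow_succ (upWord s (N + 1)),
      h.up_pow (N + 1) le_rfl, down_eq, mul_assoc]

/-- The relations of the dihedral group hold as soon as the full twist and the
sphere word are trivial. -/
theorem dihedral {N : ℕ} (h : ArtinRels s N) (h1 : upWord s N ^ (N + 1) = 1)
    (h2 : upWord s N * downWord s N = 1) :
    halfWord s N ^ 2 = 1 ∧ (upWord s N * halfWord s N) ^ 2 = 1 := by
  have hh : halfWord s N ^ 2 = 1 := by rw [h.half_sq, h1]
  refine ⟨hh, ?_⟩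
  cases N with
  | zero => simp
  | succ N =>
    have h3 := h.half_sq_succ
    rw [hh, mul_eq_one_comm.1 h2, mul_one] at h3
    have h4 : (upWord s (N + 1))⁻¹ * halfWord s (N + 1) = halfWord s N := by
      rw [h.half_succ, inv_mul_cancel_left]
    rw [← h4] at h3
    have hi : (halfWord s (N + 1))⁻¹ = halfWord s (N + 1) := by
      rw [inv_eq_iff_mul_eq_one, ← pow_two, hh]
    have h5 := congrArg Inv.inv h3
    rw [inv_one, ← inv_pow, mul_inv_rev, inv_inv, hi, pow_two] at h5
    rw [pow_two, mul_assoc, mul_eq_one_comm]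
    simpa only [mul_assoc] using h5.symm

end ArtinRels

end Words

/-! ### Braid groups and mapping class groups in genus zero -/

/-- The relators of the Artin presentation of the braid group on `n` strands. -/
inductive BraidRel (n : ℕ) : Set (FreeGroup (Fin (n - 1)))
  | braid (i j : Fin (n - 1)) (h : (i : ℕ) + 1 = j) : BraidRel n
      (FreeGroup.of i * FreeGroup.of j * FreeGroup.of i *
        (FreeGroup.of j * FreeGroup.of i * FreeGroup.of j)⁻¹)
  | comm (i j : Fin (n - 1)) (h : (i : ℕ) + 1 < j) : BraidRel n
      (FreeGroup.of i * FreeGroup.of j * (FreeGroup.of j * FreeGroup.of i)⁻¹)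

/-- The braid group `B_n` of `n` strands in the plane. -/
abbrev Braid (n : ℕ) : Type := PresentedGroup (BraidRel n)

namespace Braid

/-- The generator `σ_{i+1}` of `B_n`, for `0 ≤ i < n - 1` (and `1` for other `i`). -/
def σ (n i : ℕ) : Braid n := if h : i < n - 1 then PresentedGroup.of ⟨i, h⟩ else 1

theorem artinRels (n : ℕ) : ArtinRels (σ n) (n - 1) where
  braid i hi := by
    have h0 : i < n - 1 := by omega
    have := PresentedGroup.one_of_mem (BraidRel.braid (n := n) ⟨i, h0⟩ ⟨i + 1, hi⟩ rfl)
    simp only [map_mul, map_inv] at this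
    rw [mul_inv_eq_one] at this
    simp only [σ, dif_pos h0, dif_pos hi]
    exact this
  comm i j hij hj := by
    have h0 : i < n - 1 := by omega
    have := PresentedGroup.one_of_mem (BraidRel.comm (n := n) ⟨i, h0⟩ ⟨j, hj⟩ hij)
    simp only [map_mul, map_inv] at this
    rw [mul_inv_eq_one] at this
    simp only [σ, dif_pos h0, dif_pos hj]
    exact this

/-- The universal property of the braid group. -/
def lift {G : Type*} [Group G] {n : ℕ} (s : ℕ → G) (hs : ArtinRels s (n - 1)) : Braid n →* G :=
  PresentedGroup.toGroup (f := fun i : Fin (n - 1) => s i) <| by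
    rintro _ (⟨i, j, h⟩ | ⟨i, j, h⟩)
    · have := hs.braid i (by omega)
      simp only [map_mul, map_inv, FreeGroup.lift_apply_of, mul_inv_eq_one, ← h]
      exact this
    · have := hs.comm i j h j.2
      simp only [map_mul, map_inv, FreeGroup.lift_apply_of, mul_inv_eq_one]
      exact this

theorem lift_σ {G : Type*} [Group G] {n : ℕ} (s : ℕ → G) (hs : ArtinRels s (n - 1)) {i : ℕ}
    (hi : i < n - 1) : lift s hs (σ n i) = s i := by
  rw [σ, dif_pos hi]
  exact PresentedGroup.toGroup.of _

end Braid

/-- The transposition `(i, i+1)` in the permutations of `{0, …, n-1}`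
(the identity if `i + 1 ≥ n`). -/
def transp (n i : ℕ) : Equiv.Perm (Fin n) :=
  if h : i + 1 < n then Equiv.swap ⟨i, by omega⟩ ⟨i + 1, h⟩ else 1

theorem transp_val {n i : ℕ} (h : i + 1 < n) (x : Fin n) :
    (transp n i x : ℕ) = if (x : ℕ) = i then i + 1 else if (x : ℕ) = i + 1 then i else x := by
  rw [transp, dif_pos h, Equiv.swap_apply_def]
  simp only [Fin.ext_iff]
  split_ifs <;> rfl

theorem transp_artinRels (n : ℕ) : ArtinRels (transp n) (n - 1) where
  braid i hi := by
    ext x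
    simp only [Equiv.Perm.mul_apply, transp_val (show i + 1 < n by omega),
      transp_val (show i + 1 + 1 < n by omega)]
    split_ifs <;> omega
  comm i j hij hj := by
    ext x
    simp only [Equiv.Perm.mul_apply, transp_val (show i + 1 < n by omega),
      transp_val (show j + 1 < n by omega)]
    split_ifs <;> omega

theorem down_transp_val {n i m : ℕ} (h : i + m < n) (x : Fin n) :
    (downWord (fun j => transp n (i + j)) m x : ℕ) =
      if (x : ℕ) = i then i + m else if i < (x : ℕ) ∧ (x : ℕ) ≤ i + m then (x : ℕ) - 1
        else (x : ℕ) := by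
  induction m with
  | zero => simp; split_ifs <;> omega
  | succ m ih =>
    rw [downWord_succ, Equiv.Perm.mul_apply, transp_val (by omega), ih (by omega)]
    split_ifs <;> omega

theorem up_transp_val {n m : ℕ} (h : m < n) (x : Fin n) :
    (upWord (transp n) m x : ℕ) =
      if (x : ℕ) < m then (x : ℕ) + 1 else if (x : ℕ) = m then 0 else (x : ℕ) := by
  induction m generalizing x with
  | zero => simp
  | succ m ih =>
    rw [upWord_succ, Equiv.Perm.mul_apply, ih (by omega), transp_val (by omega)]
    split_ifs <;> omega

theorem half_transp_val {n m : ℕ} (h : m < n) (x : Fin n) :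
    (halfWord (transp n) m x : ℕ) = if (x : ℕ) ≤ m then m - (x : ℕ) else (x : ℕ) := by
  induction m generalizing x with
  | zero => simp
  | succ m ih =>
    have := down_transp_val (i := 0) (m := m + 1) (by omega) x
    simp only [zero_add] at this
    rw [halfWord_succ, Equiv.Perm.mul_apply, ih (by omega), this]
    split_ifs <;> omega

theorem cross_transp_val {n k m : ℕ} (h : k + m ≤ n) (x : Fin n) :
    (crossWord (transp n) k m x : ℕ) =
      if (x : ℕ) < k then m + (x : ℕ) else if (x : ℕ) < k + m then (x : ℕ) - k
        else (x : ℕ) := by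
  induction k generalizing x with
  | zero => simp
  | succ k ih =>
    rw [crossWord_succ, Equiv.Perm.mul_apply, ih (by omega), down_transp_val (by omega)]
    split_ifs <;> omega

theorem up_transp (n : ℕ) : upWord (transp n) (n - 1) = finRotate n := by
  ext x
  have hx := x.2
  obtain ⟨m, rfl⟩ : ∃ m, n = m + 1 := ⟨n - 1, by omega⟩
  rw [up_transp_val (by omega), coe_finRotate]
  simp only [Fin.ext_iff, Fin.val_last]
  split_ifs <;> omega

theorem half_transp (n : ℕ) : halfWord (transp n) (n - 1) = Fin.revPerm := by
  ext x
  have hx := x.2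
  rw [half_transp_val (by omega), Fin.revPerm_apply, Fin.val_rev]
  split_ifs <;> omega

namespace Braid

/-- The morphism `B_n → S_n`, `σ_i ↦ (i, i+1)`. -/
def perm (n : ℕ) : Braid n →* Equiv.Perm (Fin n) := lift (transp n) (transp_artinRels n)

theorem perm_σ (n i : ℕ) : perm n (σ n i) = transp n i := by
  by_cases h : i < n - 1
  · exact lift_σ _ _ h
  · rw [σ, dif_neg h, map_one, transp, dif_neg (by omega)]

/-- The element `ρ = σ_1 ⋯ σ_{n-1}` of `B_n`. -/
def rho (n : ℕ) : Braid n := upWord (σ n) (n - 1)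

/-- The half-twist `h_n = σ_1 (σ_2 σ_1) ⋯ (σ_{n-1} ⋯ σ_1)`. -/
def half (n : ℕ) : Braid n := halfWord (σ n) (n - 1)

/-- The sphere element `σ_1 ⋯ σ_{n-1} σ_{n-1} ⋯ σ_1` of `B_n`. -/
def sphere (n : ℕ) : Braid n := upWord (σ n) (n - 1) * downWord (σ n) (n - 1)

/-- The braid `b_{n,m} = (σ_m ⋯ σ_1) ⋯ (σ_{n+m-1} ⋯ σ_n)`. -/
def cross (n m : ℕ) : Braid (n + m) := crossWord (σ (n + m)) n m

theorem perm_rho (n : ℕ) : perm n (rho n) = finRotate n := by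
  rw [rho, map_upWord]; simp only [perm_σ]; exact up_transp n

theorem perm_half (n : ℕ) : perm n (half n) = Fin.revPerm := by
  rw [half, map_halfWord]; simp only [perm_σ]; exact half_transp n

theorem perm_sphere (n : ℕ) : perm n (sphere n) = 1 := by
  rw [sphere, map_mul, map_upWord, map_downWord]; simp only [perm_σ]
  have hs : ∀ i, transp n i * transp n i = 1 := fun i => by
    rw [transp]; split_ifs <;> simp
  generalize n - 1 = N
  induction N with
  | zero => simp
  | succ N ih =>
    rw [upWord_succ, downWord_succ, mul_assoc, ← mul_assoc (transp n N), hs, one_mul, ih]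

/-- The permutation `i ↦ m + i` for `i ∈ [n]`, `n + i ↦ i` for `i ∈ [m]`. -/
def _root_.blockPerm (n m : ℕ) : Equiv.Perm (Fin (n + m)) :=
  finAddFlip.trans (finCongr (Nat.add_comm m n))

theorem perm_cross (n m : ℕ) : perm (n + m) (cross n m) = blockPerm n m := by
  rw [cross, map_crossWord]; simp only [perm_σ]
  ext x
  rw [cross_transp_val le_rfl]
  refine Fin.addCases (fun i => ?_) (fun i => ?_) x
  · simp [blockPerm, Nat.add_comm]
  · simp [blockPerm]

/-- The morphism `B_n → B_{n+m}`, `σ_i ↦ σ_i`. -/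
def inl (n m : ℕ) : Braid n →* Braid (n + m) :=
  lift (σ (n + m)) ((artinRels (n + m)).mono (by omega))

/-- The morphism `B_m → B_{n+m}`, `σ_i ↦ σ_{n+i}`. -/
def inr (n m : ℕ) : Braid m →* Braid (n + m) :=
  lift (fun i => σ (n + m) (n + i))
    ⟨fun i hi => (artinRels (n + m)).braid (n + i) (by omega),
      fun i j hij hj => (artinRels (n + m)).comm (n + i) (n + j) (by omega) (by omega)⟩

/-- The juxtaposition of braids `B_n × B_m → B_{n+m}`. -/
def juxt {n m : ℕ} (b : Braid n) (b' : Braid m) : Braid (n + m) := inl n m b * inr n m b'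

/-- The juxtaposition of permutations `S_n × S_m → S_{n+m}`. -/
def _root_.permJuxt {n m : ℕ} (σ : Equiv.Perm (Fin n)) (τ : Equiv.Perm (Fin m)) :
    Equiv.Perm (Fin (n + m)) :=
  finSumFinEquiv.permCongr (Equiv.Perm.sumCongr σ τ)

theorem hom_ext {G : Type*} [Group G] {n : ℕ} {f g : Braid n →* G}
    (h : ∀ i, i < n - 1 → f (σ n i) = g (σ n i)) : f = g :=
  PresentedGroup.ext fun i => by
    have := h i i.2
    rwa [σ, dif_pos i.2] at this

theorem perm_juxt {n m : ℕ} (b : Braid n) (b' : Braid m) :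
    perm (n + m) (juxt b b') = permJuxt (perm n b) (perm m b') := by
  let J : Equiv.Perm (Fin n) × Equiv.Perm (Fin m) →* Equiv.Perm (Fin (n + m)) :=
    (finSumFinEquiv.permCongrHom.toMonoidHom).comp (Equiv.Perm.sumCongrHom (Fin n) (Fin m))
  have hJ : ∀ σ τ, J (σ, τ) = permJuxt σ τ := fun _ _ => rfl
  have h1 : (perm (n + m)).comp (inl n m) = (J.comp (MonoidHom.inl _ _)).comp (perm n) := by
    refine hom_ext fun i hi => ?_
    simp only [MonoidHom.comp_apply, inl, lift_σ _ _ hi, perm_σ, MonoidHom.inl_apply, hJ]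
    ext x
    rw [transp_val (by omega)]
    refine Fin.addCases (fun y => ?_) (fun y => ?_) x
    · simp [permJuxt, Equiv.permCongr_apply, transp_val (show i + 1 < n by omega)]
    · simp [permJuxt, Equiv.permCongr_apply]; split_ifs <;> omega
  have h2 : (perm (n + m)).comp (inr n m) = (J.comp (MonoidHom.inr _ _)).comp (perm m) := by
    refine hom_ext fun i hi => ?_
    simp only [MonoidHom.comp_apply, inr, lift_σ _ _ hi, perm_σ, MonoidHom.inr_apply, hJ]
    ext x
    rw [transp_val (by omega)]
    refine Fin.addCases (fun y => ?_) (fun y => ?_) x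
    · simp [permJuxt, Equiv.permCongr_apply]; split_ifs <;> omega
    · simp [permJuxt, Equiv.permCongr_apply, transp_val (show i + 1 < m by omega)]
      split_ifs <;> omega
  have e1 := DFunLike.congr_fun h1 b
  have e2 := DFunLike.congr_fun h2 b'
  simp only [MonoidHom.comp_apply] at e1 e2
  rw [juxt, map_mul, e1, e2, ← map_mul, ← hJ]
  simp

end Braid

/-- The mapping class group
`Γ_{0,n} = B_n / ((σ_1 ⋯ σ_{n-1})^n, σ_1 ⋯ σ_{n-1}^2 ⋯ σ_1)`. -/
abbrev Gamma0 (n : ℕ) : Type :=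
  Braid n ⧸ Subgroup.normalClosure ({Braid.rho n ^ n, Braid.sphere n} : Set (Braid n))

namespace Gamma0

/-- The projection `B_n → Γ_{0,n}`. -/
def mk (n : ℕ) : Braid n →* Gamma0 n := QuotientGroup.mk' _

/-- The morphism `Γ_{0,n} → S_n` induced by `B_n → S_n`. -/
def perm (n : ℕ) : Gamma0 n →* Equiv.Perm (Fin n) :=
  QuotientGroup.lift _ (Braid.perm n) <| by
    have : Subgroup.normalClosure ({Braid.rho n ^ n, Braid.sphere n} : Set (Braid n)) ≤
        (Braid.perm n).ker := by
      refine Subgroup.normalClosure_le_normal ?_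
      rintro x (rfl | rfl)
      · change Braid.perm n _ = 1
        rw [map_pow, Braid.perm_rho]
        cases n with
        | zero => simp
        | succ n =>
          cases n with
          | zero => simp; rfl
          | succ n =>
            have := (isCycle_finRotate (n := n)).orderOf
            rw [support_finRotate, Finset.card_univ, Fintype.card_fin] at this
            exact orderOf_dvd_iff_pow_eq_one.1 (dvd_of_eq this)
      · exact Braid.perm_sphere n
    intro x hx
    exact this hx

theorem perm_mk (n : ℕ) (b : Braid n) : perm n (mk n b) = Braid.perm n b := rfl

theorem dihedral (n : ℕ) : mk n (Braid.half n) ^ 2 = 1 ∧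
    (mk n (Braid.rho n) * mk n (Braid.half n)) ^ 2 = 1 := by
  have h1 : mk n (Braid.rho n) ^ n = 1 := by
    rw [← map_pow]
    exact (QuotientGroup.eq_one_iff _).2 (Subgroup.subset_normalClosure (by simp))
  have h2 : mk n (Braid.sphere n) = 1 :=
    (QuotientGroup.eq_one_iff _).2 (Subgroup.subset_normalClosure (by simp))
  have hA := Braid.artinRels n
  have hA' : ArtinRels (fun i => mk n (Braid.σ n i)) (n - 1) :=
    ⟨fun i hi => by simpa using congrArg (mk n) (hA.braid i hi),
      fun i j hij hj => by simpa using congrArg (mk n) (hA.comm i j hij hj)⟩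
  have e : mk n (Braid.rho n) = upWord (fun i => mk n (Braid.σ n i)) (n - 1) := map_upWord ..
  have e' : mk n (Braid.half n) = halfWord (fun i => mk n (Braid.σ n i)) (n - 1) :=
    map_halfWord ..
  have e2 : mk n (Braid.sphere n) = upWord (fun i => mk n (Braid.σ n i)) (n - 1) *
      downWord (fun i => mk n (Braid.σ n i)) (n - 1) := by
    rw [← map_upWord, ← map_downWord, ← map_mul]; rfl
  rw [e2] at h2
  rw [e] at h1 ⊢
  rw [e']
  cases n with
  | zero => simp
  | succ n => exact hA'.dihedral h1 h2

end Gamma0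

/-! ### The infinite dihedral group -/

/-- The infinite dihedral group `D = ⟨r, s | s² = (r s)² = 1⟩`, with `r = DihedralGroup.r 1` and
`s = DihedralGroup.sr 0`. -/
abbrev DInf : Type := DihedralGroup 0

namespace DInf

/-- The morphism `D → G` with `r ↦ a`, `s ↦ b`. -/
def lift {G : Type*} [Group G] (a b : G) (hb : b ^ 2 = 1) (hab : (a * b) ^ 2 = 1) :
    DInf →* G where
  toFun
    | .r i => a ^ (show ℤ from i)
    | .sr i => b * a ^ (show ℤ from i)
  map_one' := zpow_zero a
  map_mul' := by
    have hb' : b⁻¹ = b := by rw [inv_eq_iff_mul_eq_one, ← pow_two, hb]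
    have key : ∀ i : ℤ, a ^ i * b = b * a ^ (-i) := by
      intro i
      have h1 : b * a * b⁻¹ = a⁻¹ := by
        rw [hb', eq_inv_iff_mul_eq_one, mul_assoc, mul_assoc, mul_eq_one_comm]
        simpa [pow_two, mul_assoc] using hab
      have h2 : b * a ^ (-i) * b⁻¹ = a ^ i := by
        rw [← conj_zpow, h1, inv_zpow, zpow_neg, inv_inv]
      rw [← h2, inv_mul_cancel_right]
    have hbb : b * b = 1 := by rw [← pow_two, hb]
    rintro (i | i) (j | j)
    · exact zpow_add a i j
    · change ℤ at i j
      change b * a ^ (j - i) = a ^ i * (b * a ^ j)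
      rw [← mul_assoc, key, mul_assoc, ← zpow_add]
      congr 2; omega
    · change ℤ at i j
      change b * a ^ (i + j) = b * a ^ i * a ^ j
      rw [zpow_add, mul_assoc]
    · change ℤ at i j
      change a ^ (j - i) = b * a ^ i * (b * a ^ j)
      rw [mul_assoc, ← mul_assoc (a ^ i), key, mul_assoc, ← mul_assoc b, hbb, one_mul,
        ← zpow_add]
      congr 1; omega

/-- The morphism `D → Γ_{0,n}`, `r ↦ σ_1 ⋯ σ_{n-1}`, `s ↦ h_n`. -/
def toGamma (n : ℕ) : DInf →* Gamma0 n :=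
  lift (Gamma0.mk n (Braid.rho n)) (Gamma0.mk n (Braid.half n))
    (Gamma0.dihedral n).1 (Gamma0.dihedral n).2

theorem perm_dihedral (n : ℕ) : (Fin.revPerm : Equiv.Perm (Fin n)) ^ 2 = 1 ∧
    (finRotate n * (Fin.revPerm : Equiv.Perm (Fin n))) ^ 2 = 1 := by
  have h := Gamma0.dihedral n
  rw [← Braid.perm_rho, ← Braid.perm_half, ← Gamma0.perm_mk, ← Gamma0.perm_mk,
    ← map_mul (Gamma0.perm n), ← map_pow (Gamma0.perm n), ← map_pow (Gamma0.perm n), h.1, h.2,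
    map_one]
  simp

/-- The morphism `D → S_n`, `r ↦ (i ↦ i + 1 mod n)`, `s ↦ (i ↦ n + 1 - i)`. -/
def toPerm (n : ℕ) : DInf →* Equiv.Perm (Fin n) :=
  lift (finRotate n) Fin.revPerm (perm_dihedral n).1 (perm_dihedral n).2

theorem perm_toGamma (n : ℕ) (g : DInf) : Gamma0.perm n (toGamma n g) = toPerm n g := by
  rcases g with i | i
  · change Gamma0.perm n (_ ^ (show ℤ from i)) = _ ^ (show ℤ from i)
    rw [map_zpow, Gamma0.perm_mk, Braid.perm_rho]
  · change Gamma0.perm n (_ * _ ^ (show ℤ from i)) = _ * _ ^ (show ℤ from i)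
    rw [map_mul, map_zpow, Gamma0.perm_mk, Gamma0.perm_mk, Braid.perm_rho, Braid.perm_half]

end DInf

/-! ### Planar trees -/

section Trees

/-- Planar binary rooted trees with at least one leaf. -/
inductive BinTree : Type
  | leaf : BinTree
  | node (l r : BinTree) : BinTree

namespace BinTree

/-- The number of leaves. -/
def leaves : BinTree → ℕ
  | leaf => 1
  | node l r => l.leaves + r.leaves

/-- When the leaves of `t` are numbered from left to right by `o, o + 1, …`, the assertion that
`a, …, b - 1` are the leaves of a subtree of `t` (consisting of a vertex or leaf of `t` and of all
its descendants). -/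
def IsPart : BinTree → ℕ → ℕ → ℕ → Prop
  | leaf, o, a, b => a = o ∧ b = o + 1
  | node l r, o, a, b => (a = o ∧ b = o + (l.leaves + r.leaves)) ∨ l.IsPart o a b ∨
      r.IsPart (o + l.leaves) a b

theorem leaves_pos : ∀ t : BinTree, 0 < t.leaves
  | leaf => Nat.one_pos
  | node l _ => Nat.add_pos_left l.leaves_pos _

theorem isPart_self : ∀ (t : BinTree) (o : ℕ), t.IsPart o o (o + t.leaves)
  | leaf, _ => ⟨rfl, rfl⟩
  | node _ _, _ => Or.inl ⟨rfl, rfl⟩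

theorem IsPart.bounds : ∀ {t : BinTree} {o a b : ℕ}, t.IsPart o a b →
    o ≤ a ∧ a < b ∧ b ≤ o + t.leaves
  | leaf, o, a, b, h => by obtain ⟨rfl, rfl⟩ := h; simp [leaves]
  | node l r, o, a, b, h => by
    have hl := l.leaves_pos
    rcases h with ⟨rfl, rfl⟩ | h | h
    · simp only [leaves]; omega
    · have := IsPart.bounds h; simp only [leaves]; omega
    · have := IsPart.bounds h; simp only [leaves]; omega

theorem IsPart.laminar : ∀ {t : BinTree} {o a b a' b' : ℕ}, t.IsPart o a b → t.IsPart o a' b' →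
    b ≤ a' ∨ b' ≤ a ∨ (a ≤ a' ∧ b' ≤ b) ∨ (a' ≤ a ∧ b ≤ b')
  | leaf, o, a, b, a', b', h, h' => by
    obtain ⟨rfl, rfl⟩ := h; obtain ⟨rfl, rfl⟩ := h'; simp
  | node l r, o, a, b, a', b', h, h' => by
    have hb := h.bounds
    have hb' := h'.bounds
    simp only [leaves] at hb hb'
    rcases h with ⟨rfl, rfl⟩ | h | h
    · omega
    · rcases h' with ⟨rfl, rfl⟩ | h' | h'
      · omega
      · exact h.laminar h'
      · have := h.bounds; have := h'.bounds; omega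
    · rcases h' with ⟨rfl, rfl⟩ | h' | h'
      · omega
      · have := h.bounds; have := h'.bounds; omega
      · exact h.laminar h'

end BinTree

/-- The interval `{a, …, b - 1}` in `Fin n`. -/
def finInterval (n a b : ℕ) : Set (Fin n) := {i | a ≤ (i : ℕ) ∧ (i : ℕ) < b}

/-- The cyclic intervals `{a, a + 1, …, a + m - 1}` (modulo `n`) in `Fin n`. -/
def IsArc {n : ℕ} (A : Set (Fin n)) : Prop :=
  ∃ (a : Fin n) (m : ℕ), ∀ i, i ∈ A ↔ ∃ j < m, i = (finRotate n ^ j) a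

/-- Compatibility of the bipartitions `A ⊔ Aᶜ` and `B ⊔ Bᶜ`: one of the four intersections of
their parts is empty. -/
def SplitCompat {α : Type*} (A B : Set α) : Prop :=
  Disjoint A B ∨ A ⊆ B ∨ B ⊆ A ∨ A ∪ B = Set.univ

/-- The set `PlT_n` of planar 3-valent trees with leaves numbered by `{1, …, n}` compatibly with
the cyclic orders. Such a tree is encoded by its edges, an edge being encoded by the bipartition
`A ⊔ Aᶜ` of the set of leaves obtained by cutting it; `sides` is the set of all the parts `A` of
these bipartitions. The tree condition is that these bipartitions are pairwise compatible, the
3-valency condition is that no further compatible bipartition can be added, and the planarity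
condition is that the parts are cyclic intervals. -/
@[ext]
structure PlT (n : ℕ) : Type where
  sides : Set (Set (Fin n))
  nonempty : ∀ A ∈ sides, A.Nonempty
  compl_mem : ∀ A ∈ sides, Aᶜ ∈ sides
  arc : ∀ A ∈ sides, IsArc A
  compat : ∀ A ∈ sides, ∀ B ∈ sides, SplitCompat A B
  maximal : ∀ A : Set (Fin n), A.Nonempty → Aᶜ.Nonempty → (∀ B ∈ sides, SplitCompat A B) →
    A ∈ sides

theorem SplitCompat.symm {α : Type*} {A B : Set α} (h : SplitCompat A B) : SplitCompat B A := by
  rcases h with h | h | h | h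
  · exact Or.inl h.symm
  · exact Or.inr (Or.inr (Or.inl h))
  · exact Or.inr (Or.inl h)
  · exact Or.inr (Or.inr (Or.inr (by rwa [Set.union_comm])))

theorem SplitCompat.compl {α : Type*} {A B : Set α} (h : SplitCompat A B) : SplitCompat Aᶜ B := by
  rcases h with h | h | h | h
  · exact Or.inr (Or.inr (Or.inl h.subset_compl_left))
  · refine Or.inr (Or.inr (Or.inr ?_))
    rw [Set.eq_univ_iff_forall]
    intro x
    by_cases hx : x ∈ A
    · exact Or.inr (h hx)
    · exact Or.inl hx
  · exact Or.inl (Set.disjoint_left.2 fun x hx hx' => hx (h hx'))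
  · refine Or.inr (Or.inl fun x hx => ?_)
    rcases (Set.eq_univ_iff_forall.1 h x) with h | h
    · exact absurd h hx
    · exact h

theorem SplitCompat.compl_iff {α : Type*} {A B : Set α} :
    SplitCompat Aᶜ B ↔ SplitCompat A B :=
  ⟨fun h => by simpa using h.compl, SplitCompat.compl⟩

theorem SplitCompat.preimage {α β : Type*} {A B : Set α} (h : SplitCompat A B) (f : β → α) :
    SplitCompat (f ⁻¹' A) (f ⁻¹' B) := by
  rcases h with h | h | h | h
  · exact Or.inl (h.preimage f)
  · exact Or.inr (Or.inl (Set.preimage_mono h))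
  · exact Or.inr (Or.inr (Or.inl (Set.preimage_mono h)))
  · exact Or.inr (Or.inr (Or.inr (by rw [← Set.preimage_union, h, Set.preimage_univ])))

theorem finRotate_pow_val {n : ℕ} (j : ℕ) (a : Fin n) :
    ((finRotate n ^ j) a : ℕ) = ((a : ℕ) + j) % n := by
  have ha := a.2
  induction j with
  | zero => simp [Nat.mod_eq_of_lt ha]
  | succ j ih =>
    obtain ⟨n, rfl⟩ : ∃ m, n = m + 1 := ⟨n - 1, by omega⟩
    rw [pow_succ', Equiv.Perm.mul_apply, finRotate_apply, Fin.val_add, ih, Fin.val_one',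
      ← Nat.add_mod, Nat.add_assoc]

theorem isArc_interval {n a b : ℕ} (h : a < b) (hb : b ≤ n) : IsArc (finInterval n a b) := by
  refine ⟨⟨a, by omega⟩, b - a, fun i => ?_⟩
  simp only [finInterval, Set.mem_ofPred_eq, Fin.ext_iff, finRotate_pow_val]
  constructor
  · intro hi
    exact ⟨i - a, by omega, by rw [Nat.mod_eq_of_lt (by omega)]; omega⟩
  · rintro ⟨j, hj, hi⟩
    rw [Nat.mod_eq_of_lt (by omega)] at hi
    omega

theorem isArc_interval_compl {n a b : ℕ} (h : a < b) (hb : b ≤ n) :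
    IsArc (finInterval n a b)ᶜ := by
  refine ⟨⟨b % n, Nat.mod_lt _ (by omega)⟩, n - (b - a), fun i => ?_⟩
  have hi := i.2
  simp only [finInterval, Set.mem_compl_iff, Set.mem_ofPred_eq, Fin.ext_iff, finRotate_pow_val,
    Nat.mod_add_mod]
  constructor
  · intro h'
    by_cases hib : b ≤ i
    · exact ⟨i - b, by omega, by rw [Nat.mod_eq_of_lt (by omega)]; omega⟩
    · refine ⟨n - b + i, by omega, ?_⟩
      rw [show b + (n - b + (i : ℕ)) = i + n by omega, Nat.add_mod_right,
        Nat.mod_eq_of_lt (by omega)]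
  · rintro ⟨j, hj, hij⟩
    by_cases hjn : b + j < n
    · rw [Nat.mod_eq_of_lt hjn] at hij; omega
    · rw [Nat.mod_eq_sub_mod (by omega), Nat.mod_eq_of_lt (by omega)] at hij; omega

/-- The subset of leaves cut off by an edge of the tree. -/
theorem BinTree.exists_part {n : ℕ} : ∀ (t : BinTree) (o : ℕ) (B : Set (Fin n)), B.Nonempty →
    B ⊆ finInterval n o (o + t.leaves) →
    (∀ a b, t.IsPart o a b →
      Disjoint B (finInterval n a b) ∨ B ⊆ finInterval n a b ∨ finInterval n a b ⊆ B) →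
    ∃ a b, t.IsPart o a b ∧ B = finInterval n a b
  | leaf, o, B, hB, hsub, _ => by
    refine ⟨o, o + 1, ⟨rfl, rfl⟩, hsub.antisymm ?_⟩
    obtain ⟨x, hx⟩ := hB
    have h1 := hsub hx
    intro y hy
    simp only [finInterval, leaves, Set.mem_ofPred_eq] at h1 hy
    obtain rfl : x = y := Fin.ext (by omega)
    exact hx
  | node l r, o, B, hB, hsub, hc => by
    have hsub' : ∀ x ∈ B, x ∈ finInterval n o (o + l.leaves) ∨
        x ∈ finInterval n (o + l.leaves) (o + l.leaves + r.leaves) := by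
      intro x hx
      have := hsub hx
      simp only [finInterval, leaves, Set.mem_ofPred_eq] at this ⊢
      omega
    have hL : B ⊆ finInterval n o (o + l.leaves) → ∃ a b, (node l r).IsPart o a b ∧
        B = finInterval n a b := fun h => by
      obtain ⟨a, b, hp, he⟩ := exists_part l o B hB h fun a b hp => hc a b (Or.inr (Or.inl hp))
      exact ⟨a, b, Or.inr (Or.inl hp), he⟩
    have hR : B ⊆ finInterval n (o + l.leaves) (o + l.leaves + r.leaves) →
        ∃ a b, (node l r).IsPart o a b ∧ B = finInterval n a b := fun h => by
      obtain ⟨a, b, hp, he⟩ := exists_part r (o + l.leaves) B hB h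
        fun a b hp => hc a b (Or.inr (Or.inr hp))
      exact ⟨a, b, Or.inr (Or.inr hp), he⟩
    rcases hc _ _ (Or.inr (Or.inl (l.isPart_self o))) with h | h | h
    · refine hR fun x hx => (hsub' x hx).resolve_left fun hx' => Set.disjoint_left.1 h hx hx'
    · exact hL h
    · rcases hc _ _ (Or.inr (Or.inr (r.isPart_self (o + l.leaves)))) with h' | h' | h'
      · refine hL fun x hx => (hsub' x hx).resolve_right fun hx' => Set.disjoint_left.1 h' hx hx'
      · exact hR h'
      · refine ⟨_, _, isPart_self _ o, hsub.antisymm fun x hx => ?_⟩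
        by_cases hx' : (x : ℕ) < o + l.leaves
        · exact h ⟨hx.1, hx'⟩
        · refine h' ⟨by omega, ?_⟩
          have := hx.2
          simp only [leaves] at this
          omega

/-- The set `T_n` of parenthesizations of a word in `n` identical letters: the empty word (`none`)
if `n = 0`, and the planar binary rooted trees with `n` leaves if `n ≥ 1`. -/
def Paren (n : ℕ) : Type := {t : Option BinTree // (t.elim 0 BinTree.leaves) = n}

namespace Paren

/-- The concatenation of parenthesized words. -/
def concat {n m : ℕ} : Paren n → Paren m → Paren (n + m)
  | ⟨none, h⟩, ⟨t', h'⟩ => ⟨t', by rw [h', ← h, Option.elim_none, Nat.zero_add]⟩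
  | ⟨some t, h⟩, ⟨none, h'⟩ => ⟨some t, by rw [h, ← h', Option.elim_none, Nat.add_zero]⟩
  | ⟨some t, h⟩, ⟨some t', h'⟩ => ⟨some (t.node t'), by rw [← h, ← h']; rfl⟩

/-- The assertion that `a, …, b - 1` are the leaves of a subtree. -/
def IsPart {n : ℕ} (t : Paren n) (a b : ℕ) : Prop :=
  match t.1 with
  | none => False
  | some t => t.IsPart 0 a b

/-- The map `π : T_n → PlT_n`: number the leaves from left to right, and replace the root and the
two edges connected to it by a single edge. -/
def toPlT {n : ℕ} (t : Paren n) : PlT n where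
  sides := {A | A.Nonempty ∧ Aᶜ.Nonempty ∧
    ∃ a b, t.IsPart a b ∧ (A = finInterval n a b ∨ Aᶜ = finInterval n a b)}
  nonempty A hA := hA.1
  compl_mem A hA := ⟨hA.2.1, by simpa using hA.1, by
    obtain ⟨a, b, h, h'⟩ := hA.2.2
    exact ⟨a, b, h, by rw [compl_compl]; exact h'.symm⟩⟩
  arc A hA := by
    obtain ⟨t, rfl⟩ := t
    obtain ⟨-, -, a, b, h, h'⟩ := hA
    match t, h with
    | some t, h =>
      have hb := BinTree.IsPart.bounds h
      rw [zero_add] at hb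
      rcases h' with rfl | h'
      · exact isArc_interval hb.2.1 hb.2.2
      · rw [← compl_compl A, h']
        exact isArc_interval_compl hb.2.1 hb.2.2
  compat A hA B hB := by
    obtain ⟨t, rfl⟩ := t
    obtain ⟨-, -, a, b, h, h'⟩ := hA
    obtain ⟨-, -, c, d, k, k'⟩ := hB
    match t, h, k with
    | some t, h, k =>
      have key : SplitCompat (finInterval (Option.elim (some t) 0 BinTree.leaves) a b)
          (finInterval (Option.elim (some t) 0 BinTree.leaves) c d) := by
        rcases BinTree.IsPart.laminar h k with e | e | e | e
        · exact Or.inl (Set.disjoint_left.2 fun x hx hx' => by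
            simp only [finInterval, Set.mem_ofPred_eq] at hx hx'; omega)
        · exact Or.inl (Set.disjoint_left.2 fun x hx hx' => by
            simp only [finInterval, Set.mem_ofPred_eq] at hx hx'; omega)
        · exact Or.inr (Or.inr (Or.inl fun x hx => by
            simp only [finInterval, Set.mem_ofPred_eq] at hx ⊢; omega))
        · exact Or.inr (Or.inl fun x hx => by
            simp only [finInterval, Set.mem_ofPred_eq] at hx ⊢; omega)
      have h1 : SplitCompat A (finInterval _ c d) := by
        rcases h' with rfl | h'
        · exact key
        · rw [← SplitCompat.compl_iff, h']; exact key
      rcases k' with rfl | k'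
      · exact h1
      · apply SplitCompat.symm
        rw [← SplitCompat.compl_iff, k']
        exact h1.symm
  maximal A hA hA' hc := by
    obtain ⟨t, rfl⟩ := t
    match t with
    | none => obtain ⟨x, -⟩ := hA; exact x.elim0
    | some .leaf =>
      obtain ⟨x, hx⟩ := hA
      obtain ⟨y, hy⟩ := hA'
      have : x = y := Fin.ext (by
        have h1 := x.2
        have h2 := y.2
        simp only [Option.elim_some, BinTree.leaves] at h1 h2
        omega)
      exact absurd hx (this ▸ hy)
    | some (.node l r) =>
      have hl := l.leaves_pos
      have hr := r.leaves_pos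
      -- the parts of the tree which are strictly contained in the set of all leaves
      have hside : ∀ a b, l.IsPart 0 a b ∨ r.IsPart (0 + l.leaves) a b →
          SplitCompat A (finInterval (l.node r).leaves a b) := by
        intro a b hab
        refine hc _ ⟨?_, ?_, a, b, Or.inr hab, Or.inl rfl⟩
        · rcases hab with h | h
          · have := h.bounds
            exact ⟨⟨a, by simp only [Option.elim_some, BinTree.leaves]; omega⟩, le_rfl, this.2.1⟩
          · have := h.bounds
            exact ⟨⟨a, by simp only [Option.elim_some, BinTree.leaves]; omega⟩, le_rfl, this.2.1⟩
        · rcases hab with h | h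
          · have := h.bounds
            refine ⟨⟨l.leaves, by simp only [Option.elim_some, BinTree.leaves]; omega⟩, fun hx => ?_⟩
            have h1 := hx.1
            have h2 := hx.2
            dsimp only at h1 h2
            omega
          · have := h.bounds
            refine ⟨⟨0, by simp only [Option.elim_some, BinTree.leaves]; omega⟩, fun hx => ?_⟩
            have h1 := hx.1
            have h2 := hx.2
            dsimp only at h1 h2
            omega
      have main : ∀ B : Set (Fin (l.node r).leaves), B.Nonempty →
          (∀ a b, l.IsPart 0 a b ∨ r.IsPart (0 + l.leaves) a b →
            SplitCompat B (finInterval (l.node r).leaves a b)) →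
          (B ⊆ finInterval _ 0 (0 + l.leaves) ∨
            B ⊆ finInterval _ (0 + l.leaves) (0 + l.leaves + r.leaves)) →
          ∃ a b, (l.node r).IsPart 0 a b ∧ B = finInterval _ a b := by
        intro B hB hcB hsub
        rcases hsub with hsub | hsub
        · obtain ⟨a, b, hp, he⟩ := BinTree.exists_part l 0 B hB hsub (by
            intro a b hp
            rcases hcB a b (Or.inl hp) with h | h | h | h
            · exact Or.inl h
            · exact Or.inr (Or.inl h)
            · exact Or.inr (Or.inr h)
            · exfalso
              have hb := hp.bounds
              have hx := Set.eq_univ_iff_forall.1 h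
                ⟨l.leaves, by simp only [BinTree.leaves]; omega⟩
              rcases hx with hx | hx
              · have := (hsub hx).2; simp at this
              · have := hx.2; simp at this; omega)
          exact ⟨a, b, Or.inr (Or.inl hp), he⟩
        · obtain ⟨a, b, hp, he⟩ := BinTree.exists_part r (0 + l.leaves) B hB hsub (by
            intro a b hp
            rcases hcB a b (Or.inr hp) with h | h | h | h
            · exact Or.inl h
            · exact Or.inr (Or.inl h)
            · exact Or.inr (Or.inr h)
            · exfalso
              have hb := hp.bounds
              have hx := Set.eq_univ_iff_forall.1 h
                ⟨0, by simp only [BinTree.leaves]; omega⟩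
              rcases hx with hx | hx
              · have := (hsub hx).1; simp at this; omega
              · have := hx.1; simp at this; omega)
          exact ⟨a, b, Or.inr (Or.inr hp), he⟩
      have hnot : ∀ x : Fin (l.node r).leaves, x ∉ finInterval _ 0 (0 + l.leaves) →
          x ∈ finInterval _ (0 + l.leaves) (0 + l.leaves + r.leaves) := by
        intro x hx
        have := x.2
        simp only [BinTree.leaves] at this
        simp only [finInterval, Set.mem_ofPred_eq] at hx ⊢
        omega
      refine ⟨hA, hA', ?_⟩
      have hcA' : ∀ a b, l.IsPart 0 a b ∨ r.IsPart (0 + l.leaves) a b →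
          SplitCompat Aᶜ (finInterval (l.node r).leaves a b) :=
        fun a b hab => (hside a b hab).compl
      rcases hside _ _ (Or.inl (l.isPart_self 0)) with h | h | h | h
      · obtain ⟨a, b, hp, he⟩ := main A hA hside
          (Or.inr fun x hx => hnot x fun hx' => Set.disjoint_left.1 h hx hx')
        exact ⟨a, b, hp, Or.inl he⟩
      · obtain ⟨a, b, hp, he⟩ := main A hA hside (Or.inl h)
        exact ⟨a, b, hp, Or.inl he⟩
      · obtain ⟨a, b, hp, he⟩ := main Aᶜ hA' hcA' (Or.inr fun x hx => hnot x fun hx' => hx (h hx'))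
        exact ⟨a, b, hp, Or.inr he⟩
      · obtain ⟨a, b, hp, he⟩ := main Aᶜ hA' hcA' (Or.inl fun x hx =>
          (Set.eq_univ_iff_forall.1 h x).resolve_left hx)
        exact ⟨a, b, hp, Or.inr he⟩

end Paren

namespace PlT

theorem isArc_preimage {n : ℕ} {A : Set (Fin n)} (hA : IsArc A) (g : DInf) :
    IsArc (DInf.toPerm n g ⁻¹' A) := by
  obtain ⟨a, m, h⟩ := hA
  have hpow : ∀ j : ℕ, finRotate n ^ j = DInf.toPerm n (.r (j : ZMod 0)) := fun j =>
    (zpow_natCast _ j).symm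
  have hmem : ∀ (i : Fin n) (j : ℕ), DInf.toPerm n g i = (finRotate n ^ j) a ↔
      i = DInf.toPerm n (g⁻¹ * .r (j : ZMod 0)) a := by
    intro i j
    rw [hpow, map_mul, map_inv, Equiv.Perm.mul_apply, Equiv.Perm.eq_inv_iff_eq]
  rcases g with k | k
  · refine ⟨DInf.toPerm n (.r (-k)) a, m, fun i => ?_⟩
    rw [Set.mem_preimage, h]
    refine exists_congr fun j => and_congr_right fun _ => ?_
    rw [hmem, hpow, ← Equiv.Perm.mul_apply, ← map_mul, DihedralGroup.inv_r, DihedralGroup.r_mul_r,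
      DihedralGroup.r_mul_r, add_comm]
  · refine ⟨DInf.toPerm n (.sr (k + (m - 1))) a, m, fun i => ?_⟩
    rw [Set.mem_preimage, h]
    have e : ∀ j : ℕ, j < m → DInf.toPerm n ((DihedralGroup.sr k : DInf)⁻¹ * .r (j : ZMod 0)) a =
        (finRotate n ^ (m - 1 - j)) (DInf.toPerm n (.sr (k + (m - 1))) a) := by
      intro j hj
      rw [hpow, ← Equiv.Perm.mul_apply, ← map_mul, DihedralGroup.inv_sr, DihedralGroup.sr_mul_r,
        DihedralGroup.r_mul_sr]
      congr 3
      rw [Nat.cast_sub (by omega), Nat.cast_sub (by omega)]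
      push_cast
      ring
    constructor
    · rintro ⟨j, hj, hi⟩
      rw [hmem, e j hj] at hi
      exact ⟨m - 1 - j, by omega, hi⟩
    · rintro ⟨j, hj, hi⟩
      refine ⟨m - 1 - j, by omega, ?_⟩
      rw [hmem, e _ (by omega), hi]
      congr 2
      omega

/-- The action of `D` on `PlT_n` by renumbering of the leaves. -/
instance (n : ℕ) : MulAction DInf (PlT n) where
  smul g t :=
    { sides := {A | DInf.toPerm n g ⁻¹' A ∈ t.sides}
      nonempty := fun A hA => by
        obtain ⟨x, hx⟩ := t.nonempty _ hA
        exact ⟨_, hx⟩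
      compl_mem := fun A hA => t.compl_mem _ hA
      arc := fun A hA => by
        have := isArc_preimage (t.arc _ hA) g⁻¹
        rw [← Set.preimage_comp, map_inv] at this
        have e : (DInf.toPerm n g ∘ ((DInf.toPerm n g)⁻¹ : Equiv.Perm (Fin n))) = id := by
          ext x; simp
        rwa [e] at this
      compat := fun A hA B hB => by
        have := (t.compat _ hA _ hB).preimage ((DInf.toPerm n g)⁻¹ : Equiv.Perm (Fin n))
        rw [← Set.preimage_comp, ← Set.preimage_comp] at this
        have e : (DInf.toPerm n g ∘ ((DInf.toPerm n g)⁻¹ : Equiv.Perm (Fin n))) = id := by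
          ext x; simp
        rwa [e] at this
      maximal := fun A hA hA' hc => by
        refine t.maximal _ ?_ ?_ ?_
        · exact hA.preimage (DInf.toPerm n g).surjective
        · exact hA'.preimage (DInf.toPerm n g).surjective
        · intro B hB
          have e : DInf.toPerm n g ⁻¹' (((DInf.toPerm n g)⁻¹ : Equiv.Perm (Fin n)) ⁻¹' B) = B := by
            rw [← Set.preimage_comp]
            have e : (((DInf.toPerm n g)⁻¹ : Equiv.Perm (Fin n)) ∘ DInf.toPerm n g) = id := by
              ext x; simp
            rw [e, Set.preimage_id]
          have := (hc (((DInf.toPerm n g)⁻¹ : Equiv.Perm (Fin n)) ⁻¹' B)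
            (by rw [Set.mem_ofPred_eq, e]; exact hB)).preimage (DInf.toPerm n g)
          rwa [e] at this }
  one_smul t := by
    apply PlT.ext
    ext A
    change DInf.toPerm n 1 ⁻¹' A ∈ t.sides ↔ _
    rw [map_one]; exact Iff.rfl
  mul_smul g h t := by
    apply PlT.ext
    ext A
    change DInf.toPerm n (g * h) ⁻¹' A ∈ t.sides ↔
      DInf.toPerm n h ⁻¹' (DInf.toPerm n g ⁻¹' A) ∈ t.sides
    rw [map_mul]; exact Iff.rfl

end PlT

end Trees

/-! ### Categories of labelled objects -/

section LabelledCategories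

/-- A family of groups `G_n` equipped with morphisms `G_n → S_n`. -/
structure PermGroups where
  G : ℕ → Type u
  [group : ∀ n, Group (G n)]
  perm : ∀ n, G n →* Equiv.Perm (Fin n)

attribute [instance] PermGroups.group

/-- A morphism between families of groups over the symmetric groups. -/
structure PermGroups.Hom (P : PermGroups.{u}) (Q : PermGroups.{v}) where
  hom : ∀ n, P.G n →* Q.G n
  perm_hom : ∀ n g, Q.perm n (hom n g) = P.perm n g

/-- The identification `G_m = G_n` for `m = n`. -/
def PermGroups.cast (P : PermGroups.{u}) {m n : ℕ} (h : m = n) : P.G m →* P.G n :=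
  h ▸ MonoidHom.id _

/-- The set `⊔_{n ≥ 0} T_n × S^n`. -/
@[ext]
structure LabObj (T : ℕ → Type) (S : Type v) : Type v where
  n : ℕ
  tree : T n
  lab : Fin n → S

/-- The category with set of objects `⊔_{n ≥ 0} T_n × S^n`, in which a morphism
`(t, s) → (t', s')` is an element of `G_n` whose image `f ∈ S_n` satisfies `s' f = s` if `t` and
`t'` both have degree `n`, and there is no morphism otherwise. The composition is the product. -/
def LabCat (_ : PermGroups.{u}) (T : ℕ → Type) (S : Type v) : Type v := LabObj T S

namespace LabCat

variable {P : PermGroups.{u}} {Q : PermGroups.{w}} {T T' : ℕ → Type} {S : Type v}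

/-- The morphisms of `LabCat`. -/
@[ext]
structure Hom (X Y : LabObj T S) (P : PermGroups.{u}) : Type u where
  len : X.n = Y.n
  elt : P.G X.n
  lab : ∀ i, Y.lab (Fin.cast len (P.perm _ elt i)) = X.lab i

instance : Category.{u} (LabCat P T S) where
  Hom X Y := Hom X Y P
  id X := ⟨rfl, 1, fun i => by simp⟩
  comp {X Y Z} f g := ⟨f.len.trans g.len, P.cast f.len.symm g.elt * f.elt, by
    rcases X with ⟨n, t, s⟩
    rcases Y with ⟨n', t', s'⟩
    rcases f with ⟨hf, f, hf'⟩
    dsimp only at hf f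
    subst hf
    intro i
    rw [← hf', ← g.lab, map_mul]
    rfl⟩
  id_comp {X Y} f := by
    apply Hom.ext
    exact mul_one f.elt
  comp_id {X Y} f := by
    apply Hom.ext
    change P.cast f.len.symm 1 * f.elt = f.elt
    rw [map_one, one_mul]
  assoc {X Y Z W} f g h := by
    apply Hom.ext
    rcases X with ⟨n, t, s⟩
    rcases Y with ⟨n', t', s'⟩
    rcases Z with ⟨n'', t'', s''⟩
    rcases f with ⟨hf, f, hf'⟩
    rcases g with ⟨hg, g, hg'⟩
    dsimp only at hf f hg g
    subst hf hg
    exact (mul_assoc h.elt g f).symm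

theorem eqToHom_elt {X Y : LabCat P T S} (h : X = Y) : Hom.elt (eqToHom h) = 1 := by
  subst h
  rfl

/-- The functor induced by morphisms of groups `G_n → G'_n` over `S_n` and by
maps `T_n → T'_n`. -/
def functor (φ : PermGroups.Hom P Q) (τ : ∀ n, T n → T' n) (S : Type v) :
    LabCat P T S ⥤ LabCat Q T' S where
  obj X := ⟨X.n, τ _ X.tree, X.lab⟩
  map {X Y} f := ⟨f.len, φ.hom _ f.elt, fun i => by rw [φ.perm_hom]; exact f.lab i⟩
  map_id X := by
    apply Hom.ext
    exact map_one (φ.hom X.n)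
  map_comp {X Y Z} f g := by
    apply Hom.ext
    rcases X with ⟨n, t, s⟩
    rcases Y with ⟨n', t', s'⟩
    rcases f with ⟨hf, f, hf'⟩
    dsimp only at hf f
    subst hf
    exact map_mul (φ.hom n) g.elt f

end LabCat

end LabelledCategories

/-! ### Quotient categories -/

section QuotientCategories

variable {G : Type w} [Group G] {C : Type v} [Category.{u} C] [MulAction G C]

/-- An action of a group `G` on a small category `C`: an action of `G` on the set of objects,
and isomorphisms `i_X^g : X → g X` such that `i_X^{gh} = i_{hX}^g i_X^h`
(the invertibility is a consequence of the two axioms). -/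
structure CatAction (G : Type w) [Group G] (C : Type v) [Category.{u} C] [MulAction G C] where
  i : ∀ (g : G) (X : C), X ⟶ g • X
  i_one : ∀ X, i 1 X = eqToHom (one_smul G X).symm
  i_mul : ∀ g h X, i (g * h) X = i h X ≫ i g (h • X) ≫ eqToHom (mul_smul g h X).symm

/-- The set of objects `(Ob C) / G` of the quotient category `C / G`. -/
def CatAction.QuotObj (_ : CatAction G C) : Type v := MulAction.orbitRel.Quotient G C

namespace CatAction

variable (A : CatAction G C)

/-- The class of an object. -/
def cls (X : C) : A.QuotObj := Quotient.mk _ X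

theorem cls_smul (g : G) (X : C) : A.cls (g • X) = A.cls X :=
  Quotient.sound ⟨g, rfl⟩

/-- The arrows which generate the quotient category: the morphisms of `C`. -/
inductive Gen : A.QuotObj → A.QuotObj → Type (max u v)
  | mk {X Y : C} (f : X ⟶ Y) : Gen (A.cls X) (A.cls Y)

instance : Quiver (A.QuotObj) := ⟨A.Gen⟩

/-- The generating arrow attached to a morphism of `C`, as a path. -/
def gen {X Y : C} (f : X ⟶ Y) :
    Quiver.Hom (V := Paths A.QuotObj) (A.cls X) (A.cls Y) :=
  (Paths.of A.QuotObj).map (Gen.mk f)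

/-- The relations of the quotient category: the identities and compositions are those of `C`, and
`i_X^g` is the identity of the class of `X` and `g X`. -/
inductive Rel : HomRel (Paths A.QuotObj)
  | id (X : C) : Rel (A.gen (𝟙 X)) (𝟙 _)
  | comp {X Y Z : C} (f : X ⟶ Y) (g : Y ⟶ Z) : Rel (A.gen (f ≫ g)) (A.gen f ≫ A.gen g)
  | act (g : G) (X : C) : Rel (A.gen (A.i g X)) (eqToHom (A.cls_smul g X).symm)

end CatAction

/-- The quotient category `C / G`. Its set of objects is `(Ob C) / G`. It is the universal category
with a functor `F` from `C` such that `F (g X) = F X` and `F (i_X^g) = id_{F X}`. -/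
def QuotCat (A : CatAction G C) : Type v := A.QuotObj

namespace QuotCat

variable (A : CatAction G C)

instance : Category.{max u v} (QuotCat A) where
  Hom X Y := (⟨X⟩ : CategoryTheory.Quotient A.Rel) ⟶ ⟨Y⟩
  id X := 𝟙 (⟨X⟩ : CategoryTheory.Quotient A.Rel)
  comp {X Y Z} f g := CategoryStruct.comp (obj := CategoryTheory.Quotient A.Rel)
    (X := ⟨X⟩) (Y := ⟨Y⟩) (Z := ⟨Z⟩) f g
  id_comp {X Y} f := Category.id_comp (obj := CategoryTheory.Quotient A.Rel) (X := ⟨X⟩) (Y := ⟨Y⟩) f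
  comp_id {X Y} f := Category.comp_id (obj := CategoryTheory.Quotient A.Rel) (X := ⟨X⟩) (Y := ⟨Y⟩) f
  assoc {W X Y Z} f g h := Category.assoc (obj := CategoryTheory.Quotient A.Rel)
    (W := ⟨W⟩) (X := ⟨X⟩) (Y := ⟨Y⟩) (Z := ⟨Z⟩) f g h

/-- The projection functor `C → C / G`. -/
def proj : C ⥤ QuotCat A where
  obj X := A.cls X
  map f := (CategoryTheory.Quotient.functor A.Rel).map (A.gen f)
  map_id X := CategoryTheory.Quotient.sound _ (CatAction.Rel.id X)
  map_comp f g := (CategoryTheory.Quotient.sound _ (CatAction.Rel.comp f g)).trans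
    (Functor.map_comp _ _ _)

end QuotCat

end QuotientCategories

/-! ### The categories of the statement -/

section MainCategories

/-- The braid groups. -/
def braidGroups : PermGroups.{0} := ⟨Braid, Braid.perm⟩

/-- The mapping class groups `Γ_{0,n}`. -/
def gammaGroups : PermGroups.{0} := ⟨Gamma0, Gamma0.perm⟩

/-- The groups `exp(t_n^) ⋊ S_n`. -/
noncomputable def tGroups (K : Type u) [CommRing K] [Algebra ℚ K] : PermGroups.{u} :=
  ⟨GrpT K, fun _ => SemidirectProduct.rightHom⟩

/-- The groups `exp(p_n^) ⋊ S_n`. -/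
noncomputable def pGroups (K : Type u) [CommRing K] [Algebra ℚ K] : PermGroups.{u} :=
  ⟨GrpP K, fun _ => SemidirectProduct.rightHom⟩

/-- The projections `B_n → Γ_{0,n}`. -/
def braidToGamma : PermGroups.Hom braidGroups gammaGroups := ⟨Gamma0.mk, fun _ _ => rfl⟩

theorem GrpT.rightHom_toGrpP (K : Type u) [CommRing K] [Algebra ℚ K] (n : ℕ) (g : GrpT K n) :
    SemidirectProduct.rightHom (GrpT.toGrpP K n g) = SemidirectProduct.rightHom g := by
  rw [GrpT.toGrpP, SemidirectProduct.rightHom_eq_right, SemidirectProduct.rightHom_eq_right,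
    SemidirectProduct.map_right, MonoidHom.id_apply]

/-- The projections `exp(t_n^) ⋊ S_n → exp(p_n^) ⋊ S_n`. -/
noncomputable def tToP (K : Type u) [CommRing K] [Algebra ℚ K] :
    PermGroups.Hom (tGroups K) (pGroups K) :=
  ⟨GrpT.toGrpP K, GrpT.rightHom_toGrpP K⟩

/-- The category `PaB_S`. -/
abbrev PaB (S : Type v) : Type v := LabCat braidGroups Paren S

/-- The category underlying `PaCD_S^Φ`. -/
abbrev PaCD (K : Type u) [CommRing K] [Algebra ℚ K] (S : Type v) : Type v :=
  LabCat (tGroups K) Paren S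

/-- The category `PaDih_S~`. -/
abbrev PaDihTilde (S : Type v) : Type v := LabCat gammaGroups PlT S

/-- The category `PaDih_S^{gr}~`. -/
abbrev PaDihGrTilde (K : Type u) [CommRing K] [Algebra ℚ K] (S : Type v) : Type v :=
  LabCat (pGroups K) PlT S

/-- The action of `D` on `⊔_{n ≥ 0} PlT_n × S^n`. -/
instance (S : Type v) : MulAction DInf (LabObj PlT S) where
  smul g X := ⟨X.n, g • X.tree, fun i => X.lab ((DInf.toPerm X.n g)⁻¹ i)⟩
  one_smul X := by
    change LabObj.mk X.n ((1 : DInf) • X.tree) (fun i => X.lab ((DInf.toPerm X.n 1)⁻¹ i)) = X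
    rw [one_smul, map_one]; rfl
  mul_smul g h X := by
    change LabObj.mk X.n ((g * h) • X.tree) (fun i => X.lab ((DInf.toPerm X.n (g * h))⁻¹ i)) =
      LabObj.mk X.n (g • h • X.tree)
        (fun i => X.lab ((DInf.toPerm X.n h)⁻¹ ((DInf.toPerm X.n g)⁻¹ i)))
    rw [mul_smul, map_mul, mul_inv_rev]; rfl

instance (P : PermGroups.{u}) (S : Type v) : MulAction DInf (LabCat P PlT S) :=
  inferInstanceAs (MulAction DInf (LabObj PlT S))

/-- The action of `D` on the category `LabCat P PlT S` attached to morphisms `D → G_n` lifting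
`D → S_n`: the isomorphism `i_X^g` is the image of `g` in `G_n`, where `n` is the degree of `X`. -/
def dihAction (P : PermGroups.{u}) (ψ : ∀ n, DInf →* P.G n)
    (hψ : ∀ n g, P.perm n (ψ n g) = DInf.toPerm n g) (S : Type v) :
    CatAction DInf (LabCat P PlT S) where
  i g X := ⟨rfl, ψ X.n g, fun i => by
    change X.lab ((DInf.toPerm X.n g)⁻¹ (P.perm X.n (ψ X.n g) i)) = X.lab i
    rw [hψ]; simp⟩
  i_one X := by
    apply LabCat.Hom.ext
    refine (map_one (ψ X.n)).trans ?_
    exact (LabCat.eqToHom_elt _).symm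
  i_mul g h X := by
    apply LabCat.Hom.ext
    refine (map_mul (ψ X.n) g h).trans ?_
    have e : ∀ (Y Z : LabCat P PlT S) (f : X ⟶ Y) (k : Y = Z),
        LabCat.Hom.elt (f ≫ eqToHom k) = LabCat.Hom.elt f := by
      rintro Y _ f rfl
      rw [eqToHom_refl, Category.comp_id]
    rw [← Category.assoc, e]
    rfl

/-- The action of `D` on `PaDih_S~`, with `i^r = σ_1 ⋯ σ_{n-1}` and `i^s = h_n`. -/
def actDih (S : Type v) : CatAction DInf (PaDihTilde S) :=
  dihAction gammaGroups DInf.toGamma DInf.perm_toGamma S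

/-- The action of `D` on `PaDih_S^{gr}~`, through `D → S_n → exp(p_n^) ⋊ S_n`. -/
noncomputable def actDihGr (K : Type u) [CommRing K] [Algebra ℚ K] (S : Type v) :
    CatAction DInf (PaDihGrTilde K S) :=
  dihAction (pGroups K) (fun n => (SemidirectProduct.inr : _ →* GrpP K n).comp (DInf.toPerm n))
    (fun _ _ => rfl) S

/-- The category `PaDih_S = PaDih_S~ / D`. -/
abbrev PaDih (S : Type v) : Type v := QuotCat (actDih S)

/-- The category `PaDih_S^{gr} = PaDih_S^{gr}~ / D`. -/
abbrev PaDihGr (K : Type u) [CommRing K] [Algebra ℚ K] (S : Type v) : Type v :=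
  QuotCat (actDihGr K S)

/-- The common set of objects `(⊔_{n ≥ 0} PlT_n × S^n) / D` of `PaDih_S` and `PaDih_S^{gr}`. -/
abbrev DihObj (S : Type v) : Type v := MulAction.orbitRel.Quotient DInf (LabObj PlT S)

/-- The contraction `PaB_S → PaDih_S`. -/
def contraction (S : Type v) : PaB S ⥤ PaDih S :=
  LabCat.functor braidToGamma (fun _ => Paren.toPlT) S ⋙ QuotCat.proj (actDih S)

/-- The contraction `PaCD_S^Φ → PaDih_S^{gr}`. -/
noncomputable def contractionGr (K : Type u) [CommRing K] [Algebra ℚ K] (S : Type v) :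
    PaCD K S ⥤ PaDihGr K S :=
  LabCat.functor (tToP K) (fun _ => Paren.toPlT) S ⋙ QuotCat.proj (actDihGr K S)

end MainCategories

/-! ### Associators -/

section Associators

variable (K : Type u) [CommRing K] [Algebra ℚ K]

/-- The free Lie algebra `f_2` with generators `A` and `B`. -/
abbrev LieF2 : Type u := FreeLieAlgebra K (Fin 2)

variable {K}

/-- The image `Φ(x, y)` of `Φ = Φ(A, B)` under the morphism `exp(f_2^) → exp(L^)` induced by
`A ↦ x`, `B ↦ y`. -/
noncomputable def subst {L : Type u} [LieRing L] [LieAlgebra K L] (Φ : expGroup K (LieF2 K))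
    (x y : L) : expGroup K L :=
  expGroup.map K (FreeLieAlgebra.lift K ![x, y]) Φ

/-- The exponential `e^{μ x / 2}`. -/
noncomputable def expHalf {L : Type u} [LieRing L] [LieAlgebra K L] (μ : K) (x : L) :
    expGroup K L :=
  expGroup.exp K ((algebraMap ℚ K (1 / 2) * μ) • x)

variable (K)

/-- The set `M(K)` of Drinfeld associators defined over `K`: pairs `(μ, Φ) ∈ K × exp(f_2^)`
satisfying the duality, hexagon and pentagon conditions. -/
structure Associator where
  μ : K
  Φ : expGroup K (LieF2 K)
  duality : subst Φ (FreeLieAlgebra.of K 1) (FreeLieAlgebra.of K 0) = Φ⁻¹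
  hexagon : ∀ A B C : LieF2 K, A = FreeLieAlgebra.of K 0 → B = FreeLieAlgebra.of K 1 →
    A + B + C = 0 →
    expHalf μ A * subst Φ C A * expHalf μ C * subst Φ B C * expHalf μ B * subst Φ A B = 1
  pentagon : ∀ t : Fin 4 → Fin 4 → LieT K 4, t = LieT.t K →
    subst Φ (t 0 1) (t 1 2 + t 1 3) * subst Φ (t 0 2 + t 1 2) (t 2 3) =
      subst Φ (t 1 2) (t 2 3) * subst Φ (t 0 1 + t 0 2) (t 1 3 + t 2 3) * subst Φ (t 0 1) (t 1 2)

end Associators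

/-! ### The braided monoidal structures -/

section Braided

variable {S : Type v}

/-- The tensor product of objects of `PaB_S` and `PaCD_S^Φ`: concatenation of parenthesized words
in `S`. -/
def LabCat.tensorObj {P : PermGroups.{u}} (X Y : LabCat P Paren S) : LabCat P Paren S :=
  LabObj.mk (X.n + Y.n) (X.tree.concat Y.tree) (Fin.append X.lab Y.lab)

theorem append_juxt {n m n' m' : ℕ} {σ : Equiv.Perm (Fin n)} {τ : Equiv.Perm (Fin m)}
    {a : Fin n → S} {b : Fin m → S} {a' : Fin n' → S} {b' : Fin m' → S} (h : n = n') (k : m = m')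
    (ha : ∀ i, a' (Fin.cast h (σ i)) = a i) (hb : ∀ i, b' (Fin.cast k (τ i)) = b i)
    (i : Fin (n + m)) :
    Fin.append a' b' (Fin.cast (by rw [h, k]) (permJuxt σ τ i)) = Fin.append a b i := by
  subst h k
  refine Fin.addCases (fun i => ?_) (fun i => ?_) i
  · simpa [permJuxt, Equiv.permCongr_apply] using ha i
  · simpa [permJuxt, Equiv.permCongr_apply] using hb i

theorem append_block {n m : ℕ} (a : Fin n → S) (b : Fin m → S) (i : Fin (n + m)) :
    Fin.append b a (Fin.cast (Nat.add_comm n m) (blockPerm n m i)) = Fin.append a b i := by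
  have e : ∀ i, Fin.cast (Nat.add_comm n m) (blockPerm n m i) = finAddFlip i := fun i => rfl
  rw [e]
  refine Fin.addCases (fun i => ?_) (fun i => ?_) i <;> simp

theorem append_assoc {n m p : ℕ} (a : Fin n → S) (b : Fin m → S) (c : Fin p → S)
    (i : Fin (n + m + p)) :
    Fin.append a (Fin.append b c) (Fin.cast (Nat.add_assoc n m p) i) =
      Fin.append (Fin.append a b) c i :=
  (congrFun (Fin.append_assoc a b c) i).symm

namespace PaB

/-- The tensor product of morphisms of `PaB_S`, the juxtaposition of braids. -/
def tensorHom {X X' Y Y' : PaB S} (f : X ⟶ X') (g : Y ⟶ Y') :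
    LabCat.tensorObj X Y ⟶ LabCat.tensorObj X' Y' :=
  LabCat.Hom.mk (congrArg₂ (· + ·) f.len g.len) (Braid.juxt f.elt g.elt) fun i => by
    have := append_juxt f.len g.len f.lab g.lab i
    rw [show permJuxt (braidGroups.perm X.n f.elt) (braidGroups.perm Y.n g.elt) = _ from
      (Braid.perm_juxt f.elt g.elt).symm] at this
    exact this

/-- The braiding `β_{XY} = b_{n,m}` of `PaB_S`. -/
def braiding (X Y : PaB S) : LabCat.tensorObj X Y ⟶ LabCat.tensorObj Y X :=
  LabCat.Hom.mk (Nat.add_comm _ _) (Braid.cross X.n Y.n) fun i => by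
    have := append_block X.lab Y.lab i
    rw [← Braid.perm_cross] at this
    exact this

/-- The associativity constraint `a_{XYZ} = 1` of `PaB_S`. -/
def associator (X Y Z : PaB S) : LabCat.tensorObj (LabCat.tensorObj X Y) Z ⟶
    LabCat.tensorObj X (LabCat.tensorObj Y Z) :=
  LabCat.Hom.mk (Nat.add_assoc _ _ _) (1 : Braid (X.n + Y.n + Z.n)) fun i => by
    have h : Braid.perm _ (1 : Braid (X.n + Y.n + Z.n)) i = i := by rw [map_one]; rfl
    have := append_assoc X.lab Y.lab Z.lab i
    rw [← h] at this
    exact this.trans (by rw [h]; rfl)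

end PaB

variable {K : Type u} [CommRing K] [Algebra ℚ K]

/-- The juxtaposition `exp(t_n^) ⋊ S_n × exp(t_m^) ⋊ S_m → exp(t_{n+m}^) ⋊ S_{n+m}`, induced by
`t_ij ↦ t_ij` on the first factor and by `t_ij ↦ t_{n+i,n+j}` on the second one. -/
noncomputable def GrpT.juxt {n m : ℕ} (x : GrpT K n) (y : GrpT K m) : GrpT K (n + m) :=
  ⟨expGroup.map K (LieT.map K (Fin.castAddEmb m)) x.left *
    expGroup.map K (LieT.map K (Fin.natAddEmb n)) y.left, permJuxt x.right y.right⟩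

/-- The sum of the `t_ij`, for `i` in the image of `f` and `j` in the image of `g`. -/
noncomputable def LieT.block {n m k : ℕ} (f : Fin n → Fin k) (g : Fin m → Fin k) : LieT K k :=
  ∑ i, ∑ j, LieT.t K (f i) (g j)

namespace PaCD

/-- The tensor product of morphisms of `PaCD_S^Φ`. -/
noncomputable def tensorHom {X X' Y Y' : PaCD K S} (f : X ⟶ X') (g : Y ⟶ Y') :
    LabCat.tensorObj X Y ⟶ LabCat.tensorObj X' Y' :=
  LabCat.Hom.mk (congrArg₂ (· + ·) f.len g.len) (GrpT.juxt f.elt g.elt) fun i =>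
    append_juxt f.len g.len f.lab g.lab i

/-- The braiding `β_{XY} = s_{n,m} exp((μ/2) ∑_{i ∈ [n], j ∈ n + [m]} t_ij)` of `PaCD_S^Φ`, where
`s_{n,m} ∈ S_{n+m}` is the permutation which exchanges the two blocks. -/
noncomputable def braiding (a : Associator K) (X Y : PaCD K S) :
    LabCat.tensorObj X Y ⟶ LabCat.tensorObj Y X :=
  LabCat.Hom.mk (Nat.add_comm _ _)
    ((SemidirectProduct.inr (blockPerm X.n Y.n) : GrpT K (X.n + Y.n)) *
      SemidirectProduct.inl (expHalf a.μ (LieT.block (Fin.castAdd Y.n) (Fin.natAdd X.n))))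
    fun i => by
      have h : ∀ x : expGroup K (LieT K (X.n + Y.n)),
          SemidirectProduct.rightHom ((SemidirectProduct.inr (blockPerm X.n Y.n) :
            GrpT K (X.n + Y.n)) * SemidirectProduct.inl x) = blockPerm X.n Y.n := fun x => by
        simp
      have := append_block X.lab Y.lab i
      rw [← h] at this
      exact this

/-- The associativity constraint `a_{XYZ} = Φ(t_{12}, t_{23})^{n,m,p}` of `PaCD_S^Φ`, where the
three strands are replaced by blocks of `n`, `m`, `p` strands. -/
noncomputable def associator (a : Associator K) (X Y Z : PaCD K S) :
    LabCat.tensorObj (LabCat.tensorObj X Y) Z ⟶ LabCat.tensorObj X (LabCat.tensorObj Y Z) :=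
  LabCat.Hom.mk (Nat.add_assoc _ _ _)
    (SemidirectProduct.inl (subst a.Φ
      (LieT.block (Fin.castAdd Z.n ∘ Fin.castAdd Y.n) (Fin.castAdd Z.n ∘ Fin.natAdd X.n))
      (LieT.block (Fin.castAdd Z.n ∘ Fin.natAdd X.n) (Fin.natAdd (X.n + Y.n)))) :
        GrpT K (X.n + Y.n + Z.n))
    fun i => append_assoc X.lab Y.lab Z.lab i

end PaCD

variable (S) in
/-- Braided monoidal functors `PaB_S → PaCD_S^Φ` which are the identity on objects and strictly
compatible with the tensor products, the braidings and the associativity constraints. (The unit of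
both categories is the empty word, with identities as unit constraints, so that the compatibility
with the latter is automatic.) -/
@[ext]
structure StrictBraidedFunctor (a : Associator K) where
  map : ∀ {X Y : LabObj Paren S}, LabCat.Hom X Y braidGroups → LabCat.Hom X Y (tGroups K)
  map_id : ∀ X : PaB S, map (𝟙 X) = CategoryStruct.id (obj := PaCD K S) X
  map_comp : ∀ {X Y Z : PaB S} (f : X ⟶ Y) (g : Y ⟶ Z),
    map (f ≫ g) = CategoryStruct.comp (obj := PaCD K S) (map f) (map g)
  map_tensor : ∀ {X X' Y Y' : PaB S} (f : X ⟶ X') (g : Y ⟶ Y'),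
    map (PaB.tensorHom f g) = PaCD.tensorHom (map f) (map g)
  map_braiding : ∀ X Y : PaB S, map (PaB.braiding X Y) = PaCD.braiding a X Y
  map_associator : ∀ X Y Z : PaB S, map (PaB.associator X Y Z) = PaCD.associator a X Y Z

/-- The underlying functor. -/
def StrictBraidedFunctor.toFunctor {a : Associator K} (j : StrictBraidedFunctor S a) :
    PaB S ⥤ PaCD K S where
  obj X := X
  map f := j.map f
  map_id X := j.map_id X
  map_comp f g := j.map_comp f g

end Braided

/-! Both halves of the statement are coherence theorems. All identities are verified in one group,
`DKGrp K ℕ`: the exponential group of the Drinfeld–Kohno Lie algebra on the index set ℕ, extended by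
the permutations of ℕ. It contains every exp(t_n^) ⋊ S_n (`GrpT.emb_injective`), and in it the
juxtaposition of x in degree n with y becomes x · shift_n(y) (`GrpT.emb_juxt`).

Existence of j_Φ. The pentagon and the hexagons hold for consecutive blocks of indices
(`assoc_pentagon`, `hexagon_right`, `hexagon_left`). Let the i-th Artin generator act on the
left-bracketed word by the crossing of two adjacent strands conjugated by an associator; this
represents the braid group (`gen_artinRels`). A word bracketed along t is compared with the
left-bracketed word by a product of associators `treeElt t`, and a braid b from t to t' is sent to
treeElt(t') · rep(b) · treeElt(t)⁻¹. Functoriality is then automatic. Compatibility with tensor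
products, associativity constraints and braidings rests on `comb_rep_juxt`, `comb_assoc` and
`crossWord_gen`.

Uniqueness of j_Φ. A trivial braid between two bracketings is a composite of tensor products of
associativity constraints and their inverses, and an Artin generator is id ⊗ β ⊗ id up to
rebracketing. A strict functor is therefore determined on all braids.

The functor k_Φ. The functor from PaB to PaDih~ is full and surjective on objects, and PaDih is
generated by the image of PaDih~; this gives uniqueness. For existence, the composite of j_Φ with
the contraction must send to an identity every braid b whose class in Γ_{0,n} is the image of some γ
in D, whenever the unrooted trees of its source and target are related by γ
(`mem_stepSubgroup_of_mk`). The pairs (γ, b) which are always sent to identities form a subgroup, so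
a few cases suffice.

For (1, 1), two rooted trees with the same unrooted tree differ by moves of the root along edges.
Each move is an associator Φ(t_IJ, t_JM) with I ⊔ J ⊔ M = [n]. In p_n the two arguments commute
(`DK.toLieP_lie`), and Φ is trivial on commuting arguments (`subst_of_commute`).

For (r, σ_1⋯σ_{n-1}) and (r⁻¹, σ_{n-1}⋯σ_1), put the root beside the last, respectively the first,
leaf. The braid becomes the braiding with a single strand i, whose exponent is a multiple of the sum
of the t_ij over j, which is zero in p_n.

For (s, h_n), the half-twist from t to its mirror image is the order-reversing permutation times
exp((μ/2) ∑_{i<j} t_ij), with no associator left (`treeElt_op`), and the exponent is again zero in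
p_n.

Powers and products of these pairs contain the two relators of Γ_{0,n}, and the normality of
`trivialSubgroup` extends the conclusion to their normal closure. -/

/-! ### Exponentials and commutation in the pro-unipotent groups. -/

section ExpGroupLemmas

attribute [local instance 100] LieRing.ofAssociativeRing

variable (K : Type u) [CommRing K] {L : Type v} [LieRing L] [LieAlgebra K L]
  {L' : Type v} [LieRing L'] [LieAlgebra K L']

namespace TruncU

theorem commute_ι {x y : L} (h : ⁅x, y⁆ = 0) (N : ℕ) : Commute (ι K L N x) (ι K L N y) := by
  have := (ι K L N).map_lie x y
  rw [h, map_zero, Ring.lie_def, eq_comm, sub_eq_zero] at this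
  exact this

end TruncU

variable [Algebra ℚ K]

namespace expGroup

@[ext]
theorem ext_val {x y : expGroup K L} (h : ∀ N, (x.1 N : TruncU K L N) = y.1 N) : x = y :=
  Subtype.ext (funext fun N => Units.ext (h N))

theorem map_exp (f : L →ₗ⁅K⁆ L') (y : L) : map K f (exp K y) = exp K (f y) := by
  ext N
  change TruncU.map K N f (IsNilpotent.exp _) = IsNilpotent.exp _
  rw [IsNilpotent.map_exp (TruncU.isNilpotent_ι K y), TruncU.map_ι]

theorem exp_add {x y : L} (h : ⁅x, y⁆ = 0) : exp K (x + y) = exp K x * exp K y := by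
  ext N
  change IsNilpotent.exp (TruncU.ι K L N (x + y)) = IsNilpotent.exp _ * IsNilpotent.exp _
  rw [map_add, IsNilpotent.exp_add_of_commute (TruncU.commute_ι K h N)
    (TruncU.isNilpotent_ι K x) (TruncU.isNilpotent_ι K y)]

theorem exp_zero : exp K (0 : L) = 1 := by
  ext N
  change IsNilpotent.exp (TruncU.ι K L N 0) = 1
  rw [map_zero, IsNilpotent.exp_zero]

theorem commute_exp {x y : L} (h : ⁅x, y⁆ = 0) : Commute (exp K x) (exp K y) := by
  have h' : ⁅y, x⁆ = 0 := by rw [← lie_skew, h, neg_zero]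
  change _ * _ = _ * _
  rw [← exp_add K h, ← exp_add K h', add_comm]

/-- An element which commutes with the exponentials of the image of `f` commutes with the image of
the morphism of groups induced by `f`. -/
theorem commute_map (f : L →ₗ⁅K⁆ L') (w : expGroup K L') (h : ∀ y, Commute (exp K (f y)) w)
    (u : expGroup K L) : Commute (map K f u) w := by
  apply Subtype.ext
  funext N
  -- At each level the group is generated by exponentials, so it is enough to put those in the
  -- centralizer of the component of `w`.
  have hle : expSubgroup K L N ≤ (Subgroup.centralizer {w.1 N}).comap
      (Units.map (TruncU.map K N f : _ →* _)) := by
    refine (Subgroup.closure_le _).2 ?_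
    rintro z ⟨y, hy⟩
    rw [SetLike.mem_coe, Subgroup.mem_comap, Subgroup.mem_centralizer_singleton_iff]
    have e : Units.map (TruncU.map K N f : _ →* _) z = (exp K (f y)).1 N := by
      apply Units.ext
      change TruncU.map K N f (z : TruncU K L N) = IsNilpotent.exp _
      rw [hy, IsNilpotent.map_exp (TruncU.isNilpotent_ι K y), TruncU.map_ι]
    rw [e]
    exact congrFun (congrArg Subtype.val (h y)) N
  have := hle (u.2.1 N)
  rw [Subgroup.mem_comap, Subgroup.mem_centralizer_singleton_iff] at this
  exact this

theorem commute_map_exp (f : L →ₗ⁅K⁆ L') {a : L'} (h : ∀ y, ⁅f y, a⁆ = 0) (u : expGroup K L) :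
    Commute (map K f u) (exp K a) :=
  commute_map K f _ (fun y => commute_exp K (h y)) u

theorem commute_map_map {L₁ : Type v} [LieRing L₁] [LieAlgebra K L₁] (f : L →ₗ⁅K⁆ L')
    (g : L₁ →ₗ⁅K⁆ L') (h : ∀ y z, ⁅f y, g z⁆ = 0) (u : expGroup K L) (v : expGroup K L₁) :
    Commute (map K f u) (map K g v) :=
  commute_map K f _ (fun y => (commute_map_exp K g (fun z => by
    rw [← lie_skew, h, neg_zero]) v).symm) u

theorem map_map {L₁ : Type v} [LieRing L₁] [LieAlgebra K L₁] (g : L' →ₗ⁅K⁆ L₁)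
    (f : L →ₗ⁅K⁆ L') (x : expGroup K L) : map K g (map K f x) = map K (g.comp f) x := by
  rw [map_comp]; rfl

end expGroup

end ExpGroupLemmas

/-! ### Commutation checked on generators of Lie algebras. -/

section Generation

variable {K : Type u} [CommRing K] {X : Type v} {L : Type w} [LieRing L] [LieAlgebra K L]

/-- The elements whose image under `f` commutes with `a`. -/
def lieCommutant {L' : Type*} [LieRing L'] [LieAlgebra K L'] (f : L →ₗ⁅K⁆ L') (a : L') :
    LieSubalgebra K L where
  carrier := {y | ⁅f y, a⁆ = 0}
  zero_mem' := by simp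
  add_mem' {x y} hx hy := by
    simp only [Set.mem_ofPred_eq] at hx hy ⊢
    rw [map_add, add_lie, hx, hy, add_zero]
  smul_mem' c {x} hx := by
    simp only [Set.mem_ofPred_eq] at hx ⊢
    rw [map_smul, smul_lie, hx, smul_zero]
  lie_mem' {x y} hx hy := by
    change ⁅f ⁅x, y⁆, a⁆ = 0
    change ⁅f x, a⁆ = 0 at hx
    change ⁅f y, a⁆ = 0 at hy
    rw [LieHom.map_lie, lie_lie, hx, hy, lie_zero, lie_zero, sub_zero]

/-- By the universal property the identity of the free Lie algebra factors through the inclusion of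
`S`. -/
theorem FreeLieAlgebra.mem_of_forall_of_mem (S : LieSubalgebra K (FreeLieAlgebra K X))
    (h : ∀ x, FreeLieAlgebra.of K x ∈ S) (y : FreeLieAlgebra K X) : y ∈ S := by
  have e : S.incl.comp (FreeLieAlgebra.lift K fun x => (⟨_, h x⟩ : S)) = LieHom.id :=
    FreeLieAlgebra.hom_ext fun x => by
      rw [LieHom.comp_apply, FreeLieAlgebra.lift_of_apply]; rfl
  have := DFunLike.congr_fun e y
  rw [LieHom.id_apply] at this
  rw [← this]
  exact Subtype.property _

theorem FreeLieAlgebra.lift_commute {f : X → L} {a : L} (h : ∀ x, ⁅f x, a⁆ = 0)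
    (y : FreeLieAlgebra K X) : ⁅FreeLieAlgebra.lift K f y, a⁆ = 0 :=
  FreeLieAlgebra.mem_of_forall_of_mem (lieCommutant (FreeLieAlgebra.lift K f) a)
    (fun x => by
      change ⁅FreeLieAlgebra.lift K f _, a⁆ = 0
      rw [FreeLieAlgebra.lift_of_apply, h]) y

theorem LiePres.commute_of_forall {R : Set (FreeLieAlgebra K X)} (f : LiePres K R →ₗ⁅K⁆ L) {a : L}
    (h : ∀ x, ⁅f (LiePres.mk K R (FreeLieAlgebra.of K x)), a⁆ = 0) (y : LiePres K R) :
    ⁅f y, a⁆ = 0 := by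
  obtain ⟨y, rfl⟩ := LiePres.mk_surjective K R y
  exact FreeLieAlgebra.mem_of_forall_of_mem (lieCommutant (f.comp (LiePres.mk K R)) a) h y

theorem lift_pair_commute {L : Type u} [LieRing L] [LieAlgebra K L] {x y a : L} (hx : ⁅x, a⁆ = 0) (hy : ⁅y, a⁆ = 0) (z : LieF2 K) :
    ⁅FreeLieAlgebra.lift K ![x, y] z, a⁆ = 0 :=
  FreeLieAlgebra.lift_commute (fun i => by fin_cases i <;> assumption) z

/-- The morphism `t_n → L` with prescribed values on the generators. -/
noncomputable def LieT.lift {n : ℕ} (g : Fin n → Fin n → L) (hs : ∀ i j, i ≠ j → g j i = g i j)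
    (h3 : ∀ i j k, i ≠ j → i ≠ k → j ≠ k → ⁅g i j, g i k + g j k⁆ = 0)
    (h4 : ∀ i j k l, i ≠ j → i ≠ k → i ≠ l → j ≠ k → j ≠ l → k ≠ l → ⁅g i j, g k l⁆ = 0) :
    LieT K n →ₗ⁅K⁆ L :=
  LiePres.lift K _ (lift_TRel K g hs h3 h4)

theorem LieT.lift_t {n : ℕ} (g : Fin n → Fin n → L) (hs : ∀ i j, i ≠ j → g j i = g i j)
    (h3 : ∀ i j k, i ≠ j → i ≠ k → j ≠ k → ⁅g i j, g i k + g j k⁆ = 0)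
    (h4 : ∀ i j k l, i ≠ j → i ≠ k → i ≠ l → j ≠ k → j ≠ l → k ≠ l → ⁅g i j, g k l⁆ = 0)
    {i j : Fin n} (h : i ≠ j) : LieT.lift g hs h3 h4 (LieT.t K i j) = g i j :=
  lift_freeT K _ g (fun _ => rfl) h

end Generation

/-! ### Values of an associator in an arbitrary Lie algebra. -/

section AssociatorIdentities

variable {K : Type u} [CommRing K] [Algebra ℚ K] {L : Type u} [LieRing L] [LieAlgebra K L]
  {L' : Type u} [LieRing L'] [LieAlgebra K L']

theorem map_subst (f : L →ₗ⁅K⁆ L') (Φ : expGroup K (LieF2 K)) (x y : L) :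
    expGroup.map K f (subst Φ x y) = subst Φ (f x) (f y) := by
  rw [subst, subst, expGroup.map_map]
  congr 2
  refine FreeLieAlgebra.hom_ext fun i => ?_
  rw [LieHom.comp_apply, FreeLieAlgebra.lift_of_apply, FreeLieAlgebra.lift_of_apply]
  fin_cases i <;> rfl

theorem map_expHalf (f : L →ₗ⁅K⁆ L') (μ : K) (x : L) :
    expGroup.map K f (expHalf μ x) = expHalf μ (f x) := by
  rw [expHalf, expHalf, expGroup.map_exp, map_smul]

theorem expHalf_add (μ : K) {x y : L} (h : ⁅x, y⁆ = 0) :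
    expHalf μ (x + y) = expHalf μ x * expHalf μ y := by
  rw [expHalf, smul_add, expGroup.exp_add]
  · rfl
  · rw [smul_lie, lie_smul, h, smul_zero, smul_zero]

theorem expHalf_zero (μ : K) : expHalf μ (0 : L) = 1 := by
  rw [expHalf, smul_zero, expGroup.exp_zero]

theorem expHalf_neg (μ : K) (x : L) : expHalf μ (-x) = (expHalf μ x)⁻¹ := by
  rw [eq_inv_iff_mul_eq_one, ← expHalf_add μ (by simp), neg_add_cancel, expHalf_zero]

theorem commute_expHalf (μ : K) {x y : L} (h : ⁅x, y⁆ = 0) :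
    Commute (expHalf μ x) (expHalf μ y) :=
  expGroup.commute_exp K (by rw [smul_lie, lie_smul, h, smul_zero, smul_zero])

theorem commute_map_expHalf (f : L →ₗ⁅K⁆ L') (μ : K) {a : L'} (h : ∀ y, ⁅f y, a⁆ = 0)
    (u : expGroup K L) : Commute (expGroup.map K f u) (expHalf μ a) :=
  expGroup.commute_map_exp K f (fun y => by rw [lie_smul, h, smul_zero]) u

theorem commute_map_subst (f : L →ₗ⁅K⁆ L') (Φ : expGroup K (LieF2 K)) {a b : L'}
    (ha : ∀ y, ⁅f y, a⁆ = 0) (hb : ∀ y, ⁅f y, b⁆ = 0) (u : expGroup K L) :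
    Commute (expGroup.map K f u) (subst Φ a b) :=
  expGroup.commute_map_map K _ _ (fun y z => by
    rw [← lie_skew, lift_pair_commute, neg_zero]
    · rw [← lie_skew, ha, neg_zero]
    · rw [← lie_skew, hb, neg_zero]) _ _

namespace Associator

variable (a : Associator K)

/-- The pentagon relation for a family of elements satisfying the relations of `t_4`. -/
theorem pentagon_of (g : Fin 4 → Fin 4 → L) (hs : ∀ i j, i ≠ j → g j i = g i j)
    (h3 : ∀ i j k, i ≠ j → i ≠ k → j ≠ k → ⁅g i j, g i k + g j k⁆ = 0)
    (h4 : ∀ i j k l, i ≠ j → i ≠ k → i ≠ l → j ≠ k → j ≠ l → k ≠ l → ⁅g i j, g k l⁆ = 0) :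
    subst a.Φ (g 0 1) (g 1 2 + g 1 3) * subst a.Φ (g 0 2 + g 1 2) (g 2 3) =
      subst a.Φ (g 1 2) (g 2 3) * subst a.Φ (g 0 1 + g 0 2) (g 1 3 + g 2 3) *
        subst a.Φ (g 0 1) (g 1 2) := by
  have h := congrArg (expGroup.map K (LieT.lift g hs h3 h4)) (a.pentagon _ rfl)
  have e : ∀ {i j : Fin 4}, i ≠ j → LieT.lift g hs h3 h4 (LieT.t K i j) = g i j :=
    fun h => LieT.lift_t g hs h3 h4 h
  simpa only [map_mul, map_subst, map_add, e (show (0 : Fin 4) ≠ 1 by decide),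
    e (show (1 : Fin 4) ≠ 2 by decide), e (show (2 : Fin 4) ≠ 3 by decide),
    e (show (0 : Fin 4) ≠ 2 by decide), e (show (1 : Fin 4) ≠ 3 by decide)] using h

/-- The matrix of a symmetric family with zeroes on the diagonal. -/
def symmFamily {L : Type*} [Zero L] (x01 x02 x03 x12 x13 x23 : L) : Fin 4 → Fin 4 → L :=
  ![![0, x01, x02, x03], ![x01, 0, x12, x13], ![x02, x12, 0, x23], ![x03, x13, x23, 0]]

/-- This is the pentagon on four strands where only t_01 = x and t_23 = y are nonzero; the relations
of t_4 then reduce to the commutation of x and y. All the vanishing statements for Φ are obtained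
from it by cancellation. -/
theorem pentagon_comm {x y : L} (h : ⁅x, y⁆ = 0) :
    subst a.Φ x 0 * subst a.Φ 0 y = subst a.Φ 0 y * subst a.Φ x y * subst a.Φ x 0 := by
  have h' : ⁅y, x⁆ = 0 := by rw [← lie_skew, h, neg_zero]
  have := a.pentagon_of (symmFamily x 0 0 0 0 y)
    (by intro i j; fin_cases i <;> fin_cases j <;> intro _ <;> rfl)
    (by intro i j k; fin_cases i <;> fin_cases j <;> fin_cases k <;> simp [symmFamily])
    (by
      intro i j k l
      fin_cases i <;> fin_cases j <;> fin_cases k <;> fin_cases l <;> simp [symmFamily, h, h'])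
  simpa [symmFamily] using this

theorem subst_zero_zero : subst a.Φ (0 : L) 0 = 1 := by
  have := a.pentagon_comm (x := (0 : L)) (y := 0) (by simp)
  simpa using this

theorem subst_zero_right (x : L) : subst a.Φ x 0 = 1 := by
  have := a.pentagon_comm (x := x) (y := 0) (by simp)
  simpa [subst_zero_zero] using this

theorem subst_zero_left (y : L) : subst a.Φ 0 y = 1 := by
  have := a.pentagon_comm (x := (0 : L)) (y := y) (by simp)
  simpa [subst_zero_zero] using this

/-- Once Φ(x, 0) and Φ(0, y) are known to be trivial, `pentagon_comm` has only one factor left. In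
p_n this kills the associativity constraints attached to moves of the root. -/
theorem subst_of_commute {x y : L} (h : ⁅x, y⁆ = 0) : subst a.Φ x y = 1 := by
  have := a.pentagon_comm h
  simpa [subst_zero_left, subst_zero_right] using this.symm

/-- In the pentagon take t_01 = x, t_12 = y, t_13 = z and t_02 = -x - y, the others being zero. The
choice of t_02 makes t_01 + t_02 + t_12 vanish, so the relations of t_4 hold, and every factor other
than the two in the statement has a zero argument or commuting arguments. -/
theorem subst_add_central_right {x y z : L} (hx : ⁅x, z⁆ = 0) (hy : ⁅y, z⁆ = 0) :
    subst a.Φ x (y + z) = subst a.Φ x y := by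
  have hx' : ⁅z, x⁆ = 0 := by rw [← lie_skew, hx, neg_zero]
  have hy' : ⁅z, y⁆ = 0 := by rw [← lie_skew, hy, neg_zero]
  have e : ⁅x, y⁆ = -⁅y, x⁆ := (lie_skew x y).symm
  have := a.pentagon_of (symmFamily x (-x - y) 0 y z 0)
    (by intro i j; fin_cases i <;> fin_cases j <;> intro _ <;> rfl)
    (by
      intro i j k
      fin_cases i <;> fin_cases j <;> fin_cases k <;> simp [symmFamily, hx, hy, hx', hy', e, -lie_skew])
    (by
      intro i j k l
      fin_cases i <;> fin_cases j <;> fin_cases k <;> fin_cases l <;>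
        simp [symmFamily, hx, hy, hx', hy'])
  have e' : x + (-x - y) = -y := by abel
  simpa [symmFamily, subst_zero_right, e', a.subst_of_commute (x := -y) (y := z) (by simp [hy])]
    using this

theorem subst_swap (x y : L) : subst a.Φ y x = (subst a.Φ x y)⁻¹ := by
  have h := congrArg (expGroup.map K (FreeLieAlgebra.lift K ![x, y])) a.duality
  rw [map_subst, map_inv, FreeLieAlgebra.lift_of_apply, FreeLieAlgebra.lift_of_apply] at h
  exact h

theorem subst_add_central_left {x y z : L} (hx : ⁅x, z⁆ = 0) (hy : ⁅y, z⁆ = 0) :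
    subst a.Φ (x + z) y = subst a.Φ x y := by
  rw [a.subst_swap y, a.subst_add_central_right hy hx, a.subst_swap x, inv_inv]

/-- The hexagon relation for three elements whose sum is central in the Lie algebra which they
generate. -/
theorem hexagon_of {x y z : L} (hx : ⁅x, x + y + z⁆ = 0) (hy : ⁅y, x + y + z⁆ = 0)
    (hz : ⁅z, x + y + z⁆ = 0) :
    expHalf a.μ x * subst a.Φ z x * expHalf a.μ z * subst a.Φ y z * expHalf a.μ y *
      subst a.Φ x y = expHalf a.μ (x + y + z) := by
  set c := x + y + z with hc
  have h := congrArg (expGroup.map K (FreeLieAlgebra.lift K ![x, y]))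
    (a.hexagon _ _ (-FreeLieAlgebra.of K 0 - FreeLieAlgebra.of K 1) rfl rfl (by abel))
  -- The third variable of the hexagon goes to -x - y, which is z up to the central element c. That
  -- element is dropped inside Φ and splits off from the exponential.
  have e : -x - y = z + -c := by rw [hc]; abel
  have hx' : ⁅x, -c⁆ = 0 := by rw [lie_neg, hx, neg_zero]
  have hy' : ⁅y, -c⁆ = 0 := by rw [lie_neg, hy, neg_zero]
  have hz' : ⁅z, -c⁆ = 0 := by rw [lie_neg, hz, neg_zero]
  simp only [map_mul, map_subst, map_expHalf, map_sub, map_neg, map_one,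
    FreeLieAlgebra.lift_of_apply, Matrix.cons_val_zero, Matrix.cons_val_one] at h
  rw [e, a.subst_add_central_left hz' hx', a.subst_add_central_right hy' hz',
    expHalf_add _ hz', expHalf_neg] at h
  have c1 : Commute (subst a.Φ y z) (expHalf a.μ c) :=
    expGroup.commute_map_exp K _ (fun w => by
      rw [lie_smul, lift_pair_commute hy hz, smul_zero]) _
  have c2 : Commute (subst a.Φ x y) (expHalf a.μ c) :=
    expGroup.commute_map_exp K _ (fun w => by
      rw [lie_smul, lift_pair_commute hx hy, smul_zero]) _
  have c3 := commute_expHalf a.μ hy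
  have c4 : Commute (subst a.Φ y z * expHalf a.μ y * subst a.Φ x y) (expHalf a.μ c) :=
    (c1.mul_left c3).mul_left c2
  rw [← mul_inv_eq_one, ← h]
  have := c4.inv_right.eq
  simp only [mul_assoc] at this ⊢
  rw [this]

end Associator

end AssociatorIdentities

/-! ### Drinfeld–Kohno Lie algebras on any index set, and sums over blocks. -/

section DrinfeldKohno

variable (K : Type u) [CommRing K]

/-- The defining relations of the Drinfeld-Kohno Lie algebra on a set of indices `α`. -/
inductive DKRel (α : Type) : Set (FreeLieAlgebra K (α × α))
  | diag (i : α) : DKRel α (FreeLieAlgebra.of K (i, i))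
  | symm (i j : α) : DKRel α (FreeLieAlgebra.of K (j, i) - FreeLieAlgebra.of K (i, j))
  | triple (i j k : α) (hij : i ≠ j) (hik : i ≠ k) (hjk : j ≠ k) :
      DKRel α ⁅FreeLieAlgebra.of K (i, j), FreeLieAlgebra.of K (i, k) + FreeLieAlgebra.of K (j, k)⁆
  | quad (i j k l : α) (hij : i ≠ j) (hik : i ≠ k) (hil : i ≠ l) (hjk : j ≠ k)
      (hjl : j ≠ l) (hkl : k ≠ l) :
      DKRel α ⁅FreeLieAlgebra.of K (i, j), FreeLieAlgebra.of K (k, l)⁆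

/-- The Drinfeld-Kohno Lie algebra on a set of indices `α`. -/
abbrev DK (α : Type) : Type u := LiePres K (DKRel K α)

namespace DK

variable {α β γ : Type}

/-- The generator `t_ij`. -/
noncomputable def t (i j : α) : DK K α := LiePres.mk K _ (FreeLieAlgebra.of K (i, j))

theorem t_self (i : α) : t K i i = 0 := LiePres.mk_eq_zero K _ (DKRel.diag i)

theorem t_comm (i j : α) : t K j i = t K i j := by
  have := LiePres.mk_eq_zero K _ (DKRel.symm (K := K) i j)
  rwa [map_sub, sub_eq_zero] at this

/-- Since t_ii = 0, the case i = j needs no exclusion. This is what allows sums over blocks to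
include their diagonal terms. -/
theorem t_triple {i j k : α} (hik : i ≠ k) (hjk : j ≠ k) :
    ⁅t K i j, t K i k + t K j k⁆ = 0 := by
  by_cases hij : i = j
  · rw [hij, t_self, zero_lie]
  · have := LiePres.mk_eq_zero K _ (DKRel.triple (K := K) i j k hij hik hjk)
    rwa [LieHom.map_lie, map_add] at this

theorem t_quad {i j k l : α} (hik : i ≠ k) (hil : i ≠ l) (hjk : j ≠ k) (hjl : j ≠ l) :
    ⁅t K i j, t K k l⁆ = 0 := by
  by_cases hij : i = j
  · rw [hij, t_self, zero_lie]
  by_cases hkl : k = l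
  · rw [hkl, t_self, lie_zero]
  have := LiePres.mk_eq_zero K _ (DKRel.quad (K := K) i j k l hij hik hil hjk hjl hkl)
  rwa [LieHom.map_lie] at this

variable {K} {L : Type w} [LieRing L] [LieAlgebra K L]

/-- The morphism with prescribed values on the generators. -/
noncomputable def lift (g : α → α → L) (hd : ∀ i, g i i = 0) (hs : ∀ i j, g j i = g i j)
    (h3 : ∀ i j k, i ≠ j → i ≠ k → j ≠ k → ⁅g i j, g i k + g j k⁆ = 0)
    (h4 : ∀ i j k l, i ≠ j → i ≠ k → i ≠ l → j ≠ k → j ≠ l → k ≠ l → ⁅g i j, g k l⁆ = 0) :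
    DK K α →ₗ⁅K⁆ L :=
  LiePres.lift K (fun q => g q.1 q.2) <| by
    intro x hx
    cases hx with
    | diag i => simp [hd]
    | symm i j => simp [hs i j]
    | triple i j k hij hik hjk => simpa using h3 i j k hij hik hjk
    | quad i j k l hij hik hil hjk hjl hkl => simpa using h4 i j k l hij hik hil hjk hjl hkl

theorem lift_t (g : α → α → L) (hd : ∀ i, g i i = 0) (hs : ∀ i j, g j i = g i j)
    (h3 : ∀ i j k, i ≠ j → i ≠ k → j ≠ k → ⁅g i j, g i k + g j k⁆ = 0)
    (h4 : ∀ i j k l, i ≠ j → i ≠ k → i ≠ l → j ≠ k → j ≠ l → k ≠ l → ⁅g i j, g k l⁆ = 0)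
    (i j : α) : lift g hd hs h3 h4 (t K i j) = g i j := by
  rw [t, lift, LiePres.lift_mk, FreeLieAlgebra.lift_of_apply]

theorem hom_ext {f g : DK K α →ₗ⁅K⁆ L} (h : ∀ i j, f (t K i j) = g (t K i j)) : f = g :=
  LiePres.hom_ext K fun q => h q.1 q.2

theorem commute_of_forall (f : DK K α →ₗ⁅K⁆ L) {a : L} (h : ∀ i j, ⁅f (t K i j), a⁆ = 0)
    (y : DK K α) : ⁅f y, a⁆ = 0 :=
  LiePres.commute_of_forall f (fun q => h q.1 q.2) y

variable (K)

/-- The morphism `t_ij ↦ t_{e(i) e(j)}` attached to an injection `e`. -/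
noncomputable def map (e : α ↪ β) : DK K α →ₗ⁅K⁆ DK K β :=
  lift (fun i j => t K (e i) (e j)) (fun _ => t_self K _) (fun _ _ => t_comm K _ _)
    (fun _ _ _ _ hik hjk => t_triple K (e.injective.ne hik) (e.injective.ne hjk))
    (fun _ _ _ _ _ hik hil hjk hjl _ => t_quad K (e.injective.ne hik) (e.injective.ne hil)
      (e.injective.ne hjk) (e.injective.ne hjl))

theorem map_t (e : α ↪ β) (i j : α) : map K e (t K i j) = t K (e i) (e j) := lift_t ..

theorem map_comp_map (e : α ↪ β) (e' : β ↪ γ) : (map K e').comp (map K e) = map K (e.trans e') :=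
  hom_ext fun i j => by
    rw [LieHom.comp_apply, map_t, map_t, map_t]; rfl

/-- The sum of the `t_ij`, for `i ∈ I` and `j ∈ J`. -/
noncomputable def T (I J : Finset α) : DK K α := ∑ i ∈ I, ∑ j ∈ J, t K i j

theorem T_comm (I J : Finset α) : T K J I = T K I J := by
  rw [T, T, Finset.sum_comm]
  exact Finset.sum_congr rfl fun i _ => Finset.sum_congr rfl fun j _ => t_comm K i j

theorem map_T (e : α ↪ β) (I J : Finset α) : map K e (T K I J) = T K (I.map e) (J.map e) := by
  simp only [T, map_sum, map_t, Finset.sum_map]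

@[simp] theorem T_empty_left (J : Finset α) : T K ∅ J = 0 := by simp [T]

@[simp] theorem T_empty_right (I : Finset α) : T K I ∅ = 0 := by simp [T]

theorem T_union_left [DecidableEq α] {I I' : Finset α} (h : Disjoint I I') (J : Finset α) :
    T K (I ∪ I') J = T K I J + T K I' J := by
  rw [T, Finset.sum_union h]; rfl

/-- For each j in J, the terms t_kj and t_lj together commute with t_kl by the three-term relation,
and the remaining t_ij have indices disjoint from k and l. -/
theorem t_T_inside {I J : Finset α} (h : Disjoint I J) {k l : α} (hk : k ∈ I) (hl : l ∈ I) :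
    ⁅t K k l, T K I J⁆ = 0 := by
  classical
  by_cases hkl : k = l
  · rw [hkl, t_self, zero_lie]
  rw [T, Finset.sum_comm, lie_sum]
  refine Finset.sum_eq_zero fun j hj => ?_
  have hne : ∀ i ∈ I, i ≠ j := fun i hi e => Finset.disjoint_left.1 h hi (e ▸ hj)
  rw [← Finset.add_sum_erase I _ hk, ← Finset.add_sum_erase (I.erase k) _
    (Finset.mem_erase.2 ⟨Ne.symm hkl, hl⟩), ← add_assoc, lie_add,
    t_triple K (hne k hk) (hne l hl), zero_add, lie_sum]
  refine Finset.sum_eq_zero fun i hi => ?_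
  have h1 := Finset.ne_of_mem_erase hi
  have h2 := Finset.mem_of_mem_erase hi
  exact t_quad K (Finset.ne_of_mem_erase h2).symm (hne k hk) h1.symm (hne l hl)

theorem t_T_outside {I J : Finset α} {k l : α} (hkI : k ∉ I) (hlI : l ∉ I) (hkJ : k ∉ J)
    (hlJ : l ∉ J) : ⁅t K k l, T K I J⁆ = 0 := by
  rw [T, lie_sum]
  refine Finset.sum_eq_zero fun i hi => ?_
  rw [lie_sum]
  refine Finset.sum_eq_zero fun j hj => ?_
  have ne : ∀ {a b : α} {A : Finset α}, a ∉ A → b ∈ A → a ≠ b := fun h h' e => h (e ▸ h')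
  exact t_quad K (ne hkI hi) (ne hkJ hj) (ne hlI hi) (ne hlJ hj)

/-- The set `R` is contained in `I` or disjoint from it. -/
def Separates (R : Set α) (I : Finset α) : Prop := (∀ x ∈ R, x ∈ I) ∨ ∀ x ∈ R, x ∉ I

theorem t_T_of_separates {I J : Finset α} (h : Disjoint I J) {R : Set α} (hI : Separates R I)
    (hJ : Separates R J) {k l : α} (hk : k ∈ R) (hl : l ∈ R) : ⁅t K k l, T K I J⁆ = 0 := by
  rcases hI with hI | hI
  · exact t_T_inside K h (hI k hk) (hI l hl)
  rcases hJ with hJ | hJ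
  · rw [T_comm]
    exact t_T_inside K h.symm (hJ k hk) (hJ l hl)
  · exact t_T_outside K (hI k hk) (hI l hl) (hJ k hk) (hJ l hl)

theorem T_T_eq_zero {A B I J : Finset α} (h : ∀ a ∈ A, ∀ b ∈ B, ⁅t K a b, T K I J⁆ = 0) :
    ⁅T K A B, T K I J⁆ = 0 := by
  rw [T, sum_lie]
  refine Finset.sum_eq_zero fun i hi => ?_
  rw [sum_lie]
  exact Finset.sum_eq_zero fun j hj => h i hi j hj

theorem T_T_disjoint {A B I J : Finset α} (h1 : Disjoint A I) (h2 : Disjoint A J)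
    (h3 : Disjoint B I) (h4 : Disjoint B J) : ⁅T K A B, T K I J⁆ = 0 :=
  T_T_eq_zero K fun _ ha _ hb => t_T_outside K (Finset.disjoint_left.1 h1 ha)
    (Finset.disjoint_left.1 h3 hb) (Finset.disjoint_left.1 h2 ha) (Finset.disjoint_left.1 h4 hb)

theorem T_self_T {I J : Finset α} (h : Disjoint I J) : ⁅T K I I, T K I J⁆ = 0 :=
  T_T_eq_zero K fun _ ha _ hb => t_T_inside K h ha hb

/-- The sum on the right is T(I ∪ J, M), which commutes with every generator whose two indices lie
in I ∪ J. -/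
theorem T_T_triple {I J M : Finset α} (h1 : Disjoint I J) (h2 : Disjoint I M)
    (h3 : Disjoint J M) : ⁅T K I J, T K I M + T K J M⁆ = 0 := by
  classical
  rw [← T_union_left K h1]
  exact T_T_eq_zero K fun _ ha _ hb => t_T_inside K (Finset.disjoint_union_left.2 ⟨h2, h3⟩)
    (Finset.mem_union_left _ ha) (Finset.mem_union_right _ hb)

theorem T_T_total {I J M : Finset α} (h1 : Disjoint I J) (h2 : Disjoint I M) (h3 : Disjoint J M) :
    ⁅T K I J, T K I J + T K J M + T K I M⁆ = 0 := by
  rw [add_assoc, lie_add, lie_self, zero_add, add_comm]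
  exact T_T_triple K h1 h2 h3

end DK

end DrinfeldKohno

/-! ### The pentagon and the hexagons for blocks of strands. -/

section Cabling

open DK

variable {K : Type u} [CommRing K] [Algebra ℚ K] {α : Type} (a : Associator K)

namespace Associator

/-- The pentagon relation for pairwise disjoint blocks of indices. -/
theorem pentagon_T {I J M N : Finset α} (h01 : Disjoint I J) (h02 : Disjoint I M)
    (h03 : Disjoint I N) (h12 : Disjoint J M) (h13 : Disjoint J N) (h23 : Disjoint M N) :
    subst a.Φ (T K I J) (T K J M + T K J N) * subst a.Φ (T K I M + T K J M) (T K M N) =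
      subst a.Φ (T K J M) (T K M N) * subst a.Φ (T K I J + T K I M) (T K J N + T K M N) *
        subst a.Φ (T K I J) (T K J M) := by
  let F : Fin 4 → Finset α := ![I, J, M, N]
  have hF : ∀ i j, i ≠ j → Disjoint (F i) (F j) := by
    intro i j h
    fin_cases i <;> fin_cases j <;>
      first
      | exact absurd rfl h
      | assumption
      | (apply Disjoint.symm; assumption)
  exact a.pentagon_of (fun i j => T K (F i) (F j)) (fun i j _ => T_comm K _ _)
    (fun i j k hij hik hjk => T_T_triple K (hF i j hij) (hF i k hik) (hF j k hjk))
    (fun i j k l _ hik hil hjk hjl _ => T_T_disjoint K (hF i k hik) (hF i l hil) (hF j k hjk)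
      (hF j l hjl))

/-- The hexagon relation for pairwise disjoint blocks of indices. -/
theorem hexagon_T {I J M : Finset α} (h1 : Disjoint I J) (h2 : Disjoint I M) (h3 : Disjoint J M) :
    expHalf a.μ (T K I J) * subst a.Φ (T K I M) (T K I J) * expHalf a.μ (T K I M) *
      subst a.Φ (T K J M) (T K I M) * expHalf a.μ (T K J M) * subst a.Φ (T K I J) (T K J M) =
      expHalf a.μ (T K I J + T K J M + T K I M) := by
  refine a.hexagon_of (T_T_total K h1 h2 h3) ?_ ?_
  · have := T_T_total K h3 h1.symm h2.symm
    rw [T_comm K I J, T_comm K I M] at this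
    rwa [show T K I J + T K J M + T K I M = T K J M + T K I M + T K I J by abel]
  · have := T_T_total K h2 h1 h3.symm
    rw [T_comm K J M] at this
    rwa [show T K I J + T K J M + T K I M = T K I M + T K J M + T K I J by abel]

/-- The hexagon which expresses the braiding of `I` with `J ⊔ M`. -/
theorem hexagon_T_right {I J M : Finset α} (h1 : Disjoint I J) (h2 : Disjoint I M)
    (h3 : Disjoint J M) :
    subst a.Φ (T K J M) (T K I M) * expHalf a.μ (T K I J + T K I M) *
      subst a.Φ (T K I J) (T K J M) =
    expHalf a.μ (T K I M) * subst a.Φ (T K I J) (T K I M) * expHalf a.μ (T K I J) := by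
  -- The hexagon is taken for the blocks in the reverse order M, J, I. The total sum commutes with
  -- t_JM, so the exponential of t_IJ + t_IM is that of the total corrected by the exponential of
  -- -t_JM.
  have h := a.hexagon_T h3.symm h2.symm h1.symm
  have c := T_T_total K h3.symm h2.symm h1.symm
  rw [T_comm K J M, T_comm K I J, T_comm K I M] at h c
  replace c : ⁅-T K J M, T K J M + T K I J + T K I M⁆ = 0 := by rw [neg_lie, c, neg_zero]
  rw [show T K I J + T K I M = -T K J M + (T K J M + T K I J + T K I M) by abel,
    expHalf_add _ c, ← h, expHalf_neg, a.subst_swap (T K I M) (T K J M),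
    a.subst_swap (T K J M) (T K I J)]
  simp only [mul_assoc, mul_inv_cancel, mul_one, inv_mul_cancel_left]

/-- The hexagon which expresses the braiding of `I ⊔ J` with `M`. -/
theorem hexagon_T_left {I J M : Finset α} (h1 : Disjoint I J) (h2 : Disjoint I M)
    (h3 : Disjoint J M) :
    expHalf a.μ (T K I M + T K J M) =
      subst a.Φ (T K I M) (T K I J) * expHalf a.μ (T K I M) * subst a.Φ (T K J M) (T K I M) *
        expHalf a.μ (T K J M) * subst a.Φ (T K I J) (T K J M) := by
  have h := a.hexagon_T h1 h2 h3
  have c : ⁅-T K I J, T K I J + T K J M + T K I M⁆ = 0 := by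
    rw [neg_lie, T_T_total K h1 h2 h3, neg_zero]
  rw [show T K I M + T K J M = -T K I J + (T K I J + T K J M + T K I M) by abel, expHalf_add _ c,
    ← h, expHalf_neg]
  simp only [mul_assoc, inv_mul_cancel_left]

end Associator

end Cabling

/-! ### Semidirect products with permutations, supports and naturality. -/

section DKGroups

variable (K : Type u) [CommRing K] [Algebra ℚ K]

/-- The action of the permutations of `α` on the group of the Drinfeld-Kohno Lie algebra. -/
noncomputable def actDK (α : Type) : Equiv.Perm α →* MulAut (expGroup K (DK K α)) :=
  actOf (fun σ => expGroup.map K (DK.map K σ.toEmbedding))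
    (by
      have : DK.map K (1 : Equiv.Perm α).toEmbedding = LieHom.id :=
        DK.hom_ext fun i j => by rw [DK.map_t]; rfl
      rw [this, expGroup.map_id])
    (fun σ τ => by rw [← expGroup.map_comp, DK.map_comp_map]; rfl)

theorem actDK_apply {α : Type} (σ : Equiv.Perm α) (x : expGroup K (DK K α)) :
    actDK K α σ x = expGroup.map K (DK.map K σ.toEmbedding) x := rfl

/-- The semidirect product of the group of the Drinfeld-Kohno Lie algebra on `α` with the
permutations of `α`. -/
abbrev DKGrp (α : Type) : Type u := expGroup K (DK K α) ⋊[actDK K α] Equiv.Perm α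

namespace DKGrp

variable {α β γ : Type}

theorem embedding_comp_perm (e : α ↪ β) (σ : Equiv.Perm α) :
    σ.toEmbedding.trans e = e.trans (Equiv.Perm.viaEmbeddingHom e σ).toEmbedding := by
  ext i
  exact (Equiv.Perm.viaEmbedding_apply σ e i).symm

/-- Functoriality with respect to injections. -/
noncomputable def map (e : α ↪ β) : DKGrp K α →* DKGrp K β :=
  SemidirectProduct.map (expGroup.map K (DK.map K e)) (Equiv.Perm.viaEmbeddingHom e) fun σ => by
    change (expGroup.map K (DK.map K e)).comp (expGroup.map K (DK.map K σ.toEmbedding)) =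
      (expGroup.map K (DK.map K (Equiv.Perm.viaEmbeddingHom e σ).toEmbedding)).comp
        (expGroup.map K (DK.map K e))
    rw [← expGroup.map_comp, ← expGroup.map_comp, DK.map_comp_map, DK.map_comp_map,
      embedding_comp_perm]

variable {K}

theorem map_inl (e : α ↪ β) (x : expGroup K (DK K α)) :
    map K e (SemidirectProduct.inl x) = SemidirectProduct.inl (expGroup.map K (DK.map K e) x) :=
  SemidirectProduct.map_inl ..

theorem map_inr (e : α ↪ β) (σ : Equiv.Perm α) :
    map K e (SemidirectProduct.inr σ) = SemidirectProduct.inr (Equiv.Perm.viaEmbeddingHom e σ) :=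
  SemidirectProduct.map_inr ..

theorem viaEmbedding_viaEmbedding (e : α ↪ β) (e' : β ↪ γ) (σ : Equiv.Perm α) :
    Equiv.Perm.viaEmbeddingHom e' (Equiv.Perm.viaEmbeddingHom e σ) =
      Equiv.Perm.viaEmbeddingHom (e.trans e') σ := by
  ext x
  simp only [Equiv.Perm.viaEmbeddingHom_apply]
  by_cases hx : x ∈ Set.range e'
  · obtain ⟨y, rfl⟩ := hx
    rw [Equiv.Perm.viaEmbedding_apply]
    by_cases hy : y ∈ Set.range e
    · obtain ⟨z, rfl⟩ := hy
      rw [Equiv.Perm.viaEmbedding_apply]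
      exact (Equiv.Perm.viaEmbedding_apply σ (e.trans e') z).symm
    · rw [Equiv.Perm.viaEmbedding_apply_of_notMem _ _ _ hy,
        Equiv.Perm.viaEmbedding_apply_of_notMem]
      rintro ⟨z, hz⟩
      exact hy ⟨z, e'.injective hz⟩
  · rw [Equiv.Perm.viaEmbedding_apply_of_notMem _ _ _ hx,
      Equiv.Perm.viaEmbedding_apply_of_notMem]
    rintro ⟨z, rfl⟩
    exact hx ⟨e z, rfl⟩

theorem ext_hom {G : Type*} [Group G] {f g : DKGrp K α →* G}
    (h : ∀ x, f (SemidirectProduct.inl x) = g (SemidirectProduct.inl x))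
    (h' : ∀ x, f (SemidirectProduct.inr x) = g (SemidirectProduct.inr x)) : f = g :=
  SemidirectProduct.hom_ext (MonoidHom.ext h) (MonoidHom.ext h')

theorem map_map (e : α ↪ β) (e' : β ↪ γ) (x : DKGrp K α) :
    map K e' (map K e x) = map K (e.trans e') x := by
  refine DFunLike.congr_fun (f := (map K e').comp (map K e)) (ext_hom (fun x => ?_) fun σ => ?_) x
  · rw [MonoidHom.comp_apply, map_inl, map_inl, map_inl, expGroup.map_map, DK.map_comp_map]
  · rw [MonoidHom.comp_apply, map_inr, map_inr, map_inr, viaEmbedding_viaEmbedding]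

theorem map_refl (x : DKGrp K α) : map K (Function.Embedding.refl α) x = x := by
  refine DFunLike.congr_fun (g := MonoidHom.id _) (ext_hom (fun x => ?_) fun σ => ?_) x
  · have : DK.map K (Function.Embedding.refl α) = LieHom.id :=
      DK.hom_ext fun i j => by rw [DK.map_t]; rfl
    rw [map_inl, this, expGroup.map_id]; rfl
  · rw [map_inr]
    exact congrArg SemidirectProduct.inr (Equiv.ext fun i =>
      Equiv.Perm.viaEmbedding_apply σ (Function.Embedding.refl α) i)

theorem inr_mul_inl (σ : Equiv.Perm α) (x : expGroup K (DK K α)) :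
    (SemidirectProduct.inr σ : DKGrp K α) * SemidirectProduct.inl x =
      SemidirectProduct.inl (expGroup.map K (DK.map K σ.toEmbedding) x) *
        SemidirectProduct.inr σ := by
  have := SemidirectProduct.inl_aut (φ := actDK K α) σ x
  rw [actDK_apply] at this
  rw [this]
  simp [mul_assoc]

/-- Conjugation by σ moves the support along σ. It is a group morphism, so it is compared with the
other side on the exponentials and on the permutations separately. -/
theorem inr_mul_map (e : α ↪ β) (σ : Equiv.Perm β) (x : DKGrp K α) :
    (SemidirectProduct.inr σ : DKGrp K β) * map K e x =
      map K (e.trans σ.toEmbedding) x * SemidirectProduct.inr σ := by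
  rw [← mul_inv_eq_iff_eq_mul]
  refine DFunLike.congr_fun (f := (MulAut.conj (SemidirectProduct.inr σ)).toMonoidHom.comp
    (map K e)) (ext_hom (fun x => ?_) fun τ => ?_) x
  · change SemidirectProduct.inr σ * map K e (SemidirectProduct.inl x) *
      (SemidirectProduct.inr σ)⁻¹ = _
    rw [mul_inv_eq_iff_eq_mul, map_inl, map_inl, inr_mul_inl, expGroup.map_map, DK.map_comp_map]
  · change SemidirectProduct.inr σ * map K e (SemidirectProduct.inr τ) *
      (SemidirectProduct.inr σ)⁻¹ = _
    rw [map_inr, map_inr, ← map_inv, ← map_mul, ← map_mul]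
    congr 1
    rw [mul_inv_eq_iff_eq_mul]
    ext i
    simp only [Equiv.Perm.mul_apply, Equiv.Perm.viaEmbeddingHom_apply]
    by_cases hi : i ∈ Set.range e
    · obtain ⟨j, rfl⟩ := hi
      rw [Equiv.Perm.viaEmbedding_apply]
      exact (Equiv.Perm.viaEmbedding_apply τ (e.trans σ.toEmbedding) j).symm
    · rw [Equiv.Perm.viaEmbedding_apply_of_notMem _ _ _ hi,
        Equiv.Perm.viaEmbedding_apply_of_notMem]
      rintro ⟨z, hz⟩
      exact hi ⟨z, σ.injective hz⟩

/-- The subgroup of the elements which commute with `w`. -/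
theorem commute_map_of {e : α ↪ β} {w : DKGrp K β}
    (h1 : ∀ x, Commute (SemidirectProduct.inl (expGroup.map K (DK.map K e) x)) w)
    (h2 : ∀ σ, Commute (SemidirectProduct.inr (Equiv.Perm.viaEmbeddingHom e σ)) w)
    (x : DKGrp K α) : Commute (map K e x) w := by
  rw [← SemidirectProduct.inl_left_mul_inr_right x, map_mul, map_inl, map_inr]
  exact (h1 _).mul_left (h2 _)

/-- Disjoint supports commute: generators with disjoint pairs of indices commute by the four-term
relation, and a permutation supported on one range fixes the other one pointwise. -/
theorem commute_map_map {e : α ↪ γ} {e' : β ↪ γ} (h : ∀ i j, e i ≠ e' j) (x : DKGrp K α)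
    (y : DKGrp K β) : Commute (map K e x) (map K e' y) := by
  have key : ∀ {α β : Type} {e : α ↪ γ} {e' : β ↪ γ}, (∀ i j, e i ≠ e' j) →
      ∀ (σ : Equiv.Perm α) (y : expGroup K (DK K β)),
      Commute (SemidirectProduct.inr (Equiv.Perm.viaEmbeddingHom e σ) : DKGrp K γ)
        (SemidirectProduct.inl (expGroup.map K (DK.map K e') y)) := by
    intro α β e e' h σ y
    change _ * _ = _ * _
    have he : e'.trans (Equiv.Perm.viaEmbeddingHom e σ).toEmbedding = e' := by
      refine Function.Embedding.ext fun j => Equiv.Perm.viaEmbedding_apply_of_notMem σ e _ ?_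
      rintro ⟨i, hi⟩
      exact h i j hi
    rw [inr_mul_inl, expGroup.map_map, DK.map_comp_map, he]
  refine commute_map_of (fun x => (commute_map_of (fun y => ?_) (fun τ => ?_) y).symm)
    (fun σ => (commute_map_of (fun y => ?_) (fun τ => ?_) y).symm) x
  · refine (expGroup.commute_map_map K _ _ (fun a b => ?_) y x).map SemidirectProduct.inl
    rw [← lie_skew, neg_eq_zero]
    refine DK.commute_of_forall _ (fun i j => ?_) b
    rw [← lie_skew, neg_eq_zero]
    refine DK.commute_of_forall _ (fun k l => ?_) a
    rw [DK.map_t, DK.map_t]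
    exact DK.t_quad K (h _ _).symm (h _ _).symm (h _ _).symm (h _ _).symm
  · exact key (fun i j => (h j i).symm) τ x
  · exact (key h σ y).symm
  · refine Commute.map ?_ SemidirectProduct.inr
    change _ * _ = _ * _
    ext i
    simp only [Equiv.Perm.mul_apply, Equiv.Perm.viaEmbeddingHom_apply]
    by_cases hi : i ∈ Set.range e
    · obtain ⟨j, rfl⟩ := hi
      have : ∀ j, e j ∉ Set.range e' := by rintro j ⟨k, hk⟩; exact h j k hk.symm
      rw [Equiv.Perm.viaEmbedding_apply, Equiv.Perm.viaEmbedding_apply_of_notMem _ _ _ (this _),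
        Equiv.Perm.viaEmbedding_apply_of_notMem _ _ _ (this _), Equiv.Perm.viaEmbedding_apply]
    · rw [Equiv.Perm.viaEmbedding_apply_of_notMem _ _ _ hi]
      by_cases hi' : i ∈ Set.range e'
      · obtain ⟨j, rfl⟩ := hi'
        have : ∀ j, e' j ∉ Set.range e := by rintro j ⟨k, hk⟩; exact h k j hk
        rw [Equiv.Perm.viaEmbedding_apply, Equiv.Perm.viaEmbedding_apply_of_notMem _ _ _ (this _)]
      · rw [Equiv.Perm.viaEmbedding_apply_of_notMem _ _ _ hi',
          Equiv.Perm.viaEmbedding_apply_of_notMem _ _ _ hi]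

theorem map_viaEmbedding_eq {e : α ↪ β} {I : Finset β} (h : DK.Separates (Set.range e) I)
    (σ : Equiv.Perm α) : I.map (Equiv.Perm.viaEmbeddingHom e σ).toEmbedding = I := by
  have sub : ∀ σ : Equiv.Perm α, ∀ i ∈ I, Equiv.Perm.viaEmbedding σ e i ∈ I := by
    intro σ i hi
    by_cases hie : i ∈ Set.range e
    · rcases h with h | h
      · obtain ⟨j, rfl⟩ := hie
        rw [Equiv.Perm.viaEmbedding_apply]
        exact h _ ⟨_, rfl⟩
      · exact absurd hi (h i hie)
    · rwa [Equiv.Perm.viaEmbedding_apply_of_notMem _ _ _ hie]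
  apply Finset.eq_of_subset_of_card_le
  · intro i hi
    obtain ⟨j, hj, rfl⟩ := Finset.mem_map.1 hi
    exact sub σ j hj
  · rw [Finset.card_map]

/-- This is the naturality of cabling. An element acting inside one block, or away from the blocks,
commutes with t_IJ on its Lie part, and its permutation preserves I and J as sets. -/
theorem commute_map_expHalf {e : α ↪ β} {I J : Finset β} (h : Disjoint I J)
    (hI : DK.Separates (Set.range e) I) (hJ : DK.Separates (Set.range e) J) (μ : K)
    (x : DKGrp K α) :
    Commute (map K e x) (SemidirectProduct.inl (expHalf μ (DK.T K I J))) := by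
  refine commute_map_of (fun x => Commute.map (_root_.commute_map_expHalf _ _ (fun y => ?_) x)
    SemidirectProduct.inl) (fun σ => ?_) x
  · refine DK.commute_of_forall _ (fun i j => ?_) y
    rw [DK.map_t]
    exact DK.t_T_of_separates K h hI hJ ⟨i, rfl⟩ ⟨j, rfl⟩
  · change _ * _ = _ * _
    rw [inr_mul_inl, map_expHalf, DK.map_T, map_viaEmbedding_eq hI, map_viaEmbedding_eq hJ]

theorem commute_map_subst {e : α ↪ β} {I J M N : Finset β} (h : Disjoint I J) (h' : Disjoint M N)
    (hI : DK.Separates (Set.range e) I) (hJ : DK.Separates (Set.range e) J)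
    (hM : DK.Separates (Set.range e) M) (hN : DK.Separates (Set.range e) N)
    (Φ : expGroup K (LieF2 K)) (x : DKGrp K α) :
    Commute (map K e x) (SemidirectProduct.inl (subst Φ (DK.T K I J) (DK.T K M N))) := by
  refine commute_map_of (fun x => Commute.map (_root_.commute_map_subst _ _ (fun y => ?_)
    (fun y => ?_) x) SemidirectProduct.inl) (fun σ => ?_) x
  · refine DK.commute_of_forall _ (fun i j => ?_) y
    rw [DK.map_t]
    exact DK.t_T_of_separates K h hI hJ ⟨i, rfl⟩ ⟨j, rfl⟩
  · refine DK.commute_of_forall _ (fun i j => ?_) y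
    rw [DK.map_t]
    exact DK.t_T_of_separates K h' hM hN ⟨i, rfl⟩ ⟨j, rfl⟩
  · change _ * _ = _ * _
    rw [inr_mul_inl, map_subst, DK.map_T, DK.map_T, map_viaEmbedding_eq hI,
      map_viaEmbedding_eq hJ, map_viaEmbedding_eq hM, map_viaEmbedding_eq hN]

end DKGrp

end DKGroups

/-! ### The stable group on the index set ℕ. -/

section Stable

variable (K : Type u) [CommRing K]

theorem LieT.t_self {n : ℕ} (i : Fin n) : LieT.t K i i = 0 := by
  rw [LieT.t, freeT, dif_neg (by simp), map_zero]

theorem LieT.t_comm {n : ℕ} (i j : Fin n) : LieT.t K j i = LieT.t K i j := by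
  by_cases h : i = j
  · rw [h]
  · have := LiePres.mk_eq_zero K _ (TRel.symm (K := K) i j h)
    rwa [map_sub, sub_eq_zero] at this

theorem LieT.t_triple {n : ℕ} {i j k : Fin n} (h1 : i ≠ j) (h2 : i ≠ k) (h3 : j ≠ k) :
    ⁅LieT.t K i j, LieT.t K i k + LieT.t K j k⁆ = 0 := by
  have := LiePres.mk_eq_zero K _ (TRel.triple (K := K) i j k h1 h2 h3)
  rwa [LieHom.map_lie, map_add] at this

theorem LieT.t_quad {n : ℕ} {i j k l : Fin n} (h1 : i ≠ j) (h2 : i ≠ k) (h3 : i ≠ l) (h4 : j ≠ k)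
    (h5 : j ≠ l) (h6 : k ≠ l) : ⁅LieT.t K i j, LieT.t K k l⁆ = 0 := by
  have := LiePres.mk_eq_zero K _ (TRel.quad (K := K) i j k l h1 h2 h3 h4 h5 h6)
  rwa [LieHom.map_lie] at this

/-- The morphism from `t_n` to the Drinfeld-Kohno Lie algebra on `α` attached to an injection. -/
noncomputable def LieT.toDK {n : ℕ} {α : Type} (e : Fin n ↪ α) : LieT K n →ₗ⁅K⁆ DK K α :=
  LieT.lift (fun i j => DK.t K (e i) (e j)) (fun _ _ _ => DK.t_comm K _ _)
    (fun _ _ _ _ h h' => DK.t_triple K (e.injective.ne h) (e.injective.ne h'))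
    (fun _ _ _ _ _ h1 h2 h3 h4 _ => DK.t_quad K (e.injective.ne h1) (e.injective.ne h2)
      (e.injective.ne h3) (e.injective.ne h4))

theorem LieT.toDK_t {n : ℕ} {α : Type} (e : Fin n ↪ α) (i j : Fin n) :
    LieT.toDK K e (LieT.t K i j) = DK.t K (e i) (e j) := by
  by_cases h : i = j
  · rw [h, LieT.t_self, DK.t_self, map_zero]
  · exact LieT.lift_t _ _ _ _ h

/-- The element `t_ij` of `t_n`, with `t_ij = 0` if `i` or `j` is out of range. -/
noncomputable def LieT.natT (n i j : ℕ) : LieT K n :=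
  if h : i < n ∧ j < n then LieT.t K ⟨i, h.1⟩ ⟨j, h.2⟩ else 0

theorem LieT.natT_of_lt {n i j : ℕ} (hi : i < n) (hj : j < n) :
    LieT.natT K n i j = LieT.t K ⟨i, hi⟩ ⟨j, hj⟩ := dif_pos ⟨hi, hj⟩

theorem LieT.natT_of_not {n i j : ℕ} (h : ¬(i < n ∧ j < n)) : LieT.natT K n i j = 0 := dif_neg h

/-- The retraction onto `t_n` which kills the `t_ij` such that `i` or `j` is out of range. -/
noncomputable def DK.toLieT (n : ℕ) : DK K ℕ →ₗ⁅K⁆ LieT K n :=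
  DK.lift (LieT.natT K n)
    (fun i => by
      rw [LieT.natT]
      split_ifs
      · exact LieT.t_self K _
      · rfl)
    (fun i j => by
      rw [LieT.natT, LieT.natT]
      split_ifs
      · exact LieT.t_comm K _ _
      all_goals first | rfl | omega)
    (fun i j k hij hik hjk => by
      by_cases h : i < n ∧ j < n
      · by_cases hk : k < n
        · rw [LieT.natT_of_lt K h.1 h.2, LieT.natT_of_lt K h.1 hk, LieT.natT_of_lt K h.2 hk]
          refine LieT.t_triple K ?_ ?_ ?_ <;> simpa [Fin.ext_iff]
        · rw [LieT.natT_of_not K (show ¬(i < n ∧ k < n) by omega),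
            LieT.natT_of_not K (show ¬(j < n ∧ k < n) by omega), add_zero, lie_zero]
      · rw [LieT.natT_of_not K h, zero_lie])
    (fun i j k l hij hik hil hjk hjl hkl => by
      by_cases h : i < n ∧ j < n
      · by_cases hk : k < n ∧ l < n
        · rw [LieT.natT_of_lt K h.1 h.2, LieT.natT_of_lt K hk.1 hk.2]
          refine LieT.t_quad K ?_ ?_ ?_ ?_ ?_ ?_ <;> simpa [Fin.ext_iff]
        · rw [LieT.natT_of_not K hk, lie_zero]
      · rw [LieT.natT_of_not K h, zero_lie])

theorem DK.toLieT_t (n i j : ℕ) : DK.toLieT K n (DK.t K i j) = LieT.natT K n i j := DK.lift_t ..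

theorem DK.toLieT_comp (n : ℕ) :
    (DK.toLieT K n).comp (LieT.toDK K Fin.valEmbedding) = LieHom.id :=
  LieT.hom_ext K fun i j _ => by
    rw [LieHom.comp_apply, LieT.toDK_t, DK.toLieT_t]
    exact LieT.natT_of_lt K i.2 j.2

variable [Algebra ℚ K]

/-- The morphism from `exp(t_n^) ⋊ S_n` to its analogue for the set of indices `Fin n`. -/
noncomputable def GrpT.toDKGrp (n : ℕ) : GrpT K n →* DKGrp K (Fin n) :=
  SemidirectProduct.map (expGroup.map K (LieT.toDK K (Function.Embedding.refl _)))
    (MonoidHom.id _) fun σ => by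
    change (expGroup.map K (LieT.toDK K (Function.Embedding.refl _))).comp
      (expGroup.map K (LieT.map K σ.toEmbedding)) = (expGroup.map K (DK.map K σ.toEmbedding)).comp
        (expGroup.map K (LieT.toDK K (Function.Embedding.refl _)))
    rw [← expGroup.map_comp, ← expGroup.map_comp]
    congr 1
    refine LieT.hom_ext K fun i j h => ?_
    rw [LieHom.comp_apply, LieHom.comp_apply, LieT.map_t K _ h, LieT.toDK_t, LieT.toDK_t,
      DK.map_t]
    rfl

/-- The embedding of `exp(t_n^) ⋊ S_n` in the group attached to the set of indices `ℕ`. -/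
noncomputable def GrpT.emb (n : ℕ) : GrpT K n →* DKGrp K ℕ :=
  (DKGrp.map K Fin.valEmbedding).comp (GrpT.toDKGrp K n)

variable {K}

namespace GrpT

theorem emb_eq {n : ℕ} (x : GrpT K n) :
    emb K n x = DKGrp.map K Fin.valEmbedding (GrpT.toDKGrp K n x) := rfl

theorem emb_left {n : ℕ} (x : GrpT K n) :
    (emb K n x).left = expGroup.map K (LieT.toDK K Fin.valEmbedding) x.left := by
  change expGroup.map K (DK.map K Fin.valEmbedding) (expGroup.map K (LieT.toDK K _) x.left) = _
  rw [expGroup.map_map]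
  congr 2
  refine LieT.hom_ext K fun i j _ => ?_
  rw [LieHom.comp_apply, LieT.toDK_t, LieT.toDK_t, DK.map_t]
  rfl

theorem emb_right {n : ℕ} (x : GrpT K n) :
    (emb K n x).right = Equiv.Perm.viaEmbeddingHom Fin.valEmbedding x.right := rfl

theorem left_eq {n : ℕ} (x : GrpT K n) :
    x.left = expGroup.map K (DK.toLieT K n) (emb K n x).left := by
  rw [emb_left, expGroup.map_map, DK.toLieT_comp, expGroup.map_id]; rfl

/-- Killing the t_ij with an index out of range is a retraction onto t_n, which recovers the Lie
part; the permutation is recovered from its extension by the identity. Equalities of morphisms may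
hence be tested in the stable group. -/
theorem emb_injective (n : ℕ) : Function.Injective (emb K n) := by
  intro x y h
  apply SemidirectProduct.ext
  · rw [left_eq, left_eq y, h]
  · apply Equiv.Perm.viaEmbeddingHom_injective Fin.valEmbedding
    rw [← emb_right, ← emb_right, h]

theorem emb_inl {n : ℕ} (x : expGroup K (LieT K n)) : emb K n (SemidirectProduct.inl x) =
    SemidirectProduct.inl (expGroup.map K (LieT.toDK K Fin.valEmbedding) x) := by
  apply SemidirectProduct.ext
  · rw [emb_left]; simp
  · rw [emb_right]; simp

theorem emb_inr {n : ℕ} (σ : Equiv.Perm (Fin n)) : emb K n (SemidirectProduct.inr σ) =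
    SemidirectProduct.inr (Equiv.Perm.viaEmbeddingHom Fin.valEmbedding σ) := by
  apply SemidirectProduct.ext
  · rw [emb_left]; simp
  · rw [emb_right]; simp

end GrpT

variable (K) in
/-- The shift of the indices by `p`. -/
noncomputable def DKGrp.shift (p : ℕ) : DKGrp K ℕ →* DKGrp K ℕ := DKGrp.map K (addLeftEmbedding p)

namespace DKGrp

theorem shift_map {α : Type} (p : ℕ) (e : α ↪ ℕ) (x : DKGrp K α) :
    shift K p (map K e x) = map K (e.trans (addLeftEmbedding p)) x := map_map ..

theorem shift_zero (x : DKGrp K ℕ) : shift K 0 x = x := by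
  have : (addLeftEmbedding 0 : ℕ ↪ ℕ) = Function.Embedding.refl ℕ := by ext; simp
  rw [shift, this, map_refl]

theorem shift_shift (p q : ℕ) (x : DKGrp K ℕ) : shift K p (shift K q x) = shift K (p + q) x := by
  rw [shift, shift, map_map]
  congr 2
  ext i
  simp [Nat.add_assoc]

theorem commute_emb_shift {n : ℕ} (x : GrpT K n) {p : ℕ} (h : n ≤ p) (y : DKGrp K ℕ) :
    Commute (GrpT.emb K n x) (shift K p y) :=
  commute_map_map (fun i j => by
    simp only [Fin.valEmbedding_apply, addLeftEmbedding_apply]; omega) _ _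

end DKGrp

theorem permJuxt_castAdd {n m : ℕ} (σ : Equiv.Perm (Fin n)) (τ : Equiv.Perm (Fin m)) (i : Fin n) :
    permJuxt σ τ (Fin.castAdd m i) = Fin.castAdd m (σ i) := by
  simp [permJuxt, Equiv.permCongr_apply]

theorem permJuxt_natAdd {n m : ℕ} (σ : Equiv.Perm (Fin n)) (τ : Equiv.Perm (Fin m)) (i : Fin m) :
    permJuxt σ τ (Fin.natAdd n i) = Fin.natAdd n (τ i) := by
  simp [permJuxt, Equiv.permCongr_apply]

/-- The stable form of the tensor product is an ordinary product, because the permutation of `x`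
does not twist an element supported on the indices from n on. -/
theorem GrpT.emb_juxt {n m : ℕ} (x : GrpT K n) (y : GrpT K m) :
    emb K (n + m) (juxt x y) = emb K n x * DKGrp.shift K n (emb K m y) := by
  apply SemidirectProduct.ext
  · have e1 : (LieT.toDK K Fin.valEmbedding).comp (LieT.map K (Fin.castAddEmb m)) =
        LieT.toDK K (n := n) Fin.valEmbedding :=
      LieT.hom_ext K fun i j h => by
        rw [LieHom.comp_apply, LieT.map_t K _ h, LieT.toDK_t, LieT.toDK_t]; rfl
    have e2 : (LieT.toDK K Fin.valEmbedding).comp (LieT.map K (Fin.natAddEmb n)) =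
        (DK.map K (addLeftEmbedding n)).comp (LieT.toDK K (n := m) Fin.valEmbedding) :=
      LieT.hom_ext K fun i j h => by
        rw [LieHom.comp_apply, LieT.map_t K _ h, LieT.toDK_t, LieHom.comp_apply, LieT.toDK_t,
          DK.map_t]; rfl
    -- The permutation of `x` moves only indices below n, so it fixes the shifted ones and acts
    -- trivially on the second factor.
    have e3 : (addLeftEmbedding n).trans
        (Equiv.Perm.viaEmbeddingHom Fin.valEmbedding x.right).toEmbedding =
          addLeftEmbedding n := by
      refine Function.Embedding.ext fun j =>
        Equiv.Perm.viaEmbedding_apply_of_notMem x.right Fin.valEmbedding _ ?_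
      rintro ⟨i, hi⟩
      have := i.2
      simp only [Fin.valEmbedding_apply, addLeftEmbedding_apply] at hi
      omega
    rw [emb_left, juxt, map_mul, expGroup.map_map, expGroup.map_map, e1, e2,
      SemidirectProduct.mul_left, emb_left, emb_right, actDK_apply]
    change _ = _ * expGroup.map K _ (expGroup.map K (DK.map K (addLeftEmbedding n))
      (emb K m y).left)
    rw [expGroup.map_map, DK.map_comp_map, e3, emb_left, expGroup.map_map]
  · rw [emb_right, juxt, SemidirectProduct.mul_right, emb_right]
    change _ = _ * Equiv.Perm.viaEmbeddingHom (addLeftEmbedding n) (emb K m y).right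
    rw [emb_right, DKGrp.viaEmbedding_viaEmbedding]
    refine Equiv.ext fun i => ?_
    simp only [Equiv.Perm.mul_apply, Equiv.Perm.viaEmbeddingHom_apply]
    have hx : ∀ i : ℕ, n ≤ i → x.right.viaEmbedding Fin.valEmbedding i = i := fun i hi => by
      refine Equiv.Perm.viaEmbedding_apply_of_notMem _ _ _ ?_
      rintro ⟨j, hj⟩
      have := j.2
      simp only [Fin.valEmbedding_apply] at hj
      omega
    have hy : ∀ i : ℕ, ¬(n ≤ i ∧ i < n + m) → y.right.viaEmbedding
        (Fin.valEmbedding.trans (addLeftEmbedding n)) i = i := fun i hi => by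
      refine Equiv.Perm.viaEmbedding_apply_of_notMem _ _ _ ?_
      rintro ⟨j, hj⟩
      have := j.2
      simp only [Function.Embedding.trans_apply, Fin.valEmbedding_apply,
        addLeftEmbedding_apply] at hj
      omega
    by_cases hi : i < n
    · rw [hy i (by omega), show i = Fin.valEmbedding (Fin.castAdd m ⟨i, hi⟩) from rfl,
        Equiv.Perm.viaEmbedding_apply]
      rw [show Fin.valEmbedding (Fin.castAdd m ⟨i, hi⟩) = Fin.valEmbedding (⟨i, hi⟩ : Fin n)
        from rfl, Equiv.Perm.viaEmbedding_apply, permJuxt_castAdd]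
      rfl
    · by_cases hi' : i < n + m
      · obtain ⟨k, rfl⟩ : ∃ k, i = n + k := ⟨i - n, by omega⟩
        have hk : k < m := by omega
        have e := Equiv.Perm.viaEmbedding_apply y.right
          (Fin.valEmbedding.trans (addLeftEmbedding n)) ⟨k, hk⟩
        simp only [Function.Embedding.trans_apply, Fin.valEmbedding_apply,
          addLeftEmbedding_apply] at e
        rw [e, hx _ (by omega)]
        refine (Equiv.Perm.viaEmbedding_apply _ Fin.valEmbedding
          (Fin.natAdd n (⟨k, hk⟩ : Fin m))).trans ?_
        rw [permJuxt_natAdd]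
        rfl
      · rw [hy i (by omega), hx i (by omega)]
        refine Equiv.Perm.viaEmbedding_apply_of_notMem _ _ _ ?_
        rintro ⟨j, hj⟩
        have := j.2
        simp only [Fin.valEmbedding_apply] at hj
        omega

end Stable

/-! ### Blocks which are intervals of ℕ, and block permutations. -/

section Blocks

variable (K : Type u) [CommRing K]

theorem DK.T_Ico_left {i j k : ℕ} (h : i ≤ j) (h' : j ≤ k) (J : Finset ℕ) :
    DK.T K (Finset.Ico i k) J = DK.T K (Finset.Ico i j) J + DK.T K (Finset.Ico j k) J := by
  rw [← Finset.Ico_union_Ico_eq_Ico h h', DK.T_union_left]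
  exact Finset.Ico_disjoint_Ico_consecutive i j k

theorem DK.T_Ico_right {i j k : ℕ} (h : i ≤ j) (h' : j ≤ k) (J : Finset ℕ) :
    DK.T K J (Finset.Ico i k) = DK.T K J (Finset.Ico i j) + DK.T K J (Finset.Ico j k) := by
  rw [DK.T_comm, DK.T_Ico_left K h h', DK.T_comm, DK.T_comm K J]

theorem Ico_disjoint_Ico {i j k l : ℕ} (h : j ≤ k) :
    Disjoint (Finset.Ico i j) (Finset.Ico k l) :=
  Finset.disjoint_left.2 fun x hx hx' => by
    rw [Finset.mem_Ico] at hx hx'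
    omega

/-- On the interval, `e` is the translation by i' - i; the additive form covers translations in both
directions without truncated subtraction. -/
theorem Ico_map_embedding {e : ℕ ↪ ℕ} {i j i' j' : ℕ} (h : ∀ x, i ≤ x → x < j → e x + i = x + i')
    (hj : j' + i = j + i') : (Finset.Ico i j).map e = Finset.Ico i' j' := by
  ext y
  simp only [Finset.mem_map, Finset.mem_Ico]
  constructor
  · rintro ⟨x, hx, rfl⟩
    have := h x hx.1 hx.2
    omega
  · intro hy
    refine ⟨y + i - i', by omega, ?_⟩
    have := h (y + i - i') (by omega) (by omega)
    omega

theorem DK.map_T_shift (p i j k l : ℕ) : DK.map K (addLeftEmbedding p)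
    (DK.T K (Finset.Ico i j) (Finset.Ico k l)) =
      DK.T K (Finset.Ico (p + i) (p + j)) (Finset.Ico (p + k) (p + l)) := by
  rw [DK.map_T, Finset.map_add_left_Ico, Finset.map_add_left_Ico]

theorem LieT.toDK_toLieT_T {n : ℕ} {I J : Finset ℕ} (hI : ∀ x ∈ I, x < n) (hJ : ∀ x ∈ J, x < n) :
    LieT.toDK K Fin.valEmbedding (DK.toLieT K n (DK.T K I J)) = DK.T K I J := by
  simp only [DK.T, map_sum]
  refine Finset.sum_congr rfl fun i hi => Finset.sum_congr rfl fun j hj => ?_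
  rw [DK.toLieT_t, LieT.natT_of_lt K (hI i hi) (hJ j hj), LieT.toDK_t]
  rfl

end Blocks

/-- The permutation of `ℕ` which exchanges the first `n` integers with the following `m` ones. -/
noncomputable def natBlockPerm (n m : ℕ) : Equiv.Perm ℕ :=
  Equiv.Perm.viaEmbeddingHom Fin.valEmbedding (blockPerm n m)

theorem viaEmbedding_val {n : ℕ} (σ : Equiv.Perm (Fin n)) (x : ℕ) :
    Equiv.Perm.viaEmbeddingHom Fin.valEmbedding σ x = if h : x < n then (σ ⟨x, h⟩ : ℕ) else x := by
  rw [Equiv.Perm.viaEmbeddingHom_apply]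
  split_ifs with h
  · exact Equiv.Perm.viaEmbedding_apply σ Fin.valEmbedding ⟨x, h⟩
  · refine Equiv.Perm.viaEmbedding_apply_of_notMem _ _ _ ?_
    rintro ⟨j, rfl⟩
    exact h j.2

theorem viaEmbedding_addLeft (p : ℕ) (σ : Equiv.Perm ℕ) (x : ℕ) :
    Equiv.Perm.viaEmbeddingHom (addLeftEmbedding p) σ x = if p ≤ x then p + σ (x - p) else x := by
  rw [Equiv.Perm.viaEmbeddingHom_apply]
  split_ifs with h
  · obtain ⟨k, rfl⟩ := Nat.exists_eq_add_of_le h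
    rw [Nat.add_sub_cancel_left]
    exact Equiv.Perm.viaEmbedding_apply σ (addLeftEmbedding p) k
  · refine Equiv.Perm.viaEmbedding_apply_of_notMem _ _ _ ?_
    rintro ⟨j, rfl⟩
    simp at h

theorem natBlockPerm_apply (n m x : ℕ) : natBlockPerm n m x =
    if x < n then m + x else if x < n + m then x - n else x := by
  rw [natBlockPerm, viaEmbedding_val]
  by_cases h : x < n + m
  · rw [dif_pos h, ← Braid.perm_cross, Braid.cross, map_crossWord]
    simp only [Braid.perm_σ]
    rw [cross_transp_val le_rfl]
  · rw [dif_neg h, if_neg (by omega), if_neg h]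

/-! ### Stable associativity constraints and braidings, and their axioms. -/

section StableElements

variable {K : Type u} [CommRing K] [Algebra ℚ K]

open SemidirectProduct

theorem GrpT.exists_emb_add {n : ℕ} (x : GrpT K n) (m : ℕ) :
    emb K n x ∈ (emb K (n + m)).range :=
  ⟨juxt x 1, by rw [emb_juxt, map_one, map_one, mul_one]⟩

theorem GrpT.range_mono {n m : ℕ} (h : n ≤ m) : (emb K n).range ≤ (emb K m).range := by
  rintro _ ⟨x, rfl⟩
  obtain ⟨k, rfl⟩ := Nat.exists_eq_add_of_le h
  exact exists_emb_add x k

theorem GrpT.shift_mem {n m : ℕ} {x : DKGrp K ℕ} (hx : x ∈ (emb K m).range) :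
    DKGrp.shift K n x ∈ (emb K (n + m)).range := by
  obtain ⟨x, rfl⟩ := hx
  exact ⟨juxt 1 x, by rw [emb_juxt, map_one, one_mul]⟩

theorem GrpT.inl_subst_mem {n : ℕ} {I J M N : Finset ℕ} (hI : ∀ x ∈ I, x < n) (hJ : ∀ x ∈ J, x < n)
    (hM : ∀ x ∈ M, x < n) (hN : ∀ x ∈ N, x < n) (Φ : expGroup K (LieF2 K)) :
    (inl (subst Φ (DK.T K I J) (DK.T K M N)) : DKGrp K ℕ) ∈ (emb K n).range :=
  ⟨inl (subst Φ (DK.toLieT K n (DK.T K I J)) (DK.toLieT K n (DK.T K M N))), by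
    rw [emb_inl, map_subst, LieT.toDK_toLieT_T K hI hJ, LieT.toDK_toLieT_T K hM hN]⟩

theorem GrpT.inl_expHalf_mem {n : ℕ} {I J : Finset ℕ} (hI : ∀ x ∈ I, x < n) (hJ : ∀ x ∈ J, x < n)
    (μ : K) : (inl (expHalf μ (DK.T K I J)) : DKGrp K ℕ) ∈ (emb K n).range :=
  ⟨inl (expHalf μ (DK.toLieT K n (DK.T K I J))), by
    rw [emb_inl, map_expHalf, LieT.toDK_toLieT_T K hI hJ]⟩

theorem DKGrp.inr_mul_subst (σ : Equiv.Perm ℕ) (Φ : expGroup K (LieF2 K)) (I J M N : Finset ℕ) :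
    (inl (subst Φ (DK.T K (I.map σ.toEmbedding) (J.map σ.toEmbedding))
      (DK.T K (M.map σ.toEmbedding) (N.map σ.toEmbedding))) : DKGrp K ℕ) * inr σ =
      inr σ * inl (subst Φ (DK.T K I J) (DK.T K M N)) := by
  rw [inr_mul_inl, map_subst, DK.map_T, DK.map_T]

theorem DKGrp.inr_mul_expHalf (σ : Equiv.Perm ℕ) (μ : K) (I J : Finset ℕ) :
    (inl (expHalf μ (DK.T K (I.map σ.toEmbedding) (J.map σ.toEmbedding))) : DKGrp K ℕ) * inr σ =
      inr σ * inl (expHalf μ (DK.T K I J)) := by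
  rw [inr_mul_inl, map_expHalf, DK.map_T]

theorem DKGrp.separates_Ico {n p i j : ℕ} (h : p + n ≤ i ∨ j ≤ p ∨ (i ≤ p ∧ p + n ≤ j)) :
    DK.Separates (Set.range ((Fin.valEmbedding : Fin n ↪ ℕ).trans (addLeftEmbedding p)))
      (Finset.Ico i j) := by
  by_cases h' : i ≤ p ∧ p + n ≤ j
  · left
    rintro _ ⟨x, rfl⟩
    have := x.2
    simp only [Function.Embedding.trans_apply, Fin.valEmbedding_apply, addLeftEmbedding_apply,
      Finset.mem_Ico]
    omega
  · right
    rintro _ ⟨x, rfl⟩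
    have := x.2
    simp only [Function.Embedding.trans_apply, Fin.valEmbedding_apply, addLeftEmbedding_apply,
      Finset.mem_Ico]
    omega

namespace Associator

variable (a : Associator K)

/-- The associativity constraint for the blocks `[i, j)`, `[j, k)` and `[k, l)`. -/
noncomputable def assoc (i j k l : ℕ) : DKGrp K ℕ :=
  inl (subst a.Φ (DK.T K (Finset.Ico i j) (Finset.Ico j k))
    (DK.T K (Finset.Ico j k) (Finset.Ico k l)))

theorem assoc_left (i k l : ℕ) : a.assoc i i k l = 1 := by
  simp [assoc, subst_zero_left]

theorem assoc_mid (i j l : ℕ) : a.assoc i j j l = 1 := by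
  simp [assoc, subst_zero_left]

theorem assoc_right (i j k : ℕ) : a.assoc i j k k = 1 := by
  simp [assoc, subst_zero_right]

theorem assoc_pentagon {i j k l m : ℕ} (hij : i ≤ j) (hjk : j ≤ k) (hkl : k ≤ l) (hlm : l ≤ m) :
    a.assoc i j k m * a.assoc i k l m = a.assoc j k l m * a.assoc i j l m * a.assoc i j k l := by
  simp only [assoc, ← map_mul]
  congr 1
  rw [DK.T_Ico_right K hkl hlm (Finset.Ico j k), DK.T_Ico_left K hij hjk (Finset.Ico k l),
    DK.T_Ico_right K hjk hkl (Finset.Ico i j), DK.T_Ico_left K hjk hkl (Finset.Ico l m)]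
  exact a.pentagon_T (Ico_disjoint_Ico le_rfl) (Ico_disjoint_Ico hjk)
    (Ico_disjoint_Ico (hjk.trans hkl)) (Ico_disjoint_Ico le_rfl) (Ico_disjoint_Ico hkl)
    (Ico_disjoint_Ico le_rfl)

theorem shift_assoc (p i j k l : ℕ) :
    DKGrp.shift K p (a.assoc i j k l) = a.assoc (p + i) (p + j) (p + k) (p + l) := by
  rw [assoc, DKGrp.shift, DKGrp.map_inl, map_subst, DK.map_T_shift, DK.map_T_shift, assoc]

theorem assoc_mem {i j k l n : ℕ} (hj : j ≤ n) (hk : k ≤ n) (hl : l ≤ n) :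
    a.assoc i j k l ∈ (GrpT.emb K n).range := by
  apply GrpT.inl_subst_mem <;> intro x hx <;> rw [Finset.mem_Ico] at hx <;> omega

/-- The shifted element is supported on [p, p + n), and the disjunction lists the positions of this
interval which cut no block: before the blocks, after them, or inside one of the three. This is the
naturality of the associativity constraint. -/
theorem commute_assoc {n p i j k l : ℕ} (h : p + n ≤ i ∨ l ≤ p ∨ (i ≤ p ∧ p + n ≤ j) ∨
    (j ≤ p ∧ p + n ≤ k) ∨ (k ≤ p ∧ p + n ≤ l)) (hij : i ≤ j) (hjk : j ≤ k) (hkl : k ≤ l)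
    {x : DKGrp K ℕ} (hx : x ∈ (GrpT.emb K n).range) :
    Commute (DKGrp.shift K p x) (a.assoc i j k l) := by
  obtain ⟨x, rfl⟩ := hx
  rw [GrpT.emb_eq, DKGrp.shift_map]
  refine DKGrp.commute_map_subst (Ico_disjoint_Ico le_rfl) (Ico_disjoint_Ico le_rfl) ?_ ?_ ?_ ?_ _ _
  all_goals
    apply DKGrp.separates_Ico
    omega

/-- The braiding of blocks of `n` and `m` indices. -/
noncomputable def braid (n m : ℕ) : DKGrp K ℕ :=
  inr (natBlockPerm n m) *
    inl (expHalf a.μ (DK.T K (Finset.Ico 0 n) (Finset.Ico n (n + m))))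

theorem braid_mem (n m : ℕ) : a.braid n m ∈ (GrpT.emb K (n + m)).range := by
  refine mul_mem ⟨inr (blockPerm n m), GrpT.emb_inr _⟩ (GrpT.inl_expHalf_mem ?_ ?_ _) <;>
    intro x hx <;> rw [Finset.mem_Ico] at hx <;> omega

theorem braid_zero_right (n : ℕ) : a.braid n 0 = 1 := by
  have : natBlockPerm n 0 = 1 := by
    ext x
    rw [natBlockPerm_apply]
    split_ifs <;> simp; omega
  rw [braid, this]
  simp [expHalf_zero]

theorem braid_zero_left (n : ℕ) : a.braid 0 n = 1 := by
  have : natBlockPerm 0 n = 1 := by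
    ext x
    rw [natBlockPerm_apply]
    split_ifs <;> simp; omega
  rw [braid, this]
  simp [expHalf_zero]

/-- Naturality of the braiding in its first argument: `x` acts inside the first block and so
commutes with the exponential, and the block permutation then translates its support by m. -/
theorem braid_emb {n m : ℕ} {x : DKGrp K ℕ} (hx : x ∈ (GrpT.emb K n).range) :
    a.braid n m * x = DKGrp.shift K m x * a.braid n m := by
  obtain ⟨x, rfl⟩ := hx
  have c : Commute (DKGrp.shift K 0 (GrpT.emb K n x))
      (inl (expHalf a.μ (DK.T K (Finset.Ico 0 n) (Finset.Ico n (n + m))))) := by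
    rw [GrpT.emb_eq, DKGrp.shift_map]
    refine DKGrp.commute_map_expHalf (Ico_disjoint_Ico le_rfl) ?_ ?_ _ _
    all_goals
      apply DKGrp.separates_Ico
      omega
  rw [DKGrp.shift_zero] at c
  rw [braid, mul_assoc, ← c.eq, ← mul_assoc, ← mul_assoc, GrpT.emb_eq, DKGrp.inr_mul_map,
    DKGrp.shift_map]
  congr 4
  ext i
  change natBlockPerm n m i = m + i
  rw [natBlockPerm_apply, if_pos i.2]

theorem braid_shift {n m : ℕ} {x : DKGrp K ℕ} (hx : x ∈ (GrpT.emb K m).range) :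
    a.braid n m * DKGrp.shift K n x = x * a.braid n m := by
  obtain ⟨x, rfl⟩ := hx
  have c : Commute (DKGrp.shift K n (GrpT.emb K m x))
      (inl (expHalf a.μ (DK.T K (Finset.Ico 0 n) (Finset.Ico n (n + m))))) := by
    rw [GrpT.emb_eq, DKGrp.shift_map]
    refine DKGrp.commute_map_expHalf (Ico_disjoint_Ico le_rfl) ?_ ?_ _ _
    all_goals
      apply DKGrp.separates_Ico
      omega
  rw [braid, mul_assoc, ← c.eq, ← mul_assoc, ← mul_assoc, GrpT.emb_eq, DKGrp.shift_map,
    DKGrp.inr_mul_map]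
  congr 4
  ext i
  change natBlockPerm n m (n + i) = i
  have := i.2
  rw [natBlockPerm_apply, if_neg (by omega), if_pos (by omega), Nat.add_sub_cancel_left]

theorem shift_braid (p n m : ℕ) : DKGrp.shift K p (a.braid n m) =
    inr (Equiv.Perm.viaEmbeddingHom (addLeftEmbedding p) (natBlockPerm n m)) *
      inl (expHalf a.μ (DK.T K (Finset.Ico p (p + n)) (Finset.Ico (p + n) (p + n + m)))) := by
  rw [braid, DKGrp.shift, map_mul, DKGrp.map_inl, DKGrp.map_inr, map_expHalf, DK.map_T_shift,
    add_zero, ← add_assoc]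

/-- This hexagon axiom moves a block of n strands across m + p strands in two steps. Once all the
permutations are collected on the left they agree, and the remaining identity between Lie parts is
`hexagon_T_right`. -/
theorem hexagon_right (n m p : ℕ) :
    a.assoc 0 m (m + p) (m + p + n) * a.braid n (m + p) * a.assoc 0 n (n + m) (n + m + p) =
      DKGrp.shift K m (a.braid n p) * a.assoc 0 m (m + n) (m + n + p) * a.braid n m := by
  have h := a.hexagon_T_right (Ico_disjoint_Ico (i := 0) (j := n) (k := n) (l := n + m) le_rfl)
    (Ico_disjoint_Ico (k := n + m) (l := n + m + p) (by omega)) (Ico_disjoint_Ico le_rfl)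
  have hσ : Equiv.Perm.viaEmbeddingHom (addLeftEmbedding m) (natBlockPerm n p) * natBlockPerm n m =
      natBlockPerm n (m + p) := by
    ext x
    rw [Equiv.Perm.mul_apply, viaEmbedding_addLeft, natBlockPerm_apply, natBlockPerm_apply,
      natBlockPerm_apply]
    split_ifs <;> omega
  -- The images of the three blocks under the total permutation, and then under the first crossing
  -- alone. They give the arguments of the associators and of the exponential after permutations
  -- have been moved to the left.
  have hX : (Finset.Ico 0 n).map (natBlockPerm n (m + p)).toEmbedding =
      Finset.Ico (m + p) (m + p + n) := Ico_map_embedding (fun x _ h2 => by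
        rw [Equiv.coe_toEmbedding, natBlockPerm_apply, if_pos h2]; omega) (by omega)
  have hY : (Finset.Ico n (n + m)).map (natBlockPerm n (m + p)).toEmbedding =
      Finset.Ico 0 m := Ico_map_embedding (fun x h1 h2 => by
        rw [Equiv.coe_toEmbedding, natBlockPerm_apply, if_neg (by omega), if_pos (by omega)]
        omega) (by omega)
  have hZ : (Finset.Ico (n + m) (n + m + p)).map (natBlockPerm n (m + p)).toEmbedding =
      Finset.Ico m (m + p) := Ico_map_embedding (fun x h1 h2 => by
        rw [Equiv.coe_toEmbedding, natBlockPerm_apply, if_neg (by omega), if_pos (by omega)]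
        omega) (by omega)
  have hX' : (Finset.Ico 0 n).map (natBlockPerm n m).toEmbedding =
      Finset.Ico m (m + n) := Ico_map_embedding (fun x _ h2 => by
        rw [Equiv.coe_toEmbedding, natBlockPerm_apply, if_pos h2]; omega) (by omega)
  have hY' : (Finset.Ico n (n + m)).map (natBlockPerm n m).toEmbedding =
      Finset.Ico 0 m := Ico_map_embedding (fun x h1 h2 => by
        rw [Equiv.coe_toEmbedding, natBlockPerm_apply, if_neg (by omega), if_pos (by omega)]
        omega) (by omega)
  have hZ' : (Finset.Ico (n + m) (n + m + p)).map (natBlockPerm n m).toEmbedding =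
      Finset.Ico (m + n) (m + n + p) := Ico_map_embedding (fun x h1 h2 => by
        rw [Equiv.coe_toEmbedding, natBlockPerm_apply, if_neg (by omega), if_neg (by omega)]
        omega) (by omega)
  have e1 := DKGrp.inr_mul_subst (natBlockPerm n (m + p)) a.Φ (Finset.Ico n (n + m))
    (Finset.Ico (n + m) (n + m + p)) (Finset.Ico (n + m) (n + m + p)) (Finset.Ico 0 n)
  have e2 := DKGrp.inr_mul_subst (natBlockPerm n m) a.Φ (Finset.Ico n (n + m))
    (Finset.Ico 0 n) (Finset.Ico 0 n) (Finset.Ico (n + m) (n + m + p))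
  have e3 := DKGrp.inr_mul_expHalf (natBlockPerm n m) a.μ (Finset.Ico 0 n)
    (Finset.Ico (n + m) (n + m + p))
  rw [hX, hY, hZ] at e1
  rw [hX', hY', hZ'] at e2
  rw [hX', hZ'] at e3
  rw [shift_braid, assoc, assoc, assoc, braid, braid]
  simp only [← mul_assoc]
  rw [e1, mul_assoc _ (inl _) (inr _), e2, ← mul_assoc, mul_assoc _ (inl _) (inr _), e3,
    ← mul_assoc, ← map_mul inr, hσ]
  simp only [mul_assoc, ← map_mul inl]
  congr 2
  rw [← mul_assoc, ← mul_assoc, DK.T_comm K (Finset.Ico 0 n) (Finset.Ico (n + m) (n + m + p)),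
    DK.T_comm K (Finset.Ico 0 n) (Finset.Ico n (n + m)), ← h, ← add_assoc,
    DK.T_Ico_right K (Nat.le_add_right n m) (Nat.le_add_right (n + m) p)]

/-- The other hexagon axiom, by the same method from `hexagon_T_left`. It is solved for the braiding
of the n + m strands, the form needed to add strands one at a time in `crossWord_gen`. -/
theorem hexagon_left (n m p : ℕ) :
    a.braid (n + m) p = a.assoc 0 p (p + n) (p + n + m) * a.braid n p *
      (a.assoc 0 n (n + p) (n + p + m))⁻¹ * DKGrp.shift K n (a.braid m p) *
        a.assoc 0 n (n + m) (n + m + p) := by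
  have h := a.hexagon_T_left (Ico_disjoint_Ico (i := 0) (j := n) (k := n) (l := n + m) le_rfl)
    (Ico_disjoint_Ico (k := n + m) (l := n + m + p) (by omega)) (Ico_disjoint_Ico le_rfl)
  set σ := Equiv.Perm.viaEmbeddingHom (addLeftEmbedding n) (natBlockPerm m p) with hdef
  have hσ : natBlockPerm n p * σ = natBlockPerm (n + m) p := by
    ext x
    rw [Equiv.Perm.mul_apply, hdef, viaEmbedding_addLeft, natBlockPerm_apply, natBlockPerm_apply,
      natBlockPerm_apply]
    split_ifs <;> omega
  have hX : (Finset.Ico 0 n).map (natBlockPerm (n + m) p).toEmbedding =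
      Finset.Ico p (p + n) := Ico_map_embedding (fun x _ h2 => by
        rw [Equiv.coe_toEmbedding, natBlockPerm_apply, if_pos (by omega)]; omega) (by omega)
  have hY : (Finset.Ico n (n + m)).map (natBlockPerm (n + m) p).toEmbedding =
      Finset.Ico (p + n) (p + n + m) := Ico_map_embedding (fun x h1 h2 => by
        rw [Equiv.coe_toEmbedding, natBlockPerm_apply, if_pos (by omega)]
        omega) (by omega)
  have hZ : (Finset.Ico (n + m) (n + m + p)).map (natBlockPerm (n + m) p).toEmbedding =
      Finset.Ico 0 p := Ico_map_embedding (fun x h1 h2 => by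
        rw [Equiv.coe_toEmbedding, natBlockPerm_apply, if_neg (by omega), if_pos (by omega)]
        omega) (by omega)
  have hX' : (Finset.Ico 0 n).map σ.toEmbedding =
      Finset.Ico 0 n := Ico_map_embedding (fun x _ h2 => by
        rw [Equiv.coe_toEmbedding, hdef, viaEmbedding_addLeft, if_neg (by omega)]) (by omega)
  have hY' : (Finset.Ico n (n + m)).map σ.toEmbedding =
      Finset.Ico (n + p) (n + p + m) := Ico_map_embedding (fun x h1 h2 => by
        rw [Equiv.coe_toEmbedding, hdef, viaEmbedding_addLeft, if_pos (by omega),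
          natBlockPerm_apply, if_pos (by omega)]
        omega) (by omega)
  have hZ' : (Finset.Ico (n + m) (n + m + p)).map σ.toEmbedding =
      Finset.Ico n (n + p) := Ico_map_embedding (fun x h1 h2 => by
        rw [Equiv.coe_toEmbedding, hdef, viaEmbedding_addLeft, if_pos (by omega),
          natBlockPerm_apply, if_neg (by omega), if_pos (by omega)]
        omega) (by omega)
  have e1 := DKGrp.inr_mul_subst (natBlockPerm (n + m) p) a.Φ (Finset.Ico (n + m) (n + m + p))
    (Finset.Ico 0 n) (Finset.Ico 0 n) (Finset.Ico n (n + m))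
  have e2 := DKGrp.inr_mul_subst σ a.Φ (Finset.Ico 0 n) (Finset.Ico (n + m) (n + m + p))
    (Finset.Ico (n + m) (n + m + p)) (Finset.Ico n (n + m))
  have e3 := DKGrp.inr_mul_expHalf σ a.μ (Finset.Ico 0 n) (Finset.Ico (n + m) (n + m + p))
  rw [hX, hY, hZ] at e1
  rw [hX', hY', hZ'] at e2
  rw [hX', hZ'] at e3
  have e2' : (a.assoc 0 n (n + p) (n + p + m))⁻¹ * inr σ = inr σ * inl (subst a.Φ
      (DK.T K (Finset.Ico 0 n) (Finset.Ico (n + m) (n + m + p)))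
      (DK.T K (Finset.Ico (n + m) (n + m + p)) (Finset.Ico n (n + m))))⁻¹ := by
    rw [inv_mul_eq_iff_eq_mul, ← mul_assoc, assoc, e2, mul_assoc, ← map_mul, mul_inv_cancel,
      map_one, mul_one]
  have e1' : a.assoc 0 p (p + n) (p + n + m) * inr (natBlockPerm n p) * inr σ =
      inr (natBlockPerm (n + m) p) * inl (subst a.Φ
        (DK.T K (Finset.Ico (n + m) (n + m + p)) (Finset.Ico 0 n))
        (DK.T K (Finset.Ico 0 n) (Finset.Ico n (n + m)))) := by
    rw [mul_assoc, ← map_mul, hσ, assoc, e1]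
  rw [shift_braid, ← hdef, braid, braid]
  simp only [← mul_assoc]
  rw [mul_assoc _ (a.assoc 0 n (n + p) (n + p + m))⁻¹ (inr σ), e2', ← mul_assoc,
    mul_assoc _ (inl _) (inr σ), e3, ← mul_assoc, e1', assoc]
  simp only [mul_assoc, ← map_mul inl]
  congr 2
  rw [DK.T_Ico_left K (Nat.zero_le n) (Nat.le_add_right n m), h,
    DK.T_comm K (Finset.Ico 0 n) (Finset.Ico (n + m) (n + m + p)),
    DK.T_comm K (Finset.Ico n (n + m)) (Finset.Ico (n + m) (n + m + p)),
    a.subst_swap (DK.T K (Finset.Ico 0 n) (Finset.Ico (n + m) (n + m + p)))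
      (DK.T K (Finset.Ico n (n + m)) (Finset.Ico (n + m) (n + m + p)))]
  simp only [mul_assoc]

end Associator

end StableElements

/-! ### The braid group acting on left-bracketed words. -/

section StableRepresentation

variable {K : Type u} [CommRing K] [Algebra ℚ K] (a : Associator K)

namespace Associator

/-- The canonical element relating the left-bracketed word of length `n + m` to the tensor product
of the left-bracketed words of lengths `n` and `m`. -/
noncomputable def comb (n : ℕ) : ℕ → DKGrp K ℕ
  | 0 => 1
  | m + 1 => a.assoc 0 n (n + m) (n + m + 1) * comb n m

theorem comb_succ (n m : ℕ) :
    a.comb n (m + 1) = a.assoc 0 n (n + m) (n + m + 1) * a.comb n m := rfl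

theorem comb_zero (n : ℕ) : a.comb n 0 = 1 := rfl

theorem comb_one (n : ℕ) : a.comb n 1 = 1 := by
  rw [comb_succ, comb_zero, add_zero, assoc_mid, one_mul]

theorem zero_comb (m : ℕ) : a.comb 0 m = 1 := by
  induction m with
  | zero => rfl
  | succ m ih => rw [comb_succ, ih, assoc_left, one_mul]

theorem comb_mem (n m : ℕ) : a.comb n m ∈ (GrpT.emb K (n + m)).range := by
  induction m with
  | zero => exact one_mem _
  | succ m ih =>
    exact mul_mem (a.assoc_mem (by omega) (by omega) (by omega)) (GrpT.range_mono (by omega) ih)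

theorem commute_assoc_zero {n i j k l : ℕ} (h : n ≤ i ∨ n ≤ j) (hij : i ≤ j)
    (hjk : j ≤ k) (hkl : k ≤ l) (hi : n ≤ i ∨ i = 0) {x : DKGrp K ℕ}
    (hx : x ∈ (GrpT.emb K n).range) : Commute x (a.assoc i j k l) := by
  have := a.commute_assoc (n := n) (p := 0) (by omega) hij hjk hkl hx
  rwa [DKGrp.shift_zero] at this

/-- Every associator in `comb n m` has [0, n) as its first block, inside which `x` acts. -/
theorem comb_comm {n m : ℕ} {x : DKGrp K ℕ} (hx : x ∈ (GrpT.emb K n).range) :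
    Commute x (a.comb n m) := by
  induction m with
  | zero => exact Commute.one_right _
  | succ m ih =>
    exact (a.commute_assoc_zero (by omega) (by omega) (by omega) (by omega) (by omega) hx).mul_right
      ih

/-- Mac Lane coherence for three left-bracketed words: both sides go from the left-bracketed word of
length n + m + p to W_n (W_m W_p). Adding one strand to the last word uses the pentagon whose fourth
block is this strand, and naturality to bring its associators together. -/
theorem comb_assoc (n m p : ℕ) :
    a.assoc 0 n (n + m) (n + m + p) * a.comb n m * a.comb (n + m) p =
      DKGrp.shift K n (a.comb m p) * a.comb n (m + p) := by
  induction p with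
  | zero => rw [add_zero, assoc_right, comb_zero, comb_zero, map_one, add_zero, one_mul, mul_one]
  | succ p ih =>
    have c1 := a.commute_assoc_zero (i := 0) (j := n + m) (k := n + m + p) (l := n + m + p + 1)
      (by omega) (by omega) (by omega) (by omega) (by omega) (a.comb_mem n m)
    have c2 := a.commute_assoc (p := n) (n := m + p) (i := 0) (j := n) (k := n + m + p)
      (l := n + m + p + 1) (by omega) (by omega) (by omega) (by omega) (a.comb_mem m p)
    have hp := a.assoc_pentagon (i := 0) (j := n) (k := n + m) (l := n + m + p)
      (m := n + m + p + 1) (by omega) (by omega) (by omega) (by omega)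
    have e : a.comb n (m + (p + 1)) =
        a.assoc 0 n (n + m + p) (n + m + p + 1) * a.comb n (m + p) := by
      rw [← add_assoc, comb_succ, add_assoc n m p]
    rw [comb_succ a (n + m) p, comb_succ a m p, map_mul, shift_assoc, e, ← add_assoc n m p,
      ← add_assoc n (m + p) 1, ← add_assoc n m p, ← add_assoc (n + m) p 1, add_zero]
    calc _ = a.assoc 0 n (n + m) (n + m + p + 1) * (a.comb n m *
          a.assoc 0 (n + m) (n + m + p) (n + m + p + 1)) * a.comb (n + m) p := by
            simp only [mul_assoc]
      _ = (a.assoc 0 n (n + m) (n + m + p + 1) * a.assoc 0 (n + m) (n + m + p) (n + m + p + 1)) *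
          (a.comb n m * a.comb (n + m) p) := by
            rw [c1.eq]; simp only [mul_assoc]
      _ = a.assoc n (n + m) (n + m + p) (n + m + p + 1) *
          a.assoc 0 n (n + m + p) (n + m + p + 1) *
            (a.assoc 0 n (n + m) (n + m + p) * a.comb n m * a.comb (n + m) p) := by
            rw [hp]; simp only [mul_assoc]
      _ = _ := by
            rw [ih, mul_assoc, ← mul_assoc (a.assoc 0 n (n + m + p) (n + m + p + 1)), ← c2.eq]
            simp only [mul_assoc]

/-- The image of the `i`-th Artin generator, acting on the left-bracketed word. -/
noncomputable def gen (i : ℕ) : DKGrp K ℕ :=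
  (a.assoc 0 i (i + 1) (i + 2))⁻¹ * DKGrp.shift K i (a.braid 1 1) * a.assoc 0 i (i + 1) (i + 2)

theorem gen_mem (i : ℕ) : a.gen i ∈ (GrpT.emb K (i + 2)).range := by
  have h := a.assoc_mem (i := 0) (j := i) (k := i + 1) (l := i + 2) (n := i + 2) (by omega)
    (by omega) le_rfl
  exact mul_mem (mul_mem (inv_mem h) (GrpT.shift_mem (a.braid_mem 1 1))) h

theorem emb_comm_gen {n i : ℕ} (h : n ≤ i) {x : DKGrp K ℕ} (hx : x ∈ (GrpT.emb K n).range) :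
    Commute x (a.gen i) := by
  have h1 := a.commute_assoc_zero (i := 0) (j := i) (k := i + 1) (l := i + 2) (Or.inr h)
    (by omega) (by omega) (by omega) (by omega) hx
  obtain ⟨x, rfl⟩ := hx
  exact (h1.inv_right.mul_right (DKGrp.commute_emb_shift _ h _)).mul_right h1

/-- Regrouping W_{n+m} as W_n W_m turns the crossing at n + i into the crossing at i in the second
factor. For m = i + 2 this is the pentagon for the blocks n, i, 1, 1; each further strand adds an
associator whose middle block contains the support of the crossing. -/
theorem comb_gen {n m i : ℕ} (h : i + 2 ≤ m) :
    a.comb n m * a.gen (n + i) = DKGrp.shift K n (a.gen i) * a.comb n m := by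
  induction m, h using Nat.le_induction with
  | base =>
    have hp := a.assoc_pentagon (i := 0) (j := n) (k := n + i) (l := n + i + 1)
      (m := n + i + 2) (by omega) (by omega) (by omega) (by omega)
    have c1 := a.emb_comm_gen le_rfl (a.comb_mem n i)
    have c2 := a.commute_assoc (p := n + i) (n := 2) (i := 0) (j := n) (k := n + i)
      (l := n + i + 2) (by omega) (by omega) (by omega) (by omega) (a.braid_mem 1 1)
    have e1 : a.comb n (i + 2) = a.assoc 0 n (n + i + 1) (n + i + 2) *
        (a.assoc 0 n (n + i) (n + i + 1) * a.comb n i) := rfl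
    have e2 : DKGrp.shift K n (a.gen i) = (a.assoc n (n + i) (n + i + 1) (n + i + 2))⁻¹ *
        DKGrp.shift K (n + i) (a.braid 1 1) * a.assoc n (n + i) (n + i + 1) (n + i + 2) := by
      rw [gen, map_mul, map_mul, map_inv, shift_assoc, DKGrp.shift_shift]; rfl
    rw [e1, e2]
    calc _ = (a.assoc 0 n (n + i + 1) (n + i + 2) * a.assoc 0 n (n + i) (n + i + 1)) *
          (a.gen (n + i) * a.comb n i) := by rw [← c1.eq]; simp only [mul_assoc]
      _ = (a.assoc n (n + i) (n + i + 1) (n + i + 2))⁻¹ *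
          (a.assoc 0 n (n + i) (n + i + 2) * a.assoc 0 (n + i) (n + i + 1) (n + i + 2)) *
          (a.gen (n + i) * a.comb n i) := by
            rw [hp]; simp only [mul_assoc, inv_mul_cancel_left]
      _ = (a.assoc n (n + i) (n + i + 1) (n + i + 2))⁻¹ *
          (a.assoc 0 n (n + i) (n + i + 2) * DKGrp.shift K (n + i) (a.braid 1 1)) *
            (a.assoc 0 (n + i) (n + i + 1) (n + i + 2) * a.comb n i) := by
            rw [gen]; simp only [mul_assoc, mul_inv_cancel_left]
      _ = (a.assoc n (n + i) (n + i + 1) (n + i + 2))⁻¹ * DKGrp.shift K (n + i) (a.braid 1 1) *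
          ((a.assoc 0 n (n + i) (n + i + 2) * a.assoc 0 (n + i) (n + i + 1) (n + i + 2)) *
            a.comb n i) := by
            rw [← c2.eq]; simp only [mul_assoc]
      _ = _ := by rw [hp]; simp only [mul_assoc]
  | succ m h ih =>
    have c := a.commute_assoc (p := n) (n := i + 2) (i := 0) (j := n) (k := n + m)
      (l := n + m + 1) (by omega) (by omega) (by omega) (by omega) (a.gen_mem i)
    rw [comb_succ, mul_assoc, ih, ← mul_assoc, ← c.eq, mul_assoc]

theorem gen_zero : a.gen 0 = a.braid 1 1 := by
  rw [gen, assoc_left, inv_one, one_mul, mul_one, DKGrp.shift_zero]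

/-- For i = 0 the braid relation is the Yang–Baxter equation, obtained from a hexagon and the
naturality of the braiding; conjugation by `comb i 3` transports it to any i. Distant generators
commute because `gen i` is supported on the first i + 2 indices. -/
theorem gen_artinRels (N : ℕ) : ArtinRels a.gen N where
  braid i _ := by
    have h := a.hexagon_right 1 1 1
    have e := a.braid_shift (n := 1) (m := 2) (a.braid_mem 1 1)
    set A := a.assoc 0 1 2 3
    -- The hexagon writes the braiding of one strand with two as two elementary crossings.
    -- Naturality, in `e`, lets the crossing of those two strands pass through it.
    have h' : a.braid 1 2 * A = a.gen 1 * a.gen 0 := by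
      rw [gen_zero, gen]
      change A * a.braid 1 2 * A = _ * A * _ at h
      rw [mul_assoc, mul_assoc, eq_inv_mul_iff_mul_eq, ← mul_assoc, ← mul_assoc, h]
    have h0 : a.gen 0 * a.gen 1 * a.gen 0 = a.gen 1 * a.gen 0 * a.gen 1 := by
      rw [mul_assoc, ← h', gen_zero, ← mul_assoc, ← e]
      have hg : a.gen 1 = A⁻¹ * DKGrp.shift K 1 (a.braid 1 1) * A := rfl
      rw [hg]
      simp only [mul_assoc, mul_inv_cancel_left]
    have e0 := a.comb_gen (n := i) (m := 3) (i := 0) (by omega)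
    have e1 := a.comb_gen (n := i) (m := 3) (i := 1) (by omega)
    rw [← eq_inv_mul_iff_mul_eq, ← mul_assoc] at e0 e1
    rw [add_zero] at e0
    rw [e0, e1]
    have h1 := congrArg (fun x => (a.comb i 3)⁻¹ * DKGrp.shift K i x * a.comb i 3) h0
    simp only [map_mul] at h1
    simpa only [mul_assoc, mul_inv_cancel_left] using h1
  comm i j hij _ := (a.emb_comm_gen hij (a.gen_mem i)).eq

/-- The word moves the first strand across m others. The hexagon with blocks 1, m, 1 provides the
crossing with one more strand. -/
theorem downWord_gen (m : ℕ) : downWord a.gen m = a.braid 1 m * a.comb 1 m := by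
  induction m with
  | zero => rw [downWord_zero, braid_zero_right, comb_zero, mul_one]
  | succ m ih =>
    have h := a.hexagon_right 1 m 1
    rw [mul_assoc, mul_assoc, ← eq_inv_mul_iff_mul_eq] at h
    rw [downWord_succ, ih, comb_succ, ← mul_assoc, ← mul_assoc, gen, h]
    simp only [mul_assoc]

theorem comb_downWord {n m M : ℕ} (h : m + 1 ≤ M) :
    a.comb n M * downWord (fun j => a.gen (n + j)) m =
      DKGrp.shift K n (downWord a.gen m) * a.comb n M := by
  induction m with
  | zero => simp
  | succ m ih =>
    rw [downWord_succ, downWord_succ, ← mul_assoc, a.comb_gen (by omega), mul_assoc,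
      ih (by omega), map_mul, mul_assoc]

/-- After regrouping source and target, the word b_{n,m} acts as the braiding of blocks. By
induction on n, `hexagon_left` with blocks n, 1, m separates the last strand, `downWord_gen` treats
its crossing, and `comb_assoc` matches the bracketings. -/
theorem crossWord_gen (n m : ℕ) :
    a.comb m n * crossWord a.gen n m = a.braid n m * a.comb n m := by
  induction n with
  | zero => rw [comb_zero, crossWord_zero, braid_zero_left, zero_comb]
  | succ n ih =>
    have h1 := a.hexagon_left n 1 m
    have h2 := a.comb_assoc n 1 m
    have h3 := a.comb_downWord (n := n) (m := m) le_rfl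
    rw [downWord_gen, comb_succ, map_mul] at h3
    rw [comb_one, mul_one, add_comm 1 m, comb_succ] at h2
    rw [comb_succ, crossWord_succ, mul_assoc, ← mul_assoc (a.comb m n), ih, h1]
    rw [mul_assoc, ← eq_inv_mul_iff_mul_eq] at h3
    simp only [mul_assoc] at h2 h3 ⊢
    rw [h3, h2]

end Associator

end StableRepresentation

/-! ### Generation of braid groups. -/

section BraidGeneration

theorem Braid.eq_top_of_mem {n : ℕ} {H : Subgroup (Braid n)} (h : ∀ i, i < n - 1 → σ n i ∈ H) :
    H = ⊤ := by
  rw [eq_top_iff, ← PresentedGroup.closure_range_of, Subgroup.closure_le]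
  rintro _ ⟨i, rfl⟩
  have := h i i.2
  rwa [σ, dif_pos i.2] at this

end BraidGeneration

/-! ### Block sums in t_n as interval sums. -/

section Blocks

variable {K : Type u} [CommRing K]

theorem LieT.toDK_block {n m k p q : ℕ} {f : Fin n → Fin k} {g : Fin m → Fin k}
    (hf : ∀ i, (f i : ℕ) = p + i) (hg : ∀ i, (g i : ℕ) = q + i) :
    LieT.toDK K Fin.valEmbedding (LieT.block f g) =
      DK.T K (Finset.Ico p (p + n)) (Finset.Ico q (q + m)) := by
  simp only [LieT.block, map_sum, LieT.toDK_t, DK.T, Finset.sum_Ico_eq_sum_range,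
    Nat.add_sub_cancel_left, Finset.sum_range, Fin.valEmbedding_apply, hf, hg]

end Blocks

/-! ### Construction of j_Φ. -/

section StrictFunctor

variable {K : Type u} [CommRing K] [Algebra ℚ K]

namespace Associator

variable (a : Associator K)

/-- The action of the braid group on the left-bracketed word. -/
noncomputable def rep (n : ℕ) : Braid n →* DKGrp K ℕ := Braid.lift a.gen (a.gen_artinRels _)

theorem rep_σ {n i : ℕ} (h : i < n - 1) : a.rep n (Braid.σ n i) = a.gen i := Braid.lift_σ _ _ h

theorem rep_mem {n : ℕ} (b : Braid n) : a.rep n b ∈ (GrpT.emb K n).range := by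
  have : (GrpT.emb K n).range.comap (a.rep n) = ⊤ := Braid.eq_top_of_mem fun i hi => by
    rw [Subgroup.mem_comap, rep_σ a hi]
    exact GrpT.range_mono (by omega) (a.gen_mem i)
  have h : b ∈ (⊤ : Subgroup (Braid n)) := Subgroup.mem_top b
  rwa [← this] at h

theorem rep_inl {n : ℕ} (m : ℕ) (b : Braid n) : a.rep (n + m) (Braid.inl n m b) = a.rep n b := by
  refine DFunLike.congr_fun (f := (a.rep (n + m)).comp (Braid.inl n m))
    (Braid.hom_ext fun i hi => ?_) b
  rw [MonoidHom.comp_apply, Braid.inl, Braid.lift_σ _ _ hi, a.rep_σ hi, a.rep_σ (by omega)]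

theorem comb_rep_inr (n : ℕ) {m : ℕ} (b : Braid m) :
    a.comb n m * a.rep (n + m) (Braid.inr n m b) =
      DKGrp.shift K n (a.rep m b) * a.comb n m := by
  rw [← mul_inv_eq_iff_eq_mul]
  refine DFunLike.congr_fun (f := (MulAut.conj (a.comb n m)).toMonoidHom.comp
    ((a.rep (n + m)).comp (Braid.inr n m))) (g := (DKGrp.shift K n).comp (a.rep m))
    (Braid.hom_ext fun i hi => ?_) b
  change a.comb n m * a.rep (n + m) (Braid.inr n m (Braid.σ m i)) * (a.comb n m)⁻¹ =
    DKGrp.shift K n (a.rep m (Braid.σ m i))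
  rw [mul_inv_eq_iff_eq_mul, Braid.inr, Braid.lift_σ _ _ hi, a.rep_σ hi, a.rep_σ (by omega),
    a.comb_gen (by omega)]

theorem comb_rep_juxt {n m : ℕ} (b : Braid n) (b' : Braid m) :
    a.comb n m * a.rep (n + m) (Braid.juxt b b') =
      a.rep n b * DKGrp.shift K n (a.rep m b') * a.comb n m := by
  rw [Braid.juxt, map_mul, rep_inl, ← mul_assoc, ← (a.comb_comm (a.rep_mem b)).eq, mul_assoc,
    comb_rep_inr, mul_assoc]

theorem comb_rep_cross (n m : ℕ) :
    a.comb m n * a.rep (n + m) (Braid.cross n m) = a.braid n m * a.comb n m := by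
  rw [← crossWord_gen, Braid.cross, map_crossWord]
  congr 1
  -- Out of range `Braid.σ` is trivial whereas `gen` is not, so the letters of the words have to be
  -- compared with bounds on their indices.
  have hd : ∀ i M, M ≤ m → i < n → downWord (fun j => a.rep (n + m) (Braid.σ (n + m) (i + j))) M =
      downWord (fun j => a.gen (i + j)) M := by
    intro i M hM hi
    induction M with
    | zero => simp
    | succ M ih => rw [downWord_succ, downWord_succ, ih (by omega), a.rep_σ (by omega)]
  have hc : ∀ N, N ≤ n → crossWord (fun i => a.rep (n + m) (Braid.σ (n + m) i)) N m =
      crossWord a.gen N m := by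
    intro N hN
    induction N with
    | zero => simp
    | succ N ih => rw [crossWord_succ, crossWord_succ, ih (by omega), hd N m le_rfl (by omega)]
  exact hc n le_rfl

theorem gen_right (i : ℕ) : (a.gen i).right =
    Equiv.Perm.viaEmbeddingHom (addLeftEmbedding i) (natBlockPerm 1 1) := by
  rw [gen, shift_braid, assoc]
  simp

theorem rep_right {n : ℕ} (b : Braid n) :
    (a.rep n b).right = Equiv.Perm.viaEmbeddingHom Fin.valEmbedding (Braid.perm n b) := by
  refine DFunLike.congr_fun (f := SemidirectProduct.rightHom.comp (a.rep n))
    (g := (Equiv.Perm.viaEmbeddingHom Fin.valEmbedding).comp (Braid.perm n))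
    (Braid.hom_ext fun i hi => ?_) b
  rw [MonoidHom.comp_apply, MonoidHom.comp_apply, a.rep_σ hi, SemidirectProduct.rightHom_eq_right,
    gen_right, Braid.perm_σ]
  ext x
  rw [viaEmbedding_val, viaEmbedding_addLeft, natBlockPerm_apply]
  by_cases hx : x < n
  · rw [dif_pos hx, transp_val (by omega)]
    dsimp only
    split_ifs <;> omega
  · rw [dif_neg hx]
    split_ifs <;> omega

/-- The element relating the left-bracketed word to the word bracketed according to a tree. -/
noncomputable def treeElt : BinTree → DKGrp K ℕ
  | .leaf => 1
  | .node l r => treeElt l * DKGrp.shift K l.leaves (treeElt r) * a.comb l.leaves r.leaves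

theorem treeElt_node (l r : BinTree) : a.treeElt (l.node r) =
    a.treeElt l * DKGrp.shift K l.leaves (a.treeElt r) * a.comb l.leaves r.leaves := rfl

theorem treeElt_mem (t : BinTree) : a.treeElt t ∈ (GrpT.emb K t.leaves).range := by
  induction t with
  | leaf => exact one_mem _
  | node l r hl hr =>
    exact mul_mem (mul_mem (GrpT.range_mono (Nat.le_add_right _ _) hl) (GrpT.shift_mem hr))
      (a.comb_mem _ _)

/-- The element relating the left-bracketed word to a parenthesized word. -/
noncomputable def parenElt {n : ℕ} (t : Paren n) : DKGrp K ℕ := t.1.elim 1 a.treeElt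

theorem parenElt_mem {n : ℕ} (t : Paren n) : a.parenElt t ∈ (GrpT.emb K n).range := by
  obtain ⟨t, rfl⟩ := t
  cases t with
  | none => exact one_mem _
  | some t => exact a.treeElt_mem t

/-- For two trees this is the recursive definition of `treeElt`. The empty word is a strict unit
because `comb 0 m` and `comb n 0` are both trivial. -/
theorem parenElt_concat {n m : ℕ} (t : Paren n) (t' : Paren m) : a.parenElt (t.concat t') =
    a.parenElt t * DKGrp.shift K n (a.parenElt t') * a.comb n m := by
  obtain ⟨t, rfl⟩ := t
  obtain ⟨t', rfl⟩ := t'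
  cases t with
  | none =>
    change a.parenElt _ = 1 * DKGrp.shift K 0 (a.parenElt _) * a.comb 0 _
    rw [zero_comb, DKGrp.shift_zero, mul_one, one_mul]
    rfl
  | some t =>
    cases t' with
    | none =>
      change a.parenElt _ = a.parenElt _ * DKGrp.shift K _ 1 * a.comb _ 0
      rw [comb_zero, map_one, mul_one, mul_one]
      rfl
    | some t' => rfl

/-- The image of a braid from a parenthesized word to another one. -/
noncomputable def transport {n m : ℕ} (t : Paren n) (t' : Paren m) (b : Braid n) : DKGrp K ℕ :=
  a.parenElt t' * a.rep n b * (a.parenElt t)⁻¹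

theorem exists_transport {n m : ℕ} (h : n = m) (t : Paren n) (t' : Paren m) (b : Braid n) :
    ∃ x : GrpT K n, GrpT.emb K n x = a.transport t t' b := by
  subst h
  exact mul_mem (mul_mem (a.parenElt_mem t') (a.rep_mem b)) (inv_mem (a.parenElt_mem t))

theorem right_of_mem_tree (t : BinTree) : (a.treeElt t).right = 1 := by
  have hc : ∀ n m, (a.comb n m).right = 1 := by
    intro n m
    induction m with
    | zero => rfl
    | succ m ih => rw [comb_succ, SemidirectProduct.mul_right, ih, assoc]; simp
  induction t with
  | leaf => rfl
  | node l r hl hr =>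
    rw [treeElt_node, SemidirectProduct.mul_right, SemidirectProduct.mul_right, hl, hc, mul_one,
      one_mul]
    change Equiv.Perm.viaEmbeddingHom _ (a.treeElt r).right = 1
    rw [hr, map_one]

theorem parenElt_right {n : ℕ} (t : Paren n) : (a.parenElt t).right = 1 := by
  obtain ⟨t, h⟩ := t
  cases t with
  | none => rfl
  | some t => exact a.right_of_mem_tree t

theorem transport_right {n m : ℕ} (t : Paren n) (t' : Paren m) (b : Braid n) :
    (a.transport t t' b).right = Equiv.Perm.viaEmbeddingHom Fin.valEmbedding (Braid.perm n b) := by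
  rw [transport, SemidirectProduct.mul_right, SemidirectProduct.mul_right,
    SemidirectProduct.inv_right, parenElt_right, parenElt_right, rep_right, one_mul, inv_one,
    mul_one]

/-- The functor `PaB_S → PaCD_S^Φ` on morphisms. -/
noncomputable def strictMap {S : Type v} {X Y : LabObj Paren S} (f : LabCat.Hom X Y braidGroups) :
    LabCat.Hom X Y (tGroups K) where
  len := f.len
  elt := (a.exists_transport f.len X.tree Y.tree f.elt).choose
  lab i := by
    -- The correcting elements have trivial permutation, so the chosen preimage has the permutation
    -- of the braid and the label condition is that of `f`.
    have h := (a.exists_transport f.len X.tree Y.tree f.elt).choose_spec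
    have h' := (GrpT.emb_right _).symm.trans ((congrArg SemidirectProduct.right h).trans
      (a.transport_right X.tree Y.tree f.elt))
    have h'' := Equiv.Perm.viaEmbeddingHom_injective _ h'
    refine Eq.trans ?_ (f.lab i)
    congr 2
    exact DFunLike.congr_fun h'' i

theorem emb_strictMap {S : Type v} {X Y : LabObj Paren S} (f : LabCat.Hom X Y braidGroups) :
    GrpT.emb K X.n (a.strictMap f).elt = a.transport X.tree Y.tree f.elt :=
  (a.exists_transport f.len X.tree Y.tree f.elt).choose_spec

theorem hom_ext_emb {S : Type v} {X Y : LabObj Paren S} {f g : LabCat.Hom X Y (tGroups K)}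
    (h : GrpT.emb K X.n f.elt = GrpT.emb K X.n g.elt) : f = g :=
  LabCat.Hom.ext (GrpT.emb_injective _ h)

theorem transport_self_one {n : ℕ} (t : Paren n) : a.transport t t 1 = 1 := by
  rw [transport, map_one, mul_one, mul_inv_cancel]

theorem transport_mul_self {n m p : ℕ} (t : Paren n) (t' : Paren m) (t'' : Paren p)
    (b b' : Braid n) : a.transport t t'' (b' * b) =
      a.parenElt t'' * a.rep n b' * (a.parenElt t')⁻¹ * a.transport t t' b := by
  rw [transport, transport, map_mul]
  simp only [mul_assoc, inv_mul_cancel_left]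

theorem transport_mul {n m p : ℕ} (h : n = m) (t : Paren n) (t' : Paren m) (t'' : Paren p)
    (b : braidGroups.G n) (b' : braidGroups.G m) :
      a.transport t t'' (show Braid n from (braidGroups.cast h.symm b' * b)) =
      a.transport t' t'' b' * a.transport t t' b := by
  subst h
  exact a.transport_mul_self t t' t'' b b'

theorem commute_shift {n : ℕ} {x : DKGrp K ℕ} (hx : x ∈ (GrpT.emb K n).range) (y : DKGrp K ℕ) :
    Commute x (DKGrp.shift K n y) := by
  obtain ⟨x, rfl⟩ := hx
  exact DKGrp.commute_emb_shift x le_rfl y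

/-- The two `comb` factors cancel by `comb_rep_juxt`. What remains only reorders elements supported
on [0, n) and on [n, ∞), which commute. -/
theorem transport_juxt {n m n' m' : ℕ} (h : n = n') (k : m = m') (t : Paren n) (t' : Paren m)
    (u : Paren n') (u' : Paren m') (b : Braid n) (b' : Braid m) :
    a.transport (t.concat t') (u.concat u') (Braid.juxt b b') =
      a.transport t u b * DKGrp.shift K n (a.transport t' u' b') := by
  subst h k
  have c1 := commute_shift (a.rep_mem b) (a.parenElt u')
  have c2 := commute_shift (a.parenElt_mem t) (a.transport t' u' b')
  rw [transport, parenElt_concat, parenElt_concat, mul_assoc _ (a.comb _ _), comb_rep_juxt]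
  calc _ = a.parenElt u * (DKGrp.shift K n (a.parenElt u') * a.rep n b) *
        DKGrp.shift K n (a.rep m b') * (DKGrp.shift K n (a.parenElt t'))⁻¹ *
          (a.parenElt t)⁻¹ := by
          simp only [mul_inv_rev, mul_assoc, mul_inv_cancel_left]
    _ = a.parenElt u * a.rep n b * (DKGrp.shift K n (a.transport t' u' b') *
        (a.parenElt t)⁻¹) := by
          rw [← c1.eq, transport, map_mul, map_mul, map_inv]
          simp only [mul_assoc]
    _ = _ := by
          rw [← c2.inv_left.eq]
          change _ = a.parenElt u * a.rep n b * (a.parenElt t)⁻¹ * _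
          simp only [mul_assoc]

/-- For left-bracketed words this is `comb_rep_cross`; naturality of the braiding in both arguments
carries it over to arbitrary bracketings. -/
theorem transport_cross {n m : ℕ} (t : Paren n) (t' : Paren m) :
    a.transport (t.concat t') (t'.concat t) (Braid.cross n m) = a.braid n m := by
  rw [transport, mul_inv_eq_iff_eq_mul, parenElt_concat, parenElt_concat,
    mul_assoc _ (a.comb _ _), comb_rep_cross, ← mul_assoc, ← mul_assoc, ← mul_assoc,
    a.braid_emb (a.parenElt_mem t), mul_assoc _ (a.braid _ _) (DKGrp.shift _ _ _),
    a.braid_shift (a.parenElt_mem t'),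
    ← mul_assoc, (commute_shift (a.parenElt_mem t') _).eq]

/-- The elements of the three bracketings each act inside one block and so commute with the
associator, which leaves `comb_assoc`. -/
theorem transport_assoc {n m p : ℕ} (t : Paren n) (t' : Paren m) (t'' : Paren p) :
    a.transport ((t.concat t').concat t'') (t.concat (t'.concat t'')) 1 =
      a.assoc 0 n (n + m) (n + m + p) := by
  have h := a.comb_assoc n m p
  have c1 := a.commute_assoc_zero (i := 0) (j := n) (k := n + m) (l := n + m + p)
    (by omega) (by omega) (by omega) (by omega) (by omega) (a.parenElt_mem t)
  have c2 := a.commute_assoc (p := n) (i := 0) (j := n) (k := n + m)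
    (l := n + m + p) (by omega) (by omega) (by omega) (by omega) (a.parenElt_mem t')
  have c3 := a.commute_assoc (p := n + m) (i := 0) (j := n) (k := n + m)
    (l := n + m + p) (by omega) (by omega) (by omega) (by omega) (a.parenElt_mem t'')
  have c4 := commute_shift (a.comb_mem n m) (a.parenElt t'')
  rw [transport, map_one, mul_one, mul_inv_eq_iff_eq_mul]
  simp only [parenElt_concat, map_mul, DKGrp.shift_shift]
  calc _ = a.parenElt t * DKGrp.shift K n (a.parenElt t') *
        DKGrp.shift K (n + m) (a.parenElt t'') *
          (DKGrp.shift K n (a.comb m p) * a.comb n (m + p)) := by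
          simp only [mul_assoc]
    _ = a.assoc 0 n (n + m) (n + m + p) * (a.parenElt t *
        DKGrp.shift K n (a.parenElt t') * DKGrp.shift K (n + m) (a.parenElt t'')) *
            (a.comb n m * a.comb (n + m) p) := by
          rw [← h, ← ((c1.mul_left c2).mul_left c3).eq]; simp only [mul_assoc]
    _ = _ := by
          simp only [mul_assoc]
          rw [← mul_assoc (a.comb n m), c4.eq]
          simp only [mul_assoc]

theorem emb_assoc (n m p : ℕ) :
    GrpT.emb K (n + m + p) (SemidirectProduct.inl (subst a.Φ
      (LieT.block (Fin.castAdd p ∘ Fin.castAdd m) (Fin.castAdd p ∘ Fin.natAdd n))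
      (LieT.block (Fin.castAdd p ∘ Fin.natAdd n) (Fin.natAdd (n + m))))) =
      a.assoc 0 n (n + m) (n + m + p) := by
  rw [GrpT.emb_inl, map_subst, LieT.toDK_block (p := 0) (q := n),
    LieT.toDK_block (p := n) (q := n + m), zero_add]
  · rfl
  all_goals intro i; simp

theorem emb_braid (n m : ℕ) :
    GrpT.emb K (n + m) (SemidirectProduct.inr (blockPerm n m) * SemidirectProduct.inl
      (expHalf a.μ (LieT.block (Fin.castAdd m) (Fin.natAdd n)))) = a.braid n m := by
  rw [map_mul, GrpT.emb_inl, GrpT.emb_inr, map_expHalf, LieT.toDK_block (p := 0) (q := n),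
    zero_add]
  · rfl
  all_goals intro i; simp

theorem emb_mul_cast {n m : ℕ} (h : n = m) (x : (tGroups K).G n) (y : (tGroups K).G m) :
    GrpT.emb K n (show GrpT K n from ((tGroups K).cast h.symm y * x)) =
      GrpT.emb K m y * GrpT.emb K n x := by
  subst h
  exact map_mul (GrpT.emb K n) y x

/-- The strict braided monoidal functor `PaB_S → PaCD_S^Φ`. -/
noncomputable def strictFunctor (S : Type v) : StrictBraidedFunctor S a where
  map f := a.strictMap f
  map_id X := hom_ext_emb ((a.emb_strictMap _).trans
    ((a.transport_self_one X.tree).trans (map_one (GrpT.emb K X.n)).symm))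
  map_comp {X Y Z} f g := hom_ext_emb <| (a.emb_strictMap _).trans <|
    (a.transport_mul f.len X.tree Y.tree Z.tree f.elt g.elt).trans <|
    (congrArg₂ (· * ·) (a.emb_strictMap g) (a.emb_strictMap f)).symm.trans
    (emb_mul_cast f.len (a.strictMap f).elt (a.strictMap g).elt).symm
  map_tensor {X X' Y Y'} f g := hom_ext_emb <| (a.emb_strictMap _).trans <|
    (a.transport_juxt f.len g.len X.tree Y.tree X'.tree Y'.tree f.elt g.elt).trans <|
    (congrArg₂ (fun x y => x * DKGrp.shift K X.n y) (a.emb_strictMap f)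
      (a.emb_strictMap g)).symm.trans (GrpT.emb_juxt (a.strictMap f).elt (a.strictMap g).elt).symm
  map_braiding X Y := hom_ext_emb <| (a.emb_strictMap _).trans <|
    (a.transport_cross X.tree Y.tree).trans (a.emb_braid X.n Y.n).symm
  map_associator X Y Z := hom_ext_emb <| (a.emb_strictMap _).trans <|
    (a.transport_assoc X.tree Y.tree Z.tree).trans (a.emb_assoc X.n Y.n Z.n).symm

end Associator

end StrictFunctor

/-! ### Uniqueness of j_Φ. -/

section Uniqueness

theorem perm_apply_inv {α : Type*} (σ : Equiv.Perm α) (x : α) : σ (σ⁻¹ x) = x :=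
  σ.apply_symm_apply x

theorem perm_inv_apply {α : Type*} (σ : Equiv.Perm α) (x : α) : σ⁻¹ (σ x) = x :=
  σ.symm_apply_apply x

namespace LabCat

variable {P : PermGroups.{u}} {S : Type v}

/-- The inverse of a morphism. -/
def Hom.symm {T : ℕ → Type} {X Y : LabObj T S} (f : Hom X Y P) : Hom Y X P where
  len := f.len.symm
  elt := P.cast f.len f.elt⁻¹
  lab i := by
    rcases X with ⟨n, t, s⟩
    rcases Y with ⟨n', t', s'⟩
    rcases f with ⟨h, b, hb⟩
    dsimp only at h b
    subst h
    have h : ∀ j, s j = s' (P.perm n b j) := fun j => (hb j).symm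
    change s (P.perm n b⁻¹ i) = s' i
    rw [h, map_inv, perm_apply_inv]

theorem Hom.symm_symm {T : ℕ → Type} {X Y : LabObj T S} (f : Hom X Y P) : f.symm.symm = f := by
  rcases X with ⟨n, t, s⟩
  rcases Y with ⟨n', t', s'⟩
  rcases f with ⟨h, b, hb⟩
  dsimp only at h b
  subst h
  exact Hom.ext (inv_inv b)

theorem comp_symm {T : ℕ → Type} {X Y : LabCat P T S} (f : X ⟶ Y) :
    f ≫ (show Y ⟶ X from Hom.symm f) = 𝟙 X := by
  apply Hom.ext
  rcases X with ⟨n, t, s⟩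
  rcases Y with ⟨n', t', s'⟩
  rcases f with ⟨h, b, hb⟩
  dsimp only at h b
  subst h
  exact inv_mul_cancel b

theorem symm_comp {T : ℕ → Type} {X Y : LabCat P T S} (f : X ⟶ Y) :
    (show Y ⟶ X from Hom.symm f) ≫ f = 𝟙 Y := by
  apply Hom.ext
  rcases X with ⟨n, t, s⟩
  rcases Y with ⟨n', t', s'⟩
  rcases f with ⟨h, b, hb⟩
  dsimp only at h b
  subst h
  exact mul_inv_cancel b

/-- The labels of the target are those of the source carried along by the permutation of the
morphism, so the target is determined once its bracketing is known. -/
theorem target_eq {X Y Z : LabObj Paren S} (f : Hom X Y P) (g : Hom X Z P)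
    (h : f.elt = g.elt) (ht : Y.tree.1 = Z.tree.1) : Y = Z := by
  rcases X with ⟨n, t, s⟩
  rcases Y with ⟨n', t', s'⟩
  rcases Z with ⟨n'', t'', s''⟩
  rcases f with ⟨hf, b, hb⟩
  rcases g with ⟨hg, c, hc⟩
  dsimp only at hf b hg c h ht
  subst hf hg h
  obtain rfl : t' = t'' := Subtype.ext ht
  congr 1
  funext i
  have h1 := hb ((P.perm n b)⁻¹ i)
  have h2 := hc ((P.perm n b)⁻¹ i)
  rw [perm_apply_inv] at h1 h2
  exact h1.trans h2.symm

theorem exists_tensorObj (X : LabObj Paren S) {l r : BinTree} (h : X.tree.1 = some (l.node r)) :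
    ∃ A B : LabObj Paren S, A.tree.1 = some l ∧ B.tree.1 = some r ∧
      X = LabCat.tensorObj (P := P) A B := by
  rcases X with ⟨n, ⟨t, ht⟩, s⟩
  dsimp only at h
  subst h
  dsimp only [Option.elim_some, BinTree.leaves] at ht
  subst ht
  refine ⟨⟨l.leaves, ⟨some l, rfl⟩, fun i => s (Fin.castAdd _ i)⟩,
    ⟨r.leaves, ⟨some r, rfl⟩, fun i => s (Fin.natAdd _ i)⟩, rfl, rfl, ?_⟩
  exact congrArg (LabObj.mk (T := Paren) (l.leaves + r.leaves) ⟨some (l.node r), rfl⟩)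
    (Fin.append_castAdd_natAdd (f := s)).symm

end LabCat

/-- The left comb with `n + 1` leaves. -/
def BinTree.comb : ℕ → BinTree
  | 0 => .leaf
  | n + 1 => (BinTree.comb n).node .leaf

theorem BinTree.leaves_comb (n : ℕ) : (BinTree.comb n).leaves = n + 1 := by
  induction n with
  | zero => rfl
  | succ n ih => rw [comb, leaves, ih]; rfl

/-- A parenthesization of a word of length `n`. -/
def Paren.someTree : (n : ℕ) → Paren n
  | 0 => ⟨none, rfl⟩
  | n + 1 => ⟨some (BinTree.comb n), BinTree.leaves_comb n⟩

namespace StrictBraidedFunctor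

variable {K : Type u} [CommRing K] [Algebra ℚ K] {S : Type v} {a : Associator K}
  (j j' : StrictBraidedFunctor S a)

theorem agree_comp {X Y Z : PaB S} {f : X ⟶ Y} {g : Y ⟶ Z} (hf : j.map f = j'.map f)
    (hg : j.map g = j'.map g) : j.map (f ≫ g) = j'.map (f ≫ g) :=
  (j.map_comp f g).trans ((congrArg₂ (fun x y => CategoryStruct.comp (obj := PaCD K S) x y)
    hf hg).trans (j'.map_comp f g).symm)

theorem agree_symm {X Y : PaB S} {f : X ⟶ Y} (hf : j.map f = j'.map f) :
    j.map (LabCat.Hom.symm f) = j'.map (LabCat.Hom.symm f) := by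
  let g : Y ⟶ X := LabCat.Hom.symm f
  have e1 : j.toFunctor.map f ≫ j.toFunctor.map g = 𝟙 _ := by
    rw [← Functor.map_comp, LabCat.comp_symm, CategoryTheory.Functor.map_id]
  have e2 : j'.toFunctor.map g ≫ j'.toFunctor.map f = 𝟙 _ := by
    rw [← Functor.map_comp, LabCat.symm_comp, CategoryTheory.Functor.map_id]
  have hf' : j.toFunctor.map f = j'.toFunctor.map f := hf
  change j.toFunctor.map g = j'.toFunctor.map g
  rw [hf'] at e1
  exact (Category.id_comp (obj := PaCD K S) _).symm.trans
    ((congrArg (fun x => CategoryStruct.comp (obj := PaCD K S) x (j.toFunctor.map g)) e2).symm.trans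
    ((Category.assoc (obj := PaCD K S) _ _ _).trans
    ((congrArg (fun x => CategoryStruct.comp (obj := PaCD K S) (j'.toFunctor.map g) x) e1).trans
      (Category.comp_id (obj := PaCD K S) _))))

theorem agree_tensor {X X' Y Y' : PaB S} {f : X ⟶ X'} {g : Y ⟶ Y'} (hf : j.map f = j'.map f)
    (hg : j.map g = j'.map g) :
    j.map (PaB.tensorHom f g) = j'.map (PaB.tensorHom f g) :=
  (j.map_tensor f g).trans ((congrArg₂ (fun x y => PaCD.tensorHom x y) hf hg).trans
    (j'.map_tensor f g).symm)

/-- The two morphisms are the same by `LabCat.target_eq`. The lemma serves to replace a morphism by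
an explicit composite or tensor product without transport along equalities of objects. -/
theorem agree_congr {X Y Z : LabObj Paren S} {f : LabCat.Hom X Y braidGroups}
    (g : LabCat.Hom X Z braidGroups) (hg : j.map g = j'.map g) (h : f.elt = g.elt)
    (ht : Y.tree.1 = Z.tree.1) : j.map f = j'.map f := by
  obtain rfl := LabCat.target_eq f g h ht
  obtain rfl := LabCat.Hom.ext h
  exact hg

/-- The two functors agree on the trivial braids with prescribed parenthesizations of the source
and of the target. -/
def AgreeOne (t t' : BinTree) : Prop :=
  ∀ (X Y : LabObj Paren S) (f : LabCat.Hom X Y braidGroups), X.tree.1 = some t →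
    Y.tree.1 = some t' → f.elt = 1 → j.map f = j'.map f

variable {j j'}

theorem AgreeOne.refl (t : BinTree) : AgreeOne j j' t t := fun X _ _ hX hY h =>
  agree_congr j j' (Z := X) (CategoryStruct.id (obj := PaB S) X)
    ((j.map_id X).trans (j'.map_id X).symm) h (hY.trans hX.symm)

theorem AgreeOne.symm {t t' : BinTree} (h : AgreeOne j j' t t') : AgreeOne j j' t' t :=
  fun X Y f hX hY hf => by
    rw [← f.symm_symm]
    refine agree_symm (X := Y) (Y := X) j j' (f := LabCat.Hom.symm f)
      (h Y X (LabCat.Hom.symm f) hY hX ?_)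
    change braidGroups.cast f.len f.elt⁻¹ = 1
    rw [hf, inv_one, map_one]

theorem AgreeOne.trans {t t' t'' : BinTree} (h : AgreeOne j j' t t') (h' : AgreeOne j j' t' t'')
    (hl : t.leaves = t'.leaves) : AgreeOne j j' t t'' := by
  intro X Z f hX hZ hf
  have e : t'.leaves = X.n := by rw [← hl, ← X.tree.2, hX]; rfl
  let Y : LabObj Paren S := ⟨X.n, ⟨some t', e⟩, X.lab⟩
  let g : LabCat.Hom X Y braidGroups := ⟨rfl, 1, fun i => by rw [map_one]; rfl⟩
  let k : LabCat.Hom Y Z braidGroups := ⟨f.len, f.elt, f.lab⟩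
  refine agree_congr j j' (CategoryStruct.comp (obj := PaB S) g k)
    (agree_comp j j' (h _ _ g hX rfl rfl) (h' _ _ k rfl hZ hf)) ?_ rfl
  exact (mul_one f.elt).symm

theorem AgreeOne.node {l l' r r' : BinTree} (h : AgreeOne j j' l l') (h' : AgreeOne j j' r r')
    (hl : l.leaves = l'.leaves) (hr : r.leaves = r'.leaves) :
    AgreeOne j j' (l.node r) (l'.node r') := by
  intro X Z f hX hZ hf
  obtain ⟨A, B, hA, hB, rfl⟩ := LabCat.exists_tensorObj (P := braidGroups) X hX
  have eA : l'.leaves = A.n := by rw [← hl, ← A.tree.2, hA]; rfl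
  have eB : r'.leaves = B.n := by rw [← hr, ← B.tree.2, hB]; rfl
  let A' : LabObj Paren S := ⟨A.n, ⟨some l', eA⟩, A.lab⟩
  let B' : LabObj Paren S := ⟨B.n, ⟨some r', eB⟩, B.lab⟩
  let f' : LabCat.Hom A A' braidGroups := ⟨rfl, 1, fun i => by rw [map_one]; rfl⟩
  let g' : LabCat.Hom B B' braidGroups := ⟨rfl, 1, fun i => by rw [map_one]; rfl⟩
  refine agree_congr j j' (PaB.tensorHom f' g')
    (agree_tensor j j' (h _ _ f' hA rfl rfl) (h' _ _ g' hB rfl rfl)) ?_ hZ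
  refine hf.trans ?_
  have : ∀ n m, Braid.juxt (1 : Braid n) (1 : Braid m) = 1 := fun n m => by
    rw [Braid.juxt, map_one, map_one, mul_one]
  exact (this A.n B.n).symm

theorem AgreeOne.assoc (l r s : BinTree) :
    AgreeOne j j' ((l.node r).node s) (l.node (r.node s)) := by
  intro X Z f hX hZ hf
  obtain ⟨D, C, hD, hC, rfl⟩ := LabCat.exists_tensorObj (P := braidGroups) X hX
  obtain ⟨A, B, hA, hB, rfl⟩ := LabCat.exists_tensorObj (P := braidGroups) D hD
  refine agree_congr j j' (PaB.associator A B C)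
    ((j.map_associator A B C).trans (j'.map_associator A B C).symm) hf (hZ.trans ?_)
  rcases A with ⟨n, ⟨t, ht⟩, s⟩
  rcases B with ⟨n', ⟨t', ht'⟩, s'⟩
  rcases C with ⟨n'', ⟨t'', ht''⟩, s''⟩
  dsimp only at hA hB hC
  subst hA hB hC
  rfl

theorem AgreeOne.comb_node (n m : ℕ) :
    AgreeOne j j' ((BinTree.comb n).node (BinTree.comb m)) (BinTree.comb (n + m + 1)) := by
  induction m with
  | zero => exact .refl _
  | succ m ih =>
    -- The last leaf is detached by an inverse associator and the induction hypothesis is tensored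
    -- with it. The comb of index n has n + 1 leaves, whence the index n + m + 1.
    refine (AgreeOne.assoc _ _ _).symm.trans (ih.node (.refl _) ?_ rfl) ?_ <;>
    · simp only [BinTree.leaves, BinTree.leaves_comb]; omega

/-- Every bracketing is joined to the left comb by associators and tensor products, on which strict
functors have no freedom: both subtrees are first turned into combs, which are then merged. -/
theorem AgreeOne.comb (t : BinTree) : AgreeOne j j' t (BinTree.comb (t.leaves - 1)) := by
  induction t with
  | leaf => exact .refl _
  | node l r hl hr =>
    have pl := l.leaves_pos
    have pr := r.leaves_pos
    have e : (l.node r).leaves - 1 = (l.leaves - 1) + (r.leaves - 1) + 1 := by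
      rw [BinTree.leaves]; omega
    rw [e]
    refine (hl.node hr ?_ ?_).trans (.comb_node _ _) ?_ <;>
    · simp only [BinTree.leaves, BinTree.leaves_comb]; omega

theorem agree_of_elt_eq_one {X Y : LabObj Paren S} (f : LabCat.Hom X Y braidGroups)
    (hf : f.elt = 1) : j.map f = j'.map f := by
  have hX := X.tree.2
  have hY := Y.tree.2
  have hn := f.len
  rcases hx : X.tree.1 with _ | t <;> rcases hy : Y.tree.1 with _ | t' <;> rw [hx] at hX <;>
    rw [hy] at hY <;> simp only [Option.elim_none, Option.elim_some] at hX hY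
  · exact agree_congr j j' (Z := X) (CategoryStruct.id (obj := PaB S) X)
      ((j.map_id X).trans (j'.map_id X).symm) hf (hy.trans hx.symm)
  · have := t'.leaves_pos; omega
  · have := t.leaves_pos; omega
  · have e : t.leaves = t'.leaves := by omega
    refine (AgreeOne.comb t).trans (e ▸ (AgreeOne.comb t').symm) ?_ X Y f hx hy hf
    have := t.leaves_pos
    rw [BinTree.leaves_comb]; omega

variable (j j')

/-- The braids on which the two functors agree, for all parenthesizations and labels. -/
def agreeSubgroup (n : ℕ) : Subgroup (Braid n) where
  carrier := {b | ∀ (t t' : Paren n) (s s' : Fin n → S)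
    (f : LabCat.Hom (LabObj.mk n t s) (LabObj.mk n t' s') braidGroups), f.elt = b →
      j.map f = j'.map f}
  one_mem' := fun _ _ _ _ f hf => agree_of_elt_eq_one f hf
  mul_mem' {b c} hb hc := by
    intro t t' s s' f hf
    let Y : LabObj Paren S := ⟨n, t, fun i => s ((Braid.perm n c)⁻¹ i)⟩
    let g : LabCat.Hom (LabObj.mk n t s) Y braidGroups := ⟨rfl, c, fun i => by
      change s ((Braid.perm n c)⁻¹ (Braid.perm n c i)) = s i
      rw [perm_inv_apply]⟩
    let k : LabCat.Hom Y (LabObj.mk n t' s') braidGroups := ⟨rfl, b, fun i => by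
      have h := f.lab ((Braid.perm n c)⁻¹ i)
      rw [hf] at h
      change s' (Braid.perm n (b * c) _) = _ at h
      rw [map_mul, Equiv.Perm.mul_apply, perm_apply_inv] at h
      exact h⟩
    exact agree_congr j j' (CategoryStruct.comp (obj := PaB S) g k)
      (agree_comp j j' (hc _ _ _ _ g rfl) (hb _ _ _ _ k rfl)) hf rfl
  inv_mem' {b} hb := by
    intro t t' s s' f hf
    rw [← f.symm_symm]
    refine agree_symm j j' (X := LabObj.mk n t' s') (Y := LabObj.mk n t s)
      (f := LabCat.Hom.symm f) (hb _ _ _ _ (LabCat.Hom.symm f) ?_)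
    change f.elt⁻¹ = b
    rw [hf]
    exact inv_inv b

variable {j j'}

/-- Up to trivial braids on both sides, the generator is id ⊗ β ⊗ id with i strands before the
crossing and k after it, and its image is imposed by strictness. -/
theorem σ_mem_agreeSubgroup (i k : ℕ) :
    Braid.σ (i + (1 + 1) + k) i ∈ agreeSubgroup j j' (i + (1 + 1) + k) := by
  intro t t' s s' f hf
  -- The bracketings of the outer factors are arbitrary. They are empty words when i = 0 or k = 0,
  -- which includes the extreme generators.
  let A : LabObj Paren S := ⟨i, .someTree i, fun x => s (Fin.castAdd k (Fin.castAdd (1 + 1) x))⟩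
  let B : LabObj Paren S := ⟨1, .someTree 1,
    fun x => s (Fin.castAdd k (Fin.natAdd i (Fin.castAdd 1 x)))⟩
  let B' : LabObj Paren S := ⟨1, .someTree 1,
    fun x => s (Fin.castAdd k (Fin.natAdd i (Fin.natAdd 1 x)))⟩
  let C : LabObj Paren S := ⟨k, .someTree k, fun x => s (Fin.natAdd (i + (1 + 1)) x)⟩
  let X : PaB S := LabCat.tensorObj (P := braidGroups)
    (LabCat.tensorObj (P := braidGroups) A (LabCat.tensorObj (P := braidGroups) B B')) C
  let Y : PaB S := LabCat.tensorObj (P := braidGroups)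
    (LabCat.tensorObj (P := braidGroups) A (LabCat.tensorObj (P := braidGroups) B' B)) C
  let g : X ⟶ Y := PaB.tensorHom (PaB.tensorHom (𝟙 (show PaB S from A)) (PaB.braiding B B'))
    (𝟙 (show PaB S from C))
  have hg : j.map g = j'.map g := agree_tensor j j' (agree_tensor j j'
    ((j.map_id A).trans (j'.map_id A).symm)
    ((j.map_braiding B B').trans (j'.map_braiding B B').symm))
    ((j.map_id C).trans (j'.map_id C).symm)
  have he : LabCat.Hom.elt g = Braid.σ (i + (1 + 1) + k) i := by
    change Braid.inl (i + (1 + 1)) k (Braid.inl i (1 + 1) 1 * Braid.inr i (1 + 1)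
      (Braid.cross 1 1)) * Braid.inr (i + (1 + 1)) k 1 = _
    have : Braid.cross 1 1 = Braid.σ (1 + 1) 0 := by
      rw [Braid.cross, crossWord_succ, crossWord_zero, downWord_succ, downWord_zero, one_mul,
        mul_one]
    rw [map_one, map_one, one_mul, mul_one, this, Braid.inr, Braid.lift_σ _ _ (by omega),
      Braid.inl, Braid.lift_σ _ _ (by omega)]
    rfl
  have hlab : X.lab = s := by
    change Fin.append (Fin.append A.lab (Fin.append B.lab B'.lab)) C.lab = s
    have e1 : Fin.append B.lab B'.lab = fun x => s (Fin.castAdd k (Fin.natAdd i x)) :=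
      Fin.append_castAdd_natAdd (f := fun x => s (Fin.castAdd k (Fin.natAdd i x)))
    have e2 : Fin.append A.lab (fun x => s (Fin.castAdd k (Fin.natAdd i x))) =
      fun x => s (Fin.castAdd k x) :=
      Fin.append_castAdd_natAdd (f := fun x => s (Fin.castAdd k x))
    rw [e1, e2]
    exact Fin.append_castAdd_natAdd (f := s)
  let p : LabCat.Hom (LabObj.mk (i + (1 + 1) + k) t s) X braidGroups := ⟨rfl, 1, fun x => by
    rw [map_one, hlab]; rfl⟩
  let q : LabCat.Hom Y (LabObj.mk (i + (1 + 1) + k) t' s') braidGroups := ⟨rfl, 1, fun x => by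
    have h1 := LabCat.Hom.lab g ((Braid.perm _ (Braid.σ (i + (1 + 1) + k) i))⁻¹ x)
    have h2 := f.lab ((Braid.perm _ (Braid.σ (i + (1 + 1) + k) i))⁻¹ x)
    rw [he] at h1
    rw [hf] at h2
    rw [hlab] at h1
    have h3 := h2.trans h1.symm
    change s' (Braid.perm _ _ ((Braid.perm _ _)⁻¹ x)) =
      Y.lab (Braid.perm _ _ ((Braid.perm _ _)⁻¹ x)) at h3
    rw [map_one]
    exact (congrArg s' (perm_apply_inv _ x)).symm.trans
      (h3.trans (congrArg Y.lab (perm_apply_inv _ x)))⟩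
  refine agree_congr j j' (CategoryStruct.comp (obj := PaB S) p
    (CategoryStruct.comp (obj := PaB S) g q)) (agree_comp j j' (agree_of_elt_eq_one p rfl)
      (agree_comp j j' hg (agree_of_elt_eq_one q rfl))) ?_ rfl
  refine hf.trans (he.symm.trans ?_)
  change LabCat.Hom.elt g = 1 * LabCat.Hom.elt g * 1
  rw [one_mul, mul_one]

theorem eq_of_strict (j j' : StrictBraidedFunctor S a) : j = j' := by
  have key : ∀ n (b : Braid n), b ∈ agreeSubgroup j j' n := by
    intro n
    refine fun b => (Braid.eq_top_of_mem fun i hi => ?_ : agreeSubgroup j j' n = ⊤) ▸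
      Subgroup.mem_top b
    obtain ⟨k, rfl⟩ : ∃ k, n = i + (1 + 1) + k := ⟨n - (i + 2), by omega⟩
    exact σ_mem_agreeSubgroup i k
  apply StrictBraidedFunctor.ext
  funext X Y f
  rcases X with ⟨n, t, s⟩
  rcases Y with ⟨n', t', s'⟩
  have h := f.len
  dsimp only at h
  subst h
  exact key n f.elt t t' s s' f rfl

end StrictBraidedFunctor

end Uniqueness

/-! ### Rooted and unrooted planar trees. -/

section PlanarTrees

/-- Trivalent trees are maximal families of compatible bipartitions, so an inclusion between two of
them is an equality. Equalities of unrooted trees therefore need one inclusion only. -/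
theorem PlT.eq_of_sides_subset {n : ℕ} {t t' : PlT n} (h : t.sides ⊆ t'.sides) : t = t' :=
  PlT.ext (h.antisymm fun A hA => t.maximal A (t'.nonempty A hA) (t'.nonempty _ (t'.compl_mem A hA))
    fun B hB => t'.compat A hA B (h hB))

theorem Paren.toPlT_eq_of_forall {n : ℕ} (t : BinTree) (h : t.leaves = n) (T : PlT n)
    (hT : ∀ a b, t.IsPart 0 a b → (finInterval n a b).Nonempty → (finInterval n a b)ᶜ.Nonempty →
      finInterval n a b ∈ T.sides) : Paren.toPlT (n := n) ⟨some t, h⟩ = T := by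
  refine PlT.eq_of_sides_subset ?_
  rintro A ⟨h1, h2, a, b, hp, hA | hA⟩
  · rw [hA] at h1 h2 ⊢
    exact hT a b hp h1 h2
  · have := T.compl_mem _ (hT a b hp (hA ▸ h2) (by rwa [← hA, compl_compl]))
    rwa [← hA, compl_compl] at this

theorem Paren.mem_sides_of_isPart {n : ℕ} {t : BinTree} (h : t.leaves = n) {a b : ℕ}
    (hp : t.IsPart 0 a b) (h1 : (finInterval n a b).Nonempty) (h2 : (finInterval n a b)ᶜ.Nonempty) :
    finInterval n a b ∈ (Paren.toPlT (n := n) ⟨some t, h⟩).sides :=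
  ⟨h1, h2, a, b, hp, Or.inl rfl⟩

namespace BinTree

/-- Moving the root of a planar binary tree along an edge. -/
inductive RootMove : BinTree → BinTree → Prop
  | mk (a b c : BinTree) : RootMove ((a.node b).node c) (a.node (b.node c))

theorem RootMove.leaves_eq {t t' : BinTree} (h : RootMove t t') : t.leaves = t'.leaves := by
  obtain ⟨a, b, c⟩ := h
  simp only [leaves]; omega

/-- The only part of (ab)c which is not a part of a(bc) is ab. Its complement is the part c, so it
cuts the same edge. -/
theorem RootMove.toPlT_eq {n : ℕ} {t t' : BinTree} (h : RootMove t t') (ht : t.leaves = n)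
    (ht' : t'.leaves = n) : Paren.toPlT (n := n) ⟨some t, ht⟩ = Paren.toPlT ⟨some t', ht'⟩ := by
  obtain ⟨a, b, c⟩ := h
  refine Paren.toPlT_eq_of_forall _ ht _ ?_
  rintro p q hp h1 h2
  have hp' : ((a.node (b.node c)).IsPart 0 p q) ∨ (p = 0 ∧ q = a.leaves + b.leaves) := by
    simp only [IsPart, leaves, zero_add, add_assoc] at hp ⊢
    tauto
  rcases hp' with hp' | ⟨rfl, rfl⟩
  · exact Paren.mem_sides_of_isPart ht' hp' h1 h2
  · refine ⟨h1, h2, a.leaves + b.leaves, a.leaves + b.leaves + c.leaves, ?_, Or.inr ?_⟩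
    · have := c.isPart_self (0 + a.leaves + b.leaves)
      simp only [zero_add] at this
      exact Or.inr (Or.inr (Or.inr (Or.inr (by simpa only [zero_add] using this))))
    · ext i
      have hi := i.2
      have hn : a.leaves + b.leaves + c.leaves = n := ht
      simp only [finInterval, Set.mem_compl_iff, Set.mem_ofPred_eq]
      omega

/-- The equivalence relation generated by the moves of the root. -/
def RootEquiv : BinTree → BinTree → Prop := Relation.EqvGen RootMove

theorem RootEquiv.leaves_eq {t t' : BinTree} (h : RootEquiv t t') : t.leaves = t'.leaves := by
  induction h with
  | rel _ _ h => exact h.leaves_eq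
  | refl => rfl
  | symm _ _ _ ih => exact ih.symm
  | trans _ _ _ _ _ ih ih' => exact ih.trans ih'

theorem RootEquiv.toPlT_eq {n : ℕ} {t t' : BinTree} (h : RootEquiv t t') (ht : t.leaves = n)
    (ht' : t'.leaves = n) : Paren.toPlT (n := n) ⟨some t, ht⟩ = Paren.toPlT ⟨some t', ht'⟩ := by
  induction h with
  | rel _ _ h => exact h.toPlT_eq ht ht'
  | refl => rfl
  | symm _ _ _ ih => exact (ih ht' ht).symm
  | trans _ _ _ h _ ih ih' =>
    have := RootEquiv.leaves_eq h
    exact (ih ht (this ▸ ht)).trans (ih' _ ht')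

/-- The root slides down the left branch until it is next to the first leaf. -/
theorem exists_rootEquiv (l r : BinTree) : ∃ r', RootEquiv (l.node r) (leaf.node r') := by
  induction l generalizing r with
  | leaf => exact ⟨r, .refl _⟩
  | node a b ha hb =>
    obtain ⟨r', h⟩ := ha (b.node r)
    exact ⟨r', .trans _ _ _ (.rel _ _ (.mk a b r)) h⟩

theorem leaves_le_of_isPart {t t' : BinTree} {o : ℕ}
    (h : ∀ a b, t.IsPart o a b → t'.IsPart o a b) : t.leaves ≤ t'.leaves := by
  have := (h _ _ (t.isPart_self o)).bounds
  omega

/-- The left subtree is the longest proper part starting at o, so the parts determine where the root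
splits the leaves, and hence the parts of each subtree. -/
theorem eq_of_isPart {t t' : BinTree} {o : ℕ} (h : ∀ a b, t.IsPart o a b ↔ t'.IsPart o a b) :
    t = t' := by
  induction t generalizing t' o with
  | leaf =>
    have e := (leaves_le_of_isPart fun a b => (h a b).2)
    cases t' with
    | leaf => rfl
    | node l r =>
      have := l.leaves_pos
      have := r.leaves_pos
      simp only [leaves] at e; omega
  | node l r hl hr =>
    have e := (leaves_le_of_isPart fun a b => (h a b).2)
    have e' := (leaves_le_of_isPart fun a b => (h a b).1)
    have pl := l.leaves_pos
    have pr := r.leaves_pos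
    cases t' with
    | leaf => simp only [leaves] at e'; omega
    | node l' r' =>
      have pl' := l'.leaves_pos
      have pr' := r'.leaves_pos
      simp only [leaves] at e e'
      have e1 : l.leaves = l'.leaves := by
        have h1 := (h _ _).1 (Or.inr (Or.inl (l.isPart_self o)))
        have h2 := (h _ _).2 (Or.inr (Or.inl (l'.isPart_self o)))
        rcases h1 with h1 | h1 | h1
        · omega
        · have b1 := h1.bounds
          rcases h2 with h2 | h2 | h2
          · omega
          · have := h2.bounds; omega
          · have := h2.bounds; omega
        · have := h1.bounds; omega
      rw [hl (t' := l') (o := o), hr (t' := r') (o := o + l.leaves)]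
      · intro a b
        constructor
        · intro hp
          have hb := hp.bounds
          rcases (h a b).1 (Or.inr (Or.inr hp)) with h | h | h
          · omega
          · have := h.bounds; omega
          · rwa [e1]
        · intro hp
          have hb := hp.bounds
          rcases (h a b).2 (Or.inr (Or.inr (e1 ▸ hp))) with h | h | h
          · omega
          · have := h.bounds; omega
          · exact h
      · intro a b
        constructor
        · intro hp
          have hb := hp.bounds
          rcases (h a b).1 (Or.inr (Or.inl hp)) with h | h | h
          · omega
          · exact h
          · have := h.bounds; omega
        · intro hp
          have hb := hp.bounds
          rcases (h a b).2 (Or.inr (Or.inl hp)) with h | h | h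
          · omega
          · exact h
          · have := h.bounds; omega

theorem finInterval_inj {n a b a' b' : ℕ} (h : a < b) (hb : b ≤ n) (h' : a' < b') (hb' : b' ≤ n)
    (e : finInterval n a b = finInterval n a' b') : a = a' ∧ b = b' := by
  have key : ∀ i, i < n → ((a ≤ i ∧ i < b) ↔ (a' ≤ i ∧ i < b')) := fun i hi =>
    Set.ext_iff.1 e ⟨i, hi⟩
  have h1 := key a (by omega)
  have h2 := key a' (by omega)
  have h3 := key (b - 1) (by omega)
  have h4 := key (b' - 1) (by omega)
  omega

theorem isPart_of_toPlT_eq {n : ℕ} {r r' : BinTree} (h : (leaf.node r).leaves = n)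
    (h' : (leaf.node r').leaves = n)
    (e : Paren.toPlT (n := n) ⟨some (leaf.node r), h⟩ = Paren.toPlT ⟨some (leaf.node r'), h'⟩)
    {a b : ℕ} (hp : r.IsPart 1 a b) : r'.IsPart 1 a b := by
  have hb := hp.bounds
  have hr : 1 + r.leaves = n := h
  have hr' : 1 + r'.leaves = n := h'
  have pr := r'.leaves_pos
  have hm : finInterval n a b ∈ (Paren.toPlT (n := n) ⟨some (leaf.node r), h⟩).sides :=
    Paren.mem_sides_of_isPart h (Or.inr (Or.inr hp)) ⟨⟨a, by omega⟩, le_rfl, hb.2.1⟩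
      ⟨⟨0, by omega⟩, fun hx => by have := hx.1; dsimp only at this; omega⟩
  rw [e] at hm
  obtain ⟨-, -, c, d, hq, hc | hc⟩ := hm
  · have hq' : (leaf.node r').IsPart 0 c d := hq
    have hcd := hq'.bounds
    rw [zero_add, h'] at hcd
    obtain ⟨rfl, rfl⟩ := finInterval_inj hb.2.1 (by omega) hcd.2.1 hcd.2.2 hc
    rcases hq' with hq | hq | hq
    · omega
    · have := hq.1; omega
    · exact hq
  · have hq' : (leaf.node r').IsPart 0 c d := hq
    have hcd := hq'.bounds
    rw [zero_add, h'] at hcd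
    have key : ∀ i, i < n → (¬ (a ≤ i ∧ i < b) ↔ (c ≤ i ∧ i < d)) := fun i hi =>
      Set.ext_iff.1 hc ⟨i, hi⟩
    have k0 := key 0 (by omega)
    have ka := key a (by omega)
    have k1 := key 1 (by omega)
    have kn := key (n - 1) (by omega)
    have kb := key (b - 1) (by omega)
    have hll : leaf.leaves = 1 := rfl
    -- The complement of [a, b) contains the leaf 0 and is a part, so it is the single leaf beside
    -- the root, and [a, b) is all of r'.
    have : a = 1 ∧ b = 1 + r'.leaves := by
      rcases hq' with hq | hq | hq
      · omega
      · obtain ⟨rfl, rfl⟩ := hq; omega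
      · have := hq.bounds
        simp only [leaves] at this
        omega
    rw [this.1, this.2]
    exact r'.isPart_self 1

/-- Moving both roots next to the first leaf fixes the choice of root. The remaining subtrees have
the same parts and so coincide. -/
theorem rootEquiv_of_toPlT_eq {n : ℕ} {t t' : BinTree} (h : t.leaves = n) (h' : t'.leaves = n)
    (e : Paren.toPlT (n := n) ⟨some t, h⟩ = Paren.toPlT ⟨some t', h'⟩) : RootEquiv t t' := by
  cases t with
  | leaf =>
    cases t' with
    | leaf => exact .refl _
    | node l r =>
      have := l.leaves_pos
      have := r.leaves_pos
      simp only [leaves] at h h'; omega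
  | node l r =>
    cases t' with
    | leaf =>
      have := l.leaves_pos
      have := r.leaves_pos
      simp only [leaves] at h h'; omega
    | node l' r' =>
      obtain ⟨q, hq⟩ := exists_rootEquiv l r
      obtain ⟨q', hq'⟩ := exists_rootEquiv l' r'
      have hl := hq.leaves_eq.symm.trans h
      have hl' := hq'.leaves_eq.symm.trans h'
      have e' := (hq.toPlT_eq h hl).symm.trans (e.trans (hq'.toPlT_eq h' hl'))
      obtain rfl : q = q' := eq_of_isPart fun a b =>
        ⟨isPart_of_toPlT_eq hl hl' e', isPart_of_toPlT_eq hl' hl e'.symm⟩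
      exact .trans _ _ _ hq (.symm _ _ hq')

theorem IsPart.of_add {t : BinTree} {o k a b : ℕ} (h : t.IsPart (o + k) a b) :
    ∃ a' b', a = a' + k ∧ b = b' + k ∧ t.IsPart o a' b' := by
  induction t generalizing o with
  | leaf => exact ⟨o, o + 1, h.1, by rw [h.2]; omega, rfl, rfl⟩
  | node l r hl hr =>
    rcases h with ⟨rfl, rfl⟩ | h | h
    · exact ⟨o, _, rfl, by omega, Or.inl ⟨rfl, rfl⟩⟩
    · obtain ⟨a', b', h1, h2, h3⟩ := hl h
      exact ⟨a', b', h1, h2, Or.inr (Or.inl h3)⟩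
    · rw [show o + k + l.leaves = o + l.leaves + k by omega] at h
      obtain ⟨a', b', h1, h2, h3⟩ := hr h
      exact ⟨a', b', h1, h2, Or.inr (Or.inr h3)⟩

/-- The mirror image of a planar binary tree. -/
def op : BinTree → BinTree
  | leaf => leaf
  | node l r => r.op.node l.op

theorem leaves_op (t : BinTree) : t.op.leaves = t.leaves := by
  induction t with
  | leaf => rfl
  | node l r hl hr => rw [op, leaves, leaves, hl, hr, Nat.add_comm]

/-- Parts of the mirror tree are reflected by x ↦ o' + o + t.leaves - x, which exchanges the two
ends of an interval. -/
theorem IsPart.of_op {t : BinTree} {o a b o' c d : ℕ} (h : t.op.IsPart o a b)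
    (hc : c + b = o' + o + t.leaves) (hd : d + a = o' + o + t.leaves) : t.IsPart o' c d := by
  induction t generalizing o o' with
  | leaf =>
    obtain ⟨rfl, rfl⟩ := h
    simp only [leaves] at hc hd
    exact ⟨by omega, by omega⟩
  | node l r hl hr =>
    simp only [leaves] at hc hd
    rcases h with ⟨rfl, rfl⟩ | h | h
    · rw [leaves_op, leaves_op] at hc
      exact Or.inl ⟨by omega, by omega⟩
    · exact Or.inr (Or.inr (hr h (by omega) (by omega)))
    · rw [leaves_op] at h
      exact Or.inr (Or.inl (hl h (by omega) (by omega)))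

end BinTree

/-- The rotation sends the last leaf to position 0 and moves the other leaves up by one. With the
root beside this leaf, it passes from the right of the root to its left. -/
theorem PlT.r_smul_toPlT {n : ℕ} (t : BinTree) (h : (t.node .leaf).leaves = n)
    (h' : (BinTree.leaf.node t).leaves = n) :
    (DihedralGroup.r 1 : DInf) • Paren.toPlT (n := n) ⟨some (t.node .leaf), h⟩ =
      Paren.toPlT ⟨some (BinTree.leaf.node t), h'⟩ := by
  symm
  refine Paren.toPlT_eq_of_forall _ h' _ fun a b hp h1 h2 => ?_
  have hs : Function.Surjective (finRotate n) := (finRotate n).surjective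
  have e : DInf.toPerm n (DihedralGroup.r 1) = finRotate n := zpow_one _
  change DInf.toPerm n (DihedralGroup.r 1) ⁻¹' _ ∈
    (Paren.toPlT (n := n) ⟨some (t.node .leaf), h⟩).sides
  have hn : 1 + t.leaves = n := h'
  have pt := t.leaves_pos
  have hv : ∀ i : Fin n, (finRotate n i : ℕ) = if (i : ℕ) + 1 = n then 0 else (i : ℕ) + 1 := by
    intro i
    have := finRotate_pow_val 1 i
    rw [pow_one] at this
    rw [this]
    have := i.2
    split_ifs with hi
    · rw [hi, Nat.mod_self]
    · exact Nat.mod_eq_of_lt (by omega)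
  have key : ∃ c d, (t.node .leaf).IsPart 0 c d ∧
      DInf.toPerm n (DihedralGroup.r 1) ⁻¹' finInterval n a b = finInterval n c d := by
    rw [e]
    rcases hp with ⟨rfl, rfl⟩ | ⟨rfl, rfl⟩ | hp
    · refine ⟨0, n, Or.inl ⟨rfl, ?_⟩, ?_⟩
      · rw [← h, BinTree.leaves]; omega
      · ext i
        have := i.2
        have := (finRotate n i).2
        simp only [finInterval, Set.mem_preimage, Set.mem_ofPred_eq, BinTree.leaves]
        omega
    · refine ⟨t.leaves, t.leaves + 1, Or.inr (Or.inr ⟨?_, ?_⟩), ?_⟩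
      · omega
      · omega
      · ext i
        have := i.2
        simp only [finInterval, Set.mem_preimage, Set.mem_ofPred_eq, hv]
        split_ifs <;> omega
    · obtain ⟨c, d, rfl, rfl, hp'⟩ := hp.of_add
      have hb := hp'.bounds
      refine ⟨c, d, Or.inr (Or.inl hp'), ?_⟩
      ext i
      have := i.2
      simp only [finInterval, Set.mem_preimage, Set.mem_ofPred_eq, hv, BinTree.leaves]
      split_ifs <;> omega
  obtain ⟨c, d, hq, hcd⟩ := key
  rw [hcd]
  refine Paren.mem_sides_of_isPart h hq ?_ ?_
  · rw [← hcd, e]; exact h1.preimage hs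
  · rw [← hcd, e, ← Set.preimage_compl]; exact h2.preimage hs

theorem PlT.s_smul_toPlT {n : ℕ} (t : BinTree) (h : t.leaves = n) (h' : t.op.leaves = n) :
    (DihedralGroup.sr 0 : DInf) • Paren.toPlT (n := n) ⟨some t, h⟩ =
      Paren.toPlT ⟨some t.op, h'⟩ := by
  symm
  refine Paren.toPlT_eq_of_forall _ h' _ fun a b hp h1 h2 => ?_
  have hs : Function.Surjective (Fin.revPerm : Equiv.Perm (Fin n)) := Equiv.surjective _
  have e : DInf.toPerm n (DihedralGroup.sr 0) = Fin.revPerm := by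
    change Fin.revPerm * finRotate n ^ (0 : ℤ) = _
    rw [zpow_zero, mul_one]
  change DInf.toPerm n (DihedralGroup.sr 0) ⁻¹' _ ∈ (Paren.toPlT (n := n) ⟨some t, h⟩).sides
  have hb := hp.bounds
  have hcd : DInf.toPerm n (DihedralGroup.sr 0) ⁻¹' finInterval n a b =
      finInterval n (n - b) (n - a) := by
    rw [e]
    ext i
    have := i.2
    simp only [finInterval, Set.mem_preimage, Set.mem_ofPred_eq, Fin.revPerm_apply, Fin.val_rev]
    omega
  rw [hcd]
  refine Paren.mem_sides_of_isPart h (hp.of_op (by omega) (by omega)) ?_ ?_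
  · rw [← hcd, e]; exact h1.preimage hs
  · rw [← hcd, e, ← Set.preimage_compl]; exact h2.preimage hs

/-- An arc which wraps around passes through 0. -/
theorem IsArc.exists_interval {n : ℕ} {A : Set (Fin n)} (hA : IsArc A) (hne : A.Nonempty)
    (h0 : ∀ i ∈ A, (i : ℕ) ≠ 0) : ∃ c d, c < d ∧ d ≤ n ∧ 1 ≤ c ∧ A = finInterval n c d := by
  obtain ⟨a, m, h⟩ := hA
  have han := a.2
  have hm : 0 < m := by
    obtain ⟨x, hx⟩ := hne
    obtain ⟨j, hj, -⟩ := (h x).1 hx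
    omega
  have hlt : (a : ℕ) + m ≤ n := by
    by_contra hlt
    refine h0 ((finRotate n ^ (n - a)) a) ((h _).2 ⟨n - a, by omega, rfl⟩) ?_
    rw [finRotate_pow_val, Nat.add_sub_cancel' han.le, Nat.mod_self]
  refine ⟨a, a + m, by omega, hlt, ?_, ?_⟩
  · have := h0 ((finRotate n ^ 0) a) ((h _).2 ⟨0, hm, rfl⟩)
    rw [finRotate_pow_val, Nat.add_zero, Nat.mod_eq_of_lt han] at this
    omega
  · ext i
    rw [h]
    simp only [finInterval, Set.mem_ofPred_eq, Fin.ext_iff, finRotate_pow_val]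
    constructor
    · rintro ⟨j, hj, hi⟩
      rw [Nat.mod_eq_of_lt (by omega)] at hi
      omega
    · intro hi
      exact ⟨i - a, by omega, by rw [Nat.mod_eq_of_lt (by omega)]; omega⟩

theorem SplitCompat.interval_cases {n a b c d : ℕ} (hn : 0 < n) (ha : 1 ≤ a) (hab : a < b)
    (hb : b ≤ n) (hc : 1 ≤ c) (hcd : c < d) (hd : d ≤ n)
    (h : SplitCompat (finInterval n a b) (finInterval n c d)) :
    b ≤ c ∨ d ≤ a ∨ (c ≤ a ∧ b ≤ d) ∨ (a ≤ c ∧ d ≤ b) := by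
  rcases h with h | h | h | h
  · have key : ∀ i, i < n → ¬ ((a ≤ i ∧ i < b) ∧ (c ≤ i ∧ i < d)) := fun i hi hx =>
      Set.disjoint_left.1 h (show (⟨i, hi⟩ : Fin n) ∈ finInterval n a b from hx.1) hx.2
    have h1 := key a (by omega)
    have h2 := key c (by omega)
    omega
  · have key : ∀ i, i < n → (a ≤ i ∧ i < b) → (c ≤ i ∧ i < d) := fun i hi hx =>
      h (show (⟨i, hi⟩ : Fin n) ∈ finInterval n a b from hx)
    have h1 := key a (by omega)
    have h2 := key (b - 1) (by omega)
    omega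
  · have key : ∀ i, i < n → (c ≤ i ∧ i < d) → (a ≤ i ∧ i < b) := fun i hi hx =>
      h (show (⟨i, hi⟩ : Fin n) ∈ finInterval n c d from hx)
    have h1 := key c (by omega)
    have h2 := key (d - 1) (by omega)
    omega
  · rcases Set.eq_univ_iff_forall.1 h ⟨0, hn⟩ with h | h
    · have := h.1; dsimp only at this; omega
    · have := h.1; dsimp only at this; omega

theorem splitCompat_interval {n a b c d : ℕ}
    (h : b ≤ c ∨ d ≤ a ∨ (c ≤ a ∧ b ≤ d) ∨ (a ≤ c ∧ d ≤ b)) :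
    SplitCompat (finInterval n a b) (finInterval n c d) := by
  rcases h with h | h | h | h
  · exact Or.inl (Set.disjoint_left.2 fun x hx hx' => by
      simp only [finInterval, Set.mem_ofPred_eq] at hx hx'; omega)
  · exact Or.inl (Set.disjoint_left.2 fun x hx hx' => by
      simp only [finInterval, Set.mem_ofPred_eq] at hx hx'; omega)
  · exact Or.inr (Or.inl fun x hx => by
      simp only [finInterval, Set.mem_ofPred_eq] at hx ⊢; omega)
  · exact Or.inr (Or.inr (Or.inl fun x hx => by
      simp only [finInterval, Set.mem_ofPred_eq] at hx ⊢; omega))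

namespace PlT

variable {n : ℕ} (T : PlT n)

/-- From each bipartition one may choose the side which avoids the leaf 0; by planarity it is an
honest interval. Maximality is thereby reduced to a comparison of intervals. -/
theorem mem_sides_of_interval {a b : ℕ} (ha : 1 ≤ a) (hab : a < b) (hb : b ≤ n)
    (h : ∀ c d, 1 ≤ c → c < d → d ≤ n → finInterval n c d ∈ T.sides →
      b ≤ c ∨ d ≤ a ∨ (c ≤ a ∧ b ≤ d) ∨ (a ≤ c ∧ d ≤ b)) : finInterval n a b ∈ T.sides := by
  have main : ∀ B ∈ T.sides, (∀ i ∈ B, (i : ℕ) ≠ 0) → SplitCompat (finInterval n a b) B := by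
    intro B hB h0
    obtain ⟨c, d, hcd, hd, hc, rfl⟩ := (T.arc B hB).exists_interval (T.nonempty B hB) h0
    exact splitCompat_interval (h c d hc hcd hd hB)
  refine T.maximal _ ⟨⟨a, by omega⟩, le_rfl, hab⟩
    ⟨⟨0, by omega⟩, fun hx => by have := hx.1; dsimp only at this; omega⟩ fun B hB => ?_
  by_cases h0 : ∀ i ∈ B, (i : ℕ) ≠ 0
  · exact main B hB h0
  · apply SplitCompat.symm
    rw [← SplitCompat.compl_iff]
    apply SplitCompat.symm
    refine main Bᶜ (T.compl_mem B hB) fun i hi hi0 => h0 fun k hk hk0 => hi ?_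
    obtain rfl : i = k := Fin.ext (hi0.trans hk0.symm)
    exact hk

/-- The rooted subtree is rebuilt by induction on its number of leaves: the longest proper side [a,
m) of [a, b) is its left child, and trivalence provides the right child [m, b). -/
theorem exists_subtree {a b : ℕ} (ha : 1 ≤ a) (hab : a < b) (hb : b ≤ n)
    (h : finInterval n a b ∈ T.sides) : ∃ t : BinTree, a + t.leaves = b ∧
      ∀ c d, t.IsPart a c d → finInterval n c d ∈ T.sides := by
  induction hk : b - a using Nat.strong_induction_on generalizing a b with
  | _ k ih =>
    subst hk
    by_cases hb1 : b = a + 1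
    · subst hb1
      refine ⟨.leaf, rfl, ?_⟩
      rintro c d ⟨rfl, rfl⟩
      exact h
    · have hs : finInterval n a (a + 1) ∈ T.sides :=
        T.mem_sides_of_interval ha (by omega) (by omega) fun c d _ _ _ _ => by omega
      classical
      let p : ℕ → Prop := fun m => a < m ∧ m < b ∧ finInterval n a m ∈ T.sides
      have hp : p (Nat.findGreatest p b) :=
        Nat.findGreatest_spec (P := p) (m := a + 1) (by omega) ⟨by omega, by omega, hs⟩
      have hmax : ∀ d, p d → d ≤ Nat.findGreatest p b := fun d hd =>
        Nat.le_findGreatest hd.2.1.le hd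
      generalize Nat.findGreatest p b = m at hp hmax
      obtain ⟨h1, h2, h3⟩ := hp
      -- A side which crossed [m, b) while compatible with [a, m) and [a, b) would start at a and
      -- end strictly between m and b, against the choice of m.
      have hr : finInterval n m b ∈ T.sides := by
        refine T.mem_sides_of_interval (by omega) h2 hb fun c d hc hcd hd hB => ?_
        have c1 := (T.compat _ h _ hB).interval_cases (by omega) ha hab hb hc hcd hd
        have c2 := (T.compat _ h3 _ hB).interval_cases (by omega) ha h1 (by omega) hc hcd hd
        by_cases hca : c = a
        · subst hca
          by_cases hdm : m < d ∧ d < b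
          · have := hmax d ⟨by omega, hdm.2, hB⟩
            omega
          · omega
        · omega
      obtain ⟨t, ht, hpt⟩ := ih (m - a) (by omega) ha h1 (by omega) h3 rfl
      obtain ⟨t', ht', hpt'⟩ := ih (b - m) (by omega) (by omega) h2 hb hr rfl
      refine ⟨t.node t', by rw [BinTree.leaves]; omega, ?_⟩
      rintro c d (⟨rfl, rfl⟩ | hcd | hcd)
      · rwa [show c + (t.leaves + t'.leaves) = b by omega]
      · exact hpt c d hcd
      · rw [ht] at hcd
        exact hpt' c d hcd

/-- Plant the root on the edge of the leaf 0 and rebuild the rooted tree on the other leaves.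
Degrees 0 and 1 have no bipartition into nonempty parts. -/
theorem _root_.Paren.toPlT_surjective (n : ℕ) : Function.Surjective (Paren.toPlT (n := n)) := by
  intro T
  match n, T with
  | 0, T =>
    exact ⟨⟨none, rfl⟩, PlT.eq_of_sides_subset fun A hA => by
      obtain ⟨x, -⟩ := hA.1; exact x.elim0⟩
  | 1, T =>
    refine ⟨⟨some .leaf, rfl⟩, PlT.eq_of_sides_subset fun A hA => ?_⟩
    obtain ⟨x, hx⟩ := hA.1
    obtain ⟨y, hy⟩ := hA.2.1
    exact absurd hx (Subsingleton.elim x y ▸ hy)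
  | n + 2, T =>
    have hs : finInterval (n + 2) 1 (n + 2) ∈ T.sides :=
      T.mem_sides_of_interval le_rfl (by omega) le_rfl fun c d _ _ _ _ => by omega
    obtain ⟨t, ht, hpt⟩ := T.exists_subtree le_rfl (by omega) le_rfl hs
    refine ⟨⟨some (BinTree.leaf.node t), ht⟩, Paren.toPlT_eq_of_forall (BinTree.leaf.node t) ht T ?_⟩
    rintro a b (⟨rfl, rfl⟩ | ⟨rfl, rfl⟩ | hp) h1 h2
    · obtain ⟨x, hx⟩ := h2
      have h3 : 1 + t.leaves = n + 2 := ht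
      exact absurd ⟨Nat.zero_le _, by have := x.2; simp only [BinTree.leaves]; omega⟩ hx
    · have := T.compl_mem _ hs
      convert this using 1
      ext x
      have := x.2
      simp only [finInterval, Set.mem_compl_iff, Set.mem_ofPred_eq]
      omega
    · exact hpt a b hp

end PlT

end PlanarTrees

/-! ### Decomposition of the half-twist in braid groups. -/

section HalfTwistWords

variable {G : Type*} [Group G] {s : ℕ → G}

theorem downWord_add (s : ℕ → G) (n m : ℕ) :
    downWord s (n + m) = downWord (fun j => s (n + j)) m * downWord s n := by
  induction m with
  | zero => rw [add_zero, downWord_zero, one_mul]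
  | succ m ih => rw [← add_assoc, downWord_succ, ih, downWord_succ, mul_assoc]

theorem crossWord_one_left (s : ℕ → G) (m : ℕ) : crossWord s 1 m = downWord s m := by
  rw [crossWord_succ, crossWord_zero, one_mul]
  simp only [zero_add]

theorem crossWord_one_right (s : ℕ → G) (n : ℕ) : crossWord s n 1 = upWord s n := by
  induction n with
  | zero => rfl
  | succ n ih =>
    rw [crossWord_succ, upWord_succ, ih, downWord_succ, downWord_zero, mul_one, add_zero]

namespace ArtinRels

theorem commute_downWord (h : ∀ N, ArtinRels s N) {i j m : ℕ}
    (hj : j + 1 < i ∨ i + m < j) : Commute (s j) (downWord (fun k => s (i + k)) m) := by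
  induction m with
  | zero => exact Commute.one_right _
  | succ m ih =>
    rw [downWord_succ]
    refine Commute.mul_right ?_ (ih (by omega))
    rcases hj with hj | hj
    · exact (h (i + m + 1)).comm j (i + m) (by omega) (by omega)
    · exact ((h (j + 1)).comm (i + m) j (by omega) (by omega)).symm

theorem downWord_mul_downWord (h : ∀ N, ArtinRels s N) (i m : ℕ) :
    downWord (fun k => s (i + k)) m * downWord (fun k => s (i + 1 + k)) m * s i =
      s (m + i) * (downWord (fun k => s (i + k)) m * downWord (fun k => s (i + 1 + k)) m) := by
  induction m with
  | zero => simp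
  | succ m ih =>
    have c := commute_downWord h (i := i) (j := i + 1 + m) (m := m) (by omega)
    have b := (h (i + m + 2)).braid (i + m) (by omega)
    have e : i + 1 + m = i + m + 1 := by omega
    have e' : m + 1 + i = i + m + 1 := by omega
    rw [add_comm m i] at ih
    rw [downWord_succ, downWord_succ, e']
    rw [e] at c ⊢
    set D := downWord (fun k => s (i + k)) m
    set D' := downWord (fun k => s (i + 1 + k)) m
    calc s (i + m) * D * (s (i + m + 1) * D') * s i
        = s (i + m) * (D * s (i + m + 1)) * D' * s i := by simp only [mul_assoc]
      _ = s (i + m) * s (i + m + 1) * (D * D' * s i) := by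
          rw [← c.eq]; simp only [mul_assoc]
      _ = s (i + m) * s (i + m + 1) * s (i + m) * (D * D') := by rw [ih]; simp only [mul_assoc]
      _ = s (i + m + 1) * s (i + m) * (s (i + m + 1) * D) * D' := by
          rw [b]; simp only [mul_assoc]
      _ = _ := by rw [c.eq]; simp only [mul_assoc]

/-- A crossing inside the first block slides through the block crossing. Only the two strands which
it involves matter, and these are treated by `downWord_mul_downWord`. -/
theorem crossWord_mul (h : ∀ N, ArtinRels s N) {n m i : ℕ} (hi : i + 1 < n) :
    crossWord s n m * s i = s (m + i) * crossWord s n m := by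
  have key : ∀ k, k ≤ i → Commute (s (m + i)) (crossWord s k m) := by
    intro k hk
    induction k with
    | zero => exact Commute.one_right _
    | succ k ih =>
      rw [crossWord_succ]
      exact (ih (by omega)).mul_right (commute_downWord h (by omega))
  induction n with
  | zero => omega
  | succ n ih =>
    rw [crossWord_succ]
    by_cases hn : i + 1 < n
    · rw [mul_assoc, ← (commute_downWord h (i := n) (j := i) (m := m) (by omega)).eq, ← mul_assoc,
        ih hn, mul_assoc]
    · obtain rfl : n = i + 1 := by omega
      rw [crossWord_succ, mul_assoc, mul_assoc, ← mul_assoc (downWord _ m) (downWord _ m),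
        downWord_mul_downWord h, ← mul_assoc, ← (key i le_rfl).eq, mul_assoc, mul_assoc]

theorem crossWord_mul_downWord (h : ∀ N, ArtinRels s N) (n m : ℕ) :
    crossWord s (n + 1) m * downWord s n =
      downWord (fun j => s (m + j)) n * crossWord s (n + 1) m := by
  have key : ∀ k, k ≤ n → crossWord s (n + 1) m * downWord s k =
      downWord (fun j => s (m + j)) k * crossWord s (n + 1) m := by
    intro k hk
    induction k with
    | zero => rw [downWord_zero, downWord_zero, mul_one, one_mul]
    | succ k ih =>
      rw [downWord_succ, downWord_succ, ← mul_assoc, crossWord_mul h (by omega), mul_assoc,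
        ih (by omega), mul_assoc]
  exact key n le_rfl

/-- A half-twist of two blocks is the crossing of the blocks followed by the half-twist of each.
Adding a strand to the first block, its descending word splits into a crossing with the other block
and a word inside the first block, which slides through the block crossing. -/
theorem halfWord_add (h : ∀ N, ArtinRels s N) (n m : ℕ) :
    halfWord s (n + m + 1) = halfWord s m * halfWord (fun j => s (m + 1 + j)) n *
      crossWord s (n + 1) (m + 1) := by
  induction n with
  | zero => rw [zero_add, halfWord_succ, halfWord_zero, mul_one, crossWord_one_left]
  | succ n ih =>
    have h1 := downWord_add s (n + 1) (m + 1)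
    have h2 := crossWord_mul_downWord h (n + 1) (m + 1)
    rw [crossWord_succ s (n + 1)] at h2
    rw [show n + 1 + m + 1 = (n + m + 1) + 1 by omega, halfWord_succ, ih,
      show n + m + 1 + 1 = n + 1 + (m + 1) by omega, h1, halfWord_succ,
      crossWord_succ s (n + 1)]
    simp only [mul_assoc] at h2 ⊢
    rw [h2]

end ArtinRels

end HalfTwistWords

/-! ### The image of the half-twist. -/

section HalfTwist

variable {K : Type u} [CommRing K] [Algebra ℚ K]

open SemidirectProduct

/-- A block summed against itself counts every unordered pair twice. Halving the parameter
compensates for this. -/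
theorem expHalf_double {L : Type u} [LieRing L] [LieAlgebra K L] (μ : K) (x : L) :
    expHalf (algebraMap ℚ K (1 / 2) * μ) (x + x) = expHalf μ x := by
  have e : algebraMap ℚ K (1 / 2) + algebraMap ℚ K (1 / 2) = 1 := by
    rw [← map_add]; norm_num
  rw [expHalf, expHalf]
  congr 1
  rw [smul_add, ← add_smul, ← add_mul, e, one_mul]

/-- The permutation of `ℕ` which reverses the first `n` integers. -/
noncomputable def natRevPerm (n : ℕ) : Equiv.Perm ℕ :=
  Equiv.Perm.viaEmbeddingHom Fin.valEmbedding (Fin.revPerm : Equiv.Perm (Fin n))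

theorem natRevPerm_apply (n x : ℕ) : natRevPerm n x = if x < n then n - 1 - x else x := by
  rw [natRevPerm, viaEmbedding_val]
  split_ifs with h
  · rw [Fin.revPerm_apply, Fin.val_rev]; dsimp only; omega
  · rfl

namespace Associator

variable (a : Associator K)

/-- The image of the half-twist. -/
noncomputable def halfTwist (n : ℕ) : DKGrp K ℕ :=
  inr (natRevPerm n) * inl (expHalf (algebraMap ℚ K (1 / 2) * a.μ)
    (DK.T K (Finset.Ico 0 n) (Finset.Ico 0 n)))

theorem halfTwist_one : a.halfTwist 1 = 1 := by
  have e : natRevPerm 1 = 1 := by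
    ext x
    rw [natRevPerm_apply]
    split_ifs <;> simp; omega
  have e' : DK.T K (Finset.Ico 0 1) (Finset.Ico 0 1) = 0 := by
    simp [DK.T, DK.t_self]
  rw [halfTwist, e, e', expHalf_zero, map_one, map_one, one_mul]

/-- The self-sum of the union is the two self-sums plus twice the mixed sum; these commute, and the
halved parameter turns the doubled mixed sum into the braiding. The permutations compose to the
reversal of all n + m indices. -/
theorem halfTwist_mul (n m : ℕ) :
    a.halfTwist m * DKGrp.shift K m (a.halfTwist n) * a.braid n m = a.halfTwist (n + m) := by
  set ν := algebraMap ℚ K (1 / 2) * a.μ with hν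
  set R := Equiv.Perm.viaEmbeddingHom (addLeftEmbedding m) (natRevPerm n) with hR
  have hs : DKGrp.shift K m (a.halfTwist n) = inr R *
      inl (expHalf ν (DK.T K (Finset.Ico m (m + n)) (Finset.Ico m (m + n)))) := by
    rw [halfTwist, DKGrp.shift, map_mul, DKGrp.map_inl, DKGrp.map_inr, map_expHalf,
      DK.map_T_shift, add_zero]
  have hRa : ∀ x, R x = if m ≤ x then (if x - m < n then m + (n - 1 - (x - m)) else x)
      else x := by
    intro x
    rw [hR, viaEmbedding_addLeft, natRevPerm_apply]
    split_ifs <;> omega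
  have e1 : (Finset.Ico 0 m).map R.toEmbedding = Finset.Ico 0 m :=
    Ico_map_embedding (fun x _ hx => by
      change R x + 0 = x + 0
      rw [hRa, if_neg (by omega)]) rfl
  have e2 : (Finset.Ico 0 n).map (natBlockPerm n m).toEmbedding = Finset.Ico m (m + n) :=
    Ico_map_embedding (fun x _ hx => by
      change natBlockPerm n m x + 0 = x + m
      rw [natBlockPerm_apply, if_pos hx]; omega) (by omega)
  have e3 : (Finset.Ico n (n + m)).map (natBlockPerm n m).toEmbedding = Finset.Ico 0 m :=
    Ico_map_embedding (fun x h hx => by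
      change natBlockPerm n m x + n = x + 0
      rw [natBlockPerm_apply, if_neg (by omega), if_pos hx]; omega) (by omega)
  have c1 := DKGrp.inr_mul_expHalf R ν (Finset.Ico 0 m) (Finset.Ico 0 m)
  have c2 := DKGrp.inr_mul_expHalf (natBlockPerm n m) ν (Finset.Ico 0 n) (Finset.Ico 0 n)
  have c3 := DKGrp.inr_mul_expHalf (natBlockPerm n m) ν (Finset.Ico n (n + m))
    (Finset.Ico n (n + m))
  rw [e1] at c1
  rw [e2] at c2
  rw [e3] at c3
  have hp : natRevPerm m * R * natBlockPerm n m = natRevPerm (n + m) := by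
    ext x
    rw [Equiv.Perm.mul_apply, Equiv.Perm.mul_apply, natRevPerm_apply, hRa, natBlockPerm_apply,
      natRevPerm_apply]
    split_ifs <;> omega
  have hT : DK.T K (Finset.Ico 0 (n + m)) (Finset.Ico 0 (n + m)) =
      DK.T K (Finset.Ico n (n + m)) (Finset.Ico n (n + m)) +
        DK.T K (Finset.Ico 0 n) (Finset.Ico 0 n) +
          (DK.T K (Finset.Ico 0 n) (Finset.Ico n (n + m)) +
            DK.T K (Finset.Ico 0 n) (Finset.Ico n (n + m))) := by
    rw [DK.T_Ico_left K (Nat.zero_le n) (Nat.le_add_right n m),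
      DK.T_Ico_right K (Nat.zero_le n) (Nat.le_add_right n m),
      DK.T_Ico_right K (Nat.zero_le n) (Nat.le_add_right n m),
      DK.T_comm K (Finset.Ico 0 n) (Finset.Ico n (n + m))]
    abel
  have d : Disjoint (Finset.Ico 0 n) (Finset.Ico n (n + m)) := Ico_disjoint_Ico le_rfl
  have k1 := DK.T_self_T K d
  have k2 : ⁅DK.T K (Finset.Ico n (n + m)) (Finset.Ico n (n + m)),
      DK.T K (Finset.Ico 0 n) (Finset.Ico n (n + m))⁆ = 0 := by
    rw [DK.T_comm K (Finset.Ico n (n + m)) (Finset.Ico 0 n)]; exact DK.T_self_T K d.symm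
  have k3 := DK.T_T_disjoint K d.symm d.symm d.symm d.symm
  have hE : (inl (expHalf ν (DK.T K (Finset.Ico 0 (n + m)) (Finset.Ico 0 (n + m)))) :
      DKGrp K ℕ) = inl (expHalf ν (DK.T K (Finset.Ico n (n + m)) (Finset.Ico n (n + m)))) *
        inl (expHalf ν (DK.T K (Finset.Ico 0 n) (Finset.Ico 0 n))) *
          inl (expHalf a.μ (DK.T K (Finset.Ico 0 n) (Finset.Ico n (n + m)))) := by
    rw [hT, expHalf_add, expHalf_add _ k3, expHalf_double, map_mul, map_mul]
    rw [add_lie, lie_add, lie_add, k1, k2]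
    simp
  rw [hs, halfTwist, halfTwist, ← hν, hE, ← hp, map_mul, map_mul, braid]
  simp only [mul_assoc]
  rw [← mul_assoc (inl (expHalf ν (DK.T K (Finset.Ico 0 m) (Finset.Ico 0 m)))) (inr R), c1,
    ← mul_assoc (inl (expHalf ν (DK.T K (Finset.Ico m (m + n)) (Finset.Ico m (m + n)))))
      (inr (natBlockPerm n m)), c2]
  simp only [mul_assoc]
  rw [← mul_assoc (inl (expHalf ν (DK.T K (Finset.Ico 0 m) (Finset.Ico 0 m))))
    (inr (natBlockPerm n m)), c3]
  simp only [mul_assoc]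

theorem halfWord_gen_mem (n : ℕ) : halfWord a.gen n ∈ (GrpT.emb K (n + 1)).range := by
  have hd : ∀ m, downWord a.gen m ∈ (GrpT.emb K (m + 1)).range := by
    intro m
    induction m with
    | zero => exact one_mem _
    | succ m ih =>
      rw [downWord_succ]
      exact mul_mem (a.gen_mem m) (GrpT.range_mono (by omega) ih)
  induction n with
  | zero => exact one_mem _
  | succ n ih =>
    rw [halfWord_succ]
    exact mul_mem (GrpT.range_mono (by omega) ih) (hd _)

theorem comb_halfWord {n m M : ℕ} (h : m + 1 ≤ M) :
    a.comb n M * halfWord (fun j => a.gen (n + j)) m =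
      DKGrp.shift K n (halfWord a.gen m) * a.comb n M := by
  induction m with
  | zero => simp
  | succ m ih =>
    rw [halfWord_succ, halfWord_succ, ← mul_assoc, ih (by omega), mul_assoc,
      a.comb_downWord (by omega), map_mul, mul_assoc]

/-- Read from a tree to its mirror image, the half-twist contains no associator. At each node
`halfWord_add` splits it, `crossWord_gen` turns the crossing into the braiding, naturality moves the
subtrees across, and `halfTwist_mul` puts the pieces together. -/
theorem treeElt_op (t : BinTree) : a.treeElt t.op * halfWord a.gen (t.leaves - 1) =
    a.halfTwist t.leaves * a.treeElt t := by
  induction t with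
  | leaf =>
    change 1 * 1 = a.halfTwist 1 * 1
    rw [halfTwist_one]
  | node l r hl hr =>
    obtain ⟨n, hn⟩ : ∃ n, l.leaves = n + 1 := ⟨l.leaves - 1, by have := l.leaves_pos; omega⟩
    obtain ⟨m, hm⟩ : ∃ m, r.leaves = m + 1 := ⟨r.leaves - 1, by have := r.leaves_pos; omega⟩
    have ml := a.treeElt_mem l
    have mr := a.treeElt_mem r
    have mlo := a.treeElt_mem l.op
    rw [BinTree.leaves_op] at mlo
    rw [BinTree.op, treeElt_node, treeElt_node, BinTree.leaves_op, BinTree.leaves_op,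
      BinTree.leaves, ← halfTwist_mul]
    rw [hn] at hl ml mlo ⊢
    rw [hm] at hr mr ⊢
    rw [Nat.add_sub_cancel] at hl hr
    rw [show n + 1 + (m + 1) - 1 = n + m + 1 by omega, ArtinRels.halfWord_add a.gen_artinRels]
    have c1 := (a.comb_comm (m := n + 1) (a.halfWord_gen_mem m)).eq
    have c2 := a.comb_halfWord (n := m + 1) (M := n + 1) (m := n) le_rfl
    have c3 := a.crossWord_gen (n + 1) (m + 1)
    have c4 := commute_shift (a.halfWord_gen_mem m) (a.treeElt l.op)
    have c5 := commute_shift mr (a.halfTwist (n + 1))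
    have c6 := a.braid_emb (m := m + 1) ml
    have c7 := a.braid_shift (n := n + 1) mr
    have c8 := (commute_shift mr (a.treeElt l)).eq
    calc a.treeElt r.op * DKGrp.shift K (m + 1) (a.treeElt l.op) * a.comb (m + 1) (n + 1) *
          (halfWord a.gen m * halfWord (fun j => a.gen (m + 1 + j)) n *
            crossWord a.gen (n + 1) (m + 1))
        = a.treeElt r.op * DKGrp.shift K (m + 1) (a.treeElt l.op) *
          (a.comb (m + 1) (n + 1) * halfWord a.gen m) *
            (halfWord (fun j => a.gen (m + 1 + j)) n * crossWord a.gen (n + 1) (m + 1)) := by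
          simp only [mul_assoc]
      _ = a.treeElt r.op * (DKGrp.shift K (m + 1) (a.treeElt l.op) * halfWord a.gen m) *
          (a.comb (m + 1) (n + 1) * halfWord (fun j => a.gen (m + 1 + j)) n) *
            crossWord a.gen (n + 1) (m + 1) := by
          rw [← c1]; simp only [mul_assoc]
      _ = (a.treeElt r.op * halfWord a.gen m) * (DKGrp.shift K (m + 1) (a.treeElt l.op) *
          DKGrp.shift K (m + 1) (halfWord a.gen n)) *
            (a.comb (m + 1) (n + 1) * crossWord a.gen (n + 1) (m + 1)) := by
          rw [c2, ← c4.eq]; simp only [mul_assoc]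
      _ = a.halfTwist (m + 1) * (a.treeElt r * DKGrp.shift K (m + 1) (a.halfTwist (n + 1))) *
          DKGrp.shift K (m + 1) (a.treeElt l) * (a.braid (n + 1) (m + 1) *
            a.comb (n + 1) (m + 1)) := by
          rw [hr, ← map_mul, hl, c3, map_mul]; simp only [mul_assoc]
      _ = a.halfTwist (m + 1) * DKGrp.shift K (m + 1) (a.halfTwist (n + 1)) *
          (a.treeElt r * DKGrp.shift K (m + 1) (a.treeElt l)) * a.braid (n + 1) (m + 1) *
            a.comb (n + 1) (m + 1) := by
          rw [c5.eq]; simp only [mul_assoc]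
      _ = a.halfTwist (m + 1) * DKGrp.shift K (m + 1) (a.halfTwist (n + 1)) *
          (DKGrp.shift K (m + 1) (a.treeElt l) * (a.braid (n + 1) (m + 1) *
            DKGrp.shift K (n + 1) (a.treeElt r))) * a.comb (n + 1) (m + 1) := by
          rw [c8, c7]; simp only [mul_assoc]
      _ = _ := by
          rw [← mul_assoc (DKGrp.shift K (m + 1) _) (a.braid _ _), ← c6]
          simp only [mul_assoc]

end Associator

end HalfTwist

/-! ### Vanishing of exponents in p_n. -/

section SphereQuotient

variable (K : Type u) [CommRing K]

theorem LieP.sum_t {n : ℕ} (i : Fin n) : ∑ j, LieP.t K i j = 0 := by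
  have h := LiePres.mk_eq_zero K _ (PRel.sum (K := K) i)
  rw [map_sum] at h
  rw [← Finset.add_sum_erase _ _ (Finset.mem_univ i), LieP.t, freeT, dif_neg (by simp), map_zero,
    zero_add]
  exact h

/-- The morphism onto `p_n` which kills the `t_ij` such that `i` or `j` is out of range. -/
noncomputable def DK.toLieP (n : ℕ) : DK K ℕ →ₗ⁅K⁆ LieP K n :=
  (LieT.toP K n).comp (DK.toLieT K n)

variable {K}

/-- Each inner sum is a defining relation of p_n, the diagonal term being zero. All the vanishing
statements used for the contraction come from here. -/
theorem DK.toLieP_T_Ico (n : ℕ) (I : Finset ℕ) :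
    DK.toLieP K n (DK.T K I (Finset.Ico 0 n)) = 0 := by
  have hself : ∀ i : Fin n, LieP.t K i i = 0 := fun i => by
    rw [LieP.t, freeT, dif_neg (by simp), map_zero]
  rw [DK.T, map_sum]
  refine Finset.sum_eq_zero fun i _ => ?_
  rw [map_sum, ← Finset.range_eq_Ico, Finset.sum_range]
  by_cases hi : i < n
  · rw [← LieP.sum_t K ⟨i, hi⟩]
    refine Finset.sum_congr rfl fun j _ => ?_
    rw [DK.toLieP, LieHom.comp_apply, DK.toLieT_t, LieT.natT_of_lt K hi j.2]
    by_cases h : (⟨i, hi⟩ : Fin n) = j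
    · rw [← h, LieT.t_self, map_zero, hself]
    · exact LieT.toP_t K h
  · refine Finset.sum_eq_zero fun j _ => ?_
    rw [DK.toLieP, LieHom.comp_apply, DK.toLieT_t, LieT.natT_of_not K (by omega), map_zero]

theorem DK.toLieP_T_single_left (n : ℕ) : DK.toLieP K (1 + n)
    (DK.T K (Finset.Ico 0 1) (Finset.Ico 1 (1 + n))) = 0 := by
  have h := DK.toLieP_T_Ico (K := K) (1 + n) (Finset.Ico 0 1)
  rw [DK.T_Ico_right K (Nat.zero_le 1) (by omega), map_add] at h
  have e : DK.T K (Finset.Ico 0 1) (Finset.Ico 0 1) = 0 := by simp [DK.T, DK.t_self]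
  rwa [e, map_zero, zero_add] at h

theorem DK.toLieP_T_single_right (n : ℕ) : DK.toLieP K (n + 1)
    (DK.T K (Finset.Ico 0 n) (Finset.Ico n (n + 1))) = 0 := by
  have h := DK.toLieP_T_Ico (K := K) (n + 1) (Finset.Ico n (n + 1))
  rw [DK.T_Ico_right K (Nat.zero_le n) (by omega), map_add] at h
  have e : DK.T K (Finset.Ico n (n + 1)) (Finset.Ico n (n + 1)) = 0 := by
    rw [Nat.Ico_succ_singleton]; simp [DK.T, DK.t_self]
  rwa [e, map_zero, add_zero, DK.T_comm] at h

/-- When I, J, M exhaust the indices, t_JM = -t_JI - t_JJ in p_n, and both terms commute with t_IJ.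
-/
theorem DK.toLieP_lie (n m p : ℕ) : ⁅DK.toLieP K (n + m + p)
      (DK.T K (Finset.Ico 0 n) (Finset.Ico n (n + m))), DK.toLieP K (n + m + p)
      (DK.T K (Finset.Ico n (n + m)) (Finset.Ico (n + m) (n + m + p)))⁆ = 0 := by
  have h := DK.toLieP_T_Ico (K := K) (n + m + p) (Finset.Ico n (n + m))
  rw [DK.T_Ico_right K (Nat.zero_le (n + m)) (by omega), DK.T_Ico_right K (Nat.zero_le n) (by omega),
    map_add, add_eq_zero_iff_neg_eq] at h
  have k : ⁅DK.T K (Finset.Ico n (n + m)) (Finset.Ico n (n + m)),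
      DK.T K (Finset.Ico n (n + m)) (Finset.Ico 0 n)⁆ = 0 :=
    DK.T_self_T K (Ico_disjoint_Ico le_rfl).symm
  rw [← h, DK.T_comm K (Finset.Ico n (n + m)), lie_neg, map_add, lie_add, lie_self, zero_add,
    ← LieHom.map_lie, ← lie_skew, k]
  simp

variable [Algebra ℚ K]

open SemidirectProduct

/-- An element of `exp(t_n^) ⋊ S_n` is mapped to a permutation in `exp(p_n^) ⋊ S_n` if its
component in `exp(t_n^)` is killed. -/
theorem GrpT.toGrpP_eq_inr {n : ℕ} (y : GrpT K n) {σ : Equiv.Perm ℕ} {x : expGroup K (DK K ℕ)}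
    (h : emb K n y = inr σ * inl x) (hx : expGroup.map K (DK.toLieP K n) x = 1) :
    toGrpP K n y = inr y.right := by
  have hσ : Equiv.Perm.viaEmbeddingHom Fin.valEmbedding y.right = σ := by
    rw [← emb_right, h]; simp
  have h' : emb K n ((inr y.right)⁻¹ * y) = inl x := by
    rw [map_mul, map_inv, emb_inr, hσ, h, inv_mul_cancel_left]
  have h1 : toGrpP K n ((inr y.right)⁻¹ * y) = 1 := by
    apply SemidirectProduct.ext
    · change expGroup.map K (LieT.toP K n) (((inr y.right)⁻¹ * y : GrpT K n).left) = 1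
      rw [left_eq, h', left_inl, expGroup.map_map]
      exact hx
    · change ((inr y.right)⁻¹ * y : GrpT K n).right = 1
      simp
  rw [map_mul, map_inv, inv_mul_eq_one] at h1
  rw [← h1]
  exact SemidirectProduct.map_inr ..

end SphereQuotient

/-! ### Morphisms which are identities up to equality of objects. -/

section EqToHoms

/-- The assertion that a morphism is an identity, up to an equality of objects. -/
def IsEqToHom {C : Type u} [Category.{v} C] {X Y : C} (f : X ⟶ Y) : Prop :=
  ∃ h : X = Y, f = eqToHom h

namespace IsEqToHom

variable {C : Type u} [Category.{v} C] {X Y Z : C}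

theorem comp {f : X ⟶ Y} {g : Y ⟶ Z} (hf : IsEqToHom f) (hg : IsEqToHom g) :
    IsEqToHom (f ≫ g) := by
  obtain ⟨h, rfl⟩ := hf
  obtain ⟨h', rfl⟩ := hg
  exact ⟨h.trans h', eqToHom_trans h h'⟩

theorem id (X : C) : IsEqToHom (𝟙 X) := ⟨rfl, rfl⟩

theorem eq_id {f : X ⟶ X} (hf : IsEqToHom f) : f = 𝟙 X := hf.2

theorem of_comp_eq_id {f : X ⟶ Y} {g : Y ⟶ X} (hg : IsEqToHom g) (h : f ≫ g = 𝟙 X) :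
    IsEqToHom f := by
  obtain ⟨rfl, rfl⟩ := hg
  rw [eqToHom_refl, Category.comp_id] at h
  exact ⟨rfl, h⟩

end IsEqToHom

theorem QuotCat.isEqToHom_proj {G : Type w} [Group G] {C : Type v} [Category.{u} C] [MulAction G C]
    (A : CatAction G C) (g : G) (X : C) : IsEqToHom ((QuotCat.proj A).map (A.i g X)) := by
  have key : ∀ (x y : A.QuotObj) (h : x = y), (CategoryTheory.Quotient.functor A.Rel).map
      (eqToHom (C := Paths A.QuotObj) h) = eqToHom (C := QuotCat A) h := by
    rintro x _ rfl
    exact CategoryTheory.Functor.map_id _ _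
  exact ⟨(A.cls_smul g X).symm, (CategoryTheory.Quotient.sound _ (CatAction.Rel.act g X)).trans
    (key _ _ _)⟩

end EqToHoms

/-! ### Braids which the composite functor sends to identities. -/

section SphereFunctor

open SemidirectProduct

theorem downWord_congr {G : Type*} [Group G] {s s' : ℕ → G} {N : ℕ} (h : ∀ i < N, s i = s' i) :
    downWord s N = downWord s' N := by
  induction N with
  | zero => rfl
  | succ N ih => rw [downWord_succ, downWord_succ, ih fun i hi => h i (by omega), h N (by omega)]

theorem halfWord_congr {G : Type*} [Group G] {s s' : ℕ → G} {N : ℕ} (h : ∀ i < N, s i = s' i) :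
    halfWord s N = halfWord s' N := by
  induction N with
  | zero => rfl
  | succ N ih =>
    rw [halfWord_succ, halfWord_succ, ih fun i hi => h i (by omega), downWord_congr h]

namespace DInf

theorem toPerm_r (n : ℕ) : toPerm n (.r 1) = finRotate n := zpow_one _

theorem toPerm_s (n : ℕ) : toPerm n (.sr 0) = Fin.revPerm := by
  change Fin.revPerm * finRotate n ^ (0 : ℤ) = _
  rw [zpow_zero, mul_one]

theorem toGamma_r (n : ℕ) : toGamma n (.r 1) = Gamma0.mk n (Braid.rho n) := zpow_one _

theorem toGamma_s (n : ℕ) : toGamma n (.sr 0) = Gamma0.mk n (Braid.half n) := by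
  change Gamma0.mk n (Braid.half n) * Gamma0.mk n (Braid.rho n) ^ (0 : ℤ) = _
  rw [zpow_zero, mul_one]

theorem closure_eq_top {H : Subgroup DInf} (hr : .r 1 ∈ H) (hs : .sr 0 ∈ H) (g : DInf) :
    g ∈ H := by
  have h : ∀ i : ℤ, (.r i : DInf) ∈ H := fun i => by
    have := zpow_mem hr i
    rwa [DihedralGroup.r_one_zpow] at this
  rcases g with i | i
  · exact h i
  · have := mul_mem hs (h i)
    rwa [DihedralGroup.sr_mul_r, zero_add] at this

end DInf

theorem PlT.smul_eq_of_toPerm {n : ℕ} {g : DInf} (h : DInf.toPerm n g = 1) (T : PlT n) :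
    g • T = T := by
  apply PlT.ext
  ext A
  change DInf.toPerm n g ⁻¹' A ∈ T.sides ↔ _
  rw [h]; exact Iff.rfl

theorem Paren.eq_of_le_one {n : ℕ} (hn : n ≤ 1) (t t' : Paren n) : t = t' := by
  have key : ∀ t : BinTree, t.leaves ≤ 1 → t = .leaf := by
    rintro (_ | ⟨l, r⟩) h
    · rfl
    · have := l.leaves_pos
      have := r.leaves_pos
      simp only [BinTree.leaves] at h; omega
  obtain ⟨_ | t, h⟩ := t <;> obtain ⟨_ | t', h'⟩ := t' <;>
    simp only [Option.elim_none, Option.elim_some] at h h'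
  · rfl
  · have := t'.leaves_pos; omega
  · have := t.leaves_pos; omega
  · obtain rfl := key t (by omega)
    obtain rfl := key t' (by omega)
    rfl

theorem BinTree.exists_rootEquiv_right (l r : BinTree) :
    ∃ l', RootEquiv (l.node r) (node l' .leaf) := by
  induction r generalizing l with
  | leaf => exact ⟨l, .refl _⟩
  | node b c hb hc =>
    obtain ⟨l', h⟩ := hc (l.node b)
    exact ⟨l', .trans _ _ _ (.symm _ _ (.rel _ _ (.mk l b c))) h⟩

variable {K : Type u} [CommRing K] [Algebra ℚ K] (a : Associator K) (S : Type v)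

/-- The permutation forces the labels of the target, so the morphism is exactly the structural
isomorphism of γ, which the quotient makes an identity. -/
theorem isEqToHom_contract_of_elt {n : ℕ} {T T' : PlT n} {s s' : Fin n → S} (γ : DInf)
    (hγ : γ • T = T') (g : LabCat.Hom (LabObj.mk n T s) (LabObj.mk n T' s') (pGroups K))
    (hg : g.elt = (inr (DInf.toPerm n γ) : GrpP K n)) :
    IsEqToHom ((QuotCat.proj (actDihGr K S)).map
      (X := LabObj.mk n T s) (Y := LabObj.mk n T' s') g) := by
  subst hγ
  have hs : s' = fun i => s ((DInf.toPerm n γ)⁻¹ i) := by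
    funext i
    have h := g.lab ((DInf.toPerm n γ)⁻¹ i)
    rw [hg] at h
    have e : (SemidirectProduct.rightHom (inr (DInf.toPerm n γ) : GrpP K n)) =
      DInf.toPerm n γ := by simp
    refine Eq.trans ?_ h
    change s' i = s' (SemidirectProduct.rightHom (inr (DInf.toPerm n γ) : GrpP K n) _)
    rw [e, perm_apply_inv]
  subst hs
  have := QuotCat.isEqToHom_proj (actDihGr K S) γ (LabObj.mk n T s)
  obtain rfl : g = (actDihGr K S).i γ (LabObj.mk n T s) := LabCat.Hom.ext hg
  exact this

namespace Associator

/-- The functor `PaB_S → PaDih_S^{gr}`. -/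
noncomputable def contract : PaB S ⥤ PaDihGr K S :=
  (a.strictFunctor S).toFunctor ⋙ contractionGr K S

variable {S}

theorem isEqToHom_contract {n : ℕ} {t t' : Paren n} {s s' : Fin n → S} (γ : DInf)
    (hγ : γ • t.toPlT = t'.toPlT)
    (f : LabCat.Hom (LabObj.mk n t s) (LabObj.mk n t' s') braidGroups)
    (hp : Braid.perm n f.elt = DInf.toPerm n γ) {σ : Equiv.Perm ℕ} {x : expGroup K (DK K ℕ)}
    (h : a.transport t t' f.elt = inr σ * inl x) (hx : expGroup.map K (DK.toLieP K n) x = 1) :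
    IsEqToHom ((a.contract S).map (X := LabObj.mk n t s) (Y := LabObj.mk n t' s') f) := by
  refine isEqToHom_contract_of_elt S γ hγ
    ((LabCat.functor (tToP K) (fun _ => Paren.toPlT) S).map (a.strictMap f)) ?_
  have h1 := GrpT.toGrpP_eq_inr (a.strictMap f).elt ((a.emb_strictMap f).trans h) hx
  refine h1.trans (congrArg _ ?_)
  refine Eq.trans ?_ hp
  have h2 := (GrpT.emb_right (a.strictMap f).elt).symm.trans
    ((congrArg SemidirectProduct.right (a.emb_strictMap f)).trans (a.transport_right t t' f.elt))
  exact Equiv.Perm.viaEmbeddingHom_injective _ h2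

theorem isEqToHom_symm {X Y : PaB S} {f : X ⟶ Y}
    (h : IsEqToHom ((a.contract S).map (show Y ⟶ X from LabCat.Hom.symm f))) :
    IsEqToHom ((a.contract S).map f) :=
  h.of_comp_eq_id (by rw [← Functor.map_comp, LabCat.comp_symm, CategoryTheory.Functor.map_id])

theorem isEqToHom_comp {X Y Z : PaB S} {f : X ⟶ Y} {g : Y ⟶ Z}
    (hf : IsEqToHom ((a.contract S).map f)) (hg : IsEqToHom ((a.contract S).map g)) :
    IsEqToHom ((a.contract S).map (f ≫ g)) := by
  rw [Functor.map_comp]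
  exact hf.comp hg

/-- The image is an associativity constraint on three blocks which exhaust the strands; its
arguments commute in p_n, so it is trivial there. -/
theorem isEqToHom_rootMove {l r q : BinTree} {X Y : PaB S} (f : X ⟶ Y)
    (hX : (LabObj.tree X).1 = some ((l.node r).node q))
    (hY : (LabObj.tree Y).1 = some (l.node (r.node q))) (hf : LabCat.Hom.elt f = 1) :
    IsEqToHom ((a.contract S).map f) := by
  rcases X with ⟨n, ⟨t, ht⟩, s⟩
  rcases Y with ⟨n', ⟨t', ht'⟩, s'⟩
  have hn : n = n' := LabCat.Hom.len f
  dsimp only at hX hY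
  subst hn hX hY
  have hn : l.leaves + r.leaves + q.leaves = n := ht
  subst hn
  refine a.isEqToHom_contract 1 ?_ f ?_ (σ := 1) (x := subst a.Φ
    (DK.T K (Finset.Ico 0 l.leaves) (Finset.Ico l.leaves (l.leaves + r.leaves)))
    (DK.T K (Finset.Ico l.leaves (l.leaves + r.leaves))
      (Finset.Ico (l.leaves + r.leaves) (l.leaves + r.leaves + q.leaves)))) ?_ ?_
  rotate_left 2
  · rw [hf, map_one, one_mul]
    exact a.transport_assoc (⟨some l, rfl⟩ : Paren l.leaves) (⟨some r, rfl⟩ : Paren r.leaves)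
      (⟨some q, rfl⟩ : Paren q.leaves)
  · rw [map_subst]
    exact a.subst_of_commute (DK.toLieP_lie _ _ _)
  · rw [one_smul]
    exact (BinTree.RootMove.mk l r q).toPlT_eq _ _
  · rw [hf, map_one]
    exact map_one _

theorem isEqToHom_of_target {X Y : PaB S} (f : X ⟶ Y) (h : (LabObj.tree X).1 = (LabObj.tree Y).1)
    (hf : LabCat.Hom.elt f = 1) : IsEqToHom ((a.contract S).map f) := by
  obtain rfl : X = Y := LabCat.target_eq (P := braidGroups) (𝟙 X) f hf.symm h
  obtain rfl : f = 𝟙 X := LabCat.Hom.ext hf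
  rw [CategoryTheory.Functor.map_id]
  exact .id _

theorem isEqToHom_rootEquiv {t t' : BinTree} (h : BinTree.RootEquiv t t') {X Y : PaB S} (f : X ⟶ Y)
    (hX : (LabObj.tree X).1 = some t) (hY : (LabObj.tree Y).1 = some t')
    (hf : LabCat.Hom.elt f = 1) : IsEqToHom ((a.contract S).map f) := by
  induction h generalizing X Y with
  | rel t t' h =>
    obtain ⟨l, r, q⟩ := h
    exact a.isEqToHom_rootMove f hX hY hf
  | refl t => exact a.isEqToHom_of_target f (hX.trans hY.symm) hf
  | symm t t' _ ih =>
    refine a.isEqToHom_symm (ih _ hY hX ?_)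
    change braidGroups.cast (LabCat.Hom.len f) (LabCat.Hom.elt f)⁻¹ = 1
    rw [hf, inv_one, map_one]
  | trans t t' t'' h _ ih ih' =>
    have e : t'.leaves = LabObj.n X := by
      rw [← BinTree.RootEquiv.leaves_eq h, ← (LabObj.tree X).2, hX]; rfl
    let f' : LabCat.Hom X Y braidGroups := f
    let Y' : LabObj Paren S := ⟨LabObj.n X, ⟨some t', e⟩, LabObj.lab X⟩
    let g : LabCat.Hom X Y' braidGroups := ⟨rfl, 1, fun i => by rw [map_one]; rfl⟩
    let k : LabCat.Hom Y' Y braidGroups := ⟨f'.len, f'.elt, f'.lab⟩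
    have hf' : f = CategoryStruct.comp (obj := PaB S) g k :=
      LabCat.Hom.ext (mul_one (LabCat.Hom.elt f)).symm
    rw [hf']
    exact a.isEqToHom_comp (ih g hX rfl rfl) (ih' k rfl hY hf)

theorem isEqToHom_one {n : ℕ} {t t' : Paren n} {s s' : Fin n → S} (h : t.toPlT = t'.toPlT)
    (f : LabCat.Hom (LabObj.mk n t s) (LabObj.mk n t' s') braidGroups) (hf : f.elt = 1) :
    IsEqToHom ((a.contract S).map (X := LabObj.mk n t s) (Y := LabObj.mk n t' s') f) := by
  by_cases hn : n ≤ 1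
  · exact a.isEqToHom_of_target f (congrArg Subtype.val (Paren.eq_of_le_one hn t t')) hf
  · obtain ⟨_ | t, ht⟩ := t <;> obtain ⟨_ | t', ht'⟩ := t' <;>
      simp only [Option.elim_none, Option.elim_some] at ht ht'
    · omega
    · omega
    · omega
    · exact a.isEqToHom_rootEquiv (BinTree.rootEquiv_of_toPlT_eq ht ht' h) f rfl rfl hf

end Associator

/-- Any bracketing may serve at the intermediate stage; the intermediate labels are those imposed by
the permutation of `b`. -/
theorem LabCat.exists_factor {n : ℕ} {t t' : Paren n} {s s' : Fin n → S}
    (f : LabCat.Hom (LabObj.mk n t s) (LabObj.mk n t' s') braidGroups) (u : Paren n)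
    (b c : Braid n) (h : f.elt = c * b) : ∃ (s₁ : Fin n → S)
      (f₁ : LabCat.Hom (LabObj.mk n t s) (LabObj.mk n u s₁) braidGroups)
      (f₂ : LabCat.Hom (LabObj.mk n u s₁) (LabObj.mk n t' s') braidGroups),
      f₁.elt = b ∧ f₂.elt = c ∧ f = CategoryStruct.comp (obj := PaB S) f₁ f₂ := by
  refine ⟨fun i => s ((Braid.perm n b)⁻¹ i), ⟨rfl, b, fun i => ?_⟩, ⟨rfl, c, fun i => ?_⟩, rfl, rfl,
    LabCat.Hom.ext h⟩
  · exact congrArg s (perm_inv_apply _ i)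
  · have hl := f.lab ((Braid.perm n b)⁻¹ i)
    rw [h] at hl
    change s' (Braid.perm n (c * b) _) = _ at hl
    rw [map_mul, Equiv.Perm.mul_apply, perm_apply_inv] at hl
    exact hl

namespace Associator

/-- The pairs of an element of `D` and of a braid such that the braid is mapped to an identity
between words whose parenthesizations are related by the element of `D`. -/
noncomputable def stepSubgroup (n : ℕ) : Subgroup (DInf × Braid n) where
  carrier := {p | ∀ (t t' : Paren n) (s s' : Fin n → S)
    (f : LabCat.Hom (LabObj.mk n t s) (LabObj.mk n t' s') braidGroups),
    p.1 • t.toPlT = t'.toPlT → f.elt = p.2 →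
    IsEqToHom ((a.contract S).map (X := LabObj.mk n t s) (Y := LabObj.mk n t' s') f)}
  one_mem' t t' s s' f h hf := a.isEqToHom_one (by rw [← h]; exact (one_smul DInf _).symm) f hf
  mul_mem' {p q} hp hq := by
    intro t t' s s' f h hf
    -- Composable rooted trees are needed: the intermediate unrooted tree is given a root.
    obtain ⟨u, hu⟩ := Paren.toPlT_surjective n (q.1 • t.toPlT)
    obtain ⟨s₁, f₁, f₂, h₁, h₂, rfl⟩ := LabCat.exists_factor S f u q.2 p.2 hf
    refine a.isEqToHom_comp (hq _ _ _ _ f₁ hu.symm h₁) (hp _ _ _ _ f₂ ?_ h₂)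
    rw [hu, ← h]
    exact (mul_smul p.1 q.1 _).symm
  inv_mem' {p} hp := by
    intro t t' s s' f h hf
    refine a.isEqToHom_symm (hp _ _ _ _ (LabCat.Hom.symm f) ?_ ?_)
    · rw [← h]
      exact smul_inv_smul p.1 _
    · change f.elt⁻¹ = p.2
      rw [hf]
      exact inv_inv p.2

theorem mem_stepSubgroup_of_le_one {n : ℕ} (hn : n ≤ 1) (γ : DInf) :
    (γ, 1) ∈ a.stepSubgroup S n := by
  intro t t' s s' f _ hf
  obtain rfl := Paren.eq_of_le_one hn t t'
  exact a.isEqToHom_one rfl f hf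

/-- Since trivial braids between rootings of the same tree become identities, it is enough to treat
one convenient rooting of the source and one of the target. -/
theorem mem_stepSubgroup_of_exists {n : ℕ} (γ : DInf) (b : Braid n)
    (hp : Braid.perm n b = DInf.toPerm n γ)
    (H : ∀ t : Paren n, ∃ u v : Paren n, u.toPlT = t.toPlT ∧ γ • u.toPlT = v.toPlT ∧
      ∃ σ x, a.transport u v b = inr σ * inl x ∧ expGroup.map K (DK.toLieP K n) x = 1) :
    (γ, b) ∈ a.stepSubgroup S n := by
  intro t t' s s' f h hf
  obtain ⟨u, v, hu, hv, σ, x, hx, hx'⟩ := H t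
  obtain ⟨s₁, f₁, f₂, h₁, h₂, rfl⟩ := LabCat.exists_factor S f u 1 b (hf.trans (mul_one b).symm)
  obtain ⟨s₂, f₃, f₄, h₃, h₄, rfl⟩ := LabCat.exists_factor S f₂ v b 1 (h₂.trans (one_mul b).symm)
  refine a.isEqToHom_comp (a.isEqToHom_one hu.symm f₁ h₁) (a.isEqToHom_comp
    (a.isEqToHom_contract γ hv f₃ ((congrArg (Braid.perm n) h₃).trans hp) (h₃ ▸ hx) hx')
    (a.isEqToHom_one ?_ f₄ h₄))
  rw [← hv, hu]
  exact h

end Associator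

end SphereFunctor

/-! ### The dihedral generators and the relators of Γ_{0,n}. -/

section DihedralSteps

open SemidirectProduct

theorem Gamma0.mk_eq_one_of_mem {n : ℕ} {b : Braid n}
    (h : b ∈ ({Braid.rho n ^ n, Braid.sphere n} : Set (Braid n))) : mk n b = 1 :=
  (QuotientGroup.eq_one_iff _).2 (Subgroup.subset_normalClosure h)

variable {K : Type u} [CommRing K] [Algebra ℚ K] (a : Associator K) {S : Type v}

theorem Paren.exists_node {n : ℕ} (hn : 2 ≤ n) (t : Paren n) :
    ∃ (l r : BinTree) (h : (l.node r).leaves = n), t = ⟨some (l.node r), h⟩ := by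
  obtain ⟨_ | _ | ⟨l, r⟩, h⟩ := t
  · simp only [Option.elim_none] at h; omega
  · simp only [Option.elim_some, BinTree.leaves] at h; omega
  · exact ⟨l, r, h, rfl⟩

namespace Associator

/-- With the root beside the last leaf, this braid is the braiding of the other strands with the
last one, and its exponent is a relation of p_n. -/
theorem rho_mem (n : ℕ) : (.r 1, Braid.rho n) ∈ a.stepSubgroup S n := by
  by_cases hn : n ≤ 1
  · have h : ∀ N, N = 0 → upWord (Braid.σ n) N = 1 := by rintro _ rfl; exact upWord_zero _
    rw [Braid.rho, h _ (by omega)]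
    exact a.mem_stepSubgroup_of_le_one S hn _
  · refine a.mem_stepSubgroup_of_exists S _ _ (by rw [Braid.perm_rho, DInf.toPerm_r]) fun t => ?_
    obtain ⟨l, r, h, rfl⟩ := Paren.exists_node (by omega) t
    obtain ⟨q, hq⟩ := BinTree.exists_rootEquiv_right l r
    have hu := hq.leaves_eq.symm.trans h
    have hv : (BinTree.leaf.node q).leaves = n := by
      rw [← hu, BinTree.leaves, BinTree.leaves, Nat.add_comm]; rfl
    refine ⟨⟨some (q.node .leaf), hu⟩, ⟨some (BinTree.leaf.node q), hv⟩, (hq.toPlT_eq h hu).symm,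
      PlT.r_smul_toPlT q hu hv, natBlockPerm q.leaves 1, expHalf a.μ
        (DK.T K (Finset.Ico 0 q.leaves) (Finset.Ico q.leaves (q.leaves + 1))), ?_, ?_⟩
    · have e : q.leaves + 1 = n := hu
      subst e
      have e : Braid.rho (q.leaves + 1) = Braid.cross q.leaves 1 := by
        rw [Braid.rho, Braid.cross, crossWord_one_right]
        exact congrArg _ (Nat.add_sub_cancel _ _)
      rw [e]
      exact a.transport_cross (⟨some q, rfl⟩ : Paren q.leaves) (⟨some .leaf, rfl⟩ : Paren 1)
    · have e : q.leaves + 1 = n := hu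
      subst e
      rw [map_expHalf, DK.toLieP_T_single_right, expHalf_zero]

/-- With the root beside the first leaf, this braid is the braiding of the first strand with the
others. It is the second half of the sphere relator. -/
theorem downWord_mem (n : ℕ) :
    ((.r 1 : DInf)⁻¹, downWord (Braid.σ n) (n - 1)) ∈ a.stepSubgroup S n := by
  by_cases hn : n ≤ 1
  · have h : ∀ N, N = 0 → downWord (Braid.σ n) N = 1 := by rintro _ rfl; exact downWord_zero _
    rw [h _ (by omega)]
    exact a.mem_stepSubgroup_of_le_one S hn _
  · have hp : Braid.perm n (downWord (Braid.σ n) (n - 1)) = DInf.toPerm n (.r 1)⁻¹ := by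
      have := Braid.perm_sphere n
      rw [Braid.sphere, map_mul] at this
      rw [map_inv, DInf.toPerm_r, ← Braid.perm_rho]
      exact eq_inv_of_mul_eq_one_right this
    refine a.mem_stepSubgroup_of_exists S _ _ hp fun t => ?_
    obtain ⟨l, r, h, rfl⟩ := Paren.exists_node (by omega) t
    obtain ⟨q, hq⟩ := BinTree.exists_rootEquiv l r
    have hu := hq.leaves_eq.symm.trans h
    have hv : (q.node .leaf).leaves = n := by
      rw [← hu, BinTree.leaves, BinTree.leaves, Nat.add_comm]; rfl
    refine ⟨⟨some (BinTree.leaf.node q), hu⟩, ⟨some (q.node .leaf), hv⟩, (hq.toPlT_eq h hu).symm,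
      ?_, natBlockPerm 1 q.leaves, expHalf a.μ
        (DK.T K (Finset.Ico 0 1) (Finset.Ico 1 (1 + q.leaves))), ?_, ?_⟩
    · rw [inv_smul_eq_iff]
      exact (PlT.r_smul_toPlT q hv hu).symm
    · have e : 1 + q.leaves = n := hu
      subst e
      have e : downWord (Braid.σ (1 + q.leaves)) (1 + q.leaves - 1) = Braid.cross 1 q.leaves := by
        rw [Braid.cross, crossWord_one_left]
        exact congrArg _ (Nat.add_sub_cancel_left _ _)
      rw [e]
      exact a.transport_cross (⟨some .leaf, rfl⟩ : Paren 1) (⟨some q, rfl⟩ : Paren q.leaves)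
    · have e : 1 + q.leaves = n := hu
      subst e
      rw [map_expHalf, DK.toLieP_T_single_left, expHalf_zero]

/-- From a tree to its mirror image the half-twist is a permutation times the exponential of a
multiple of the sum of all the t_ij, by `treeElt_op`. -/
theorem half_mem (n : ℕ) : (.sr 0, Braid.half n) ∈ a.stepSubgroup S n := by
  refine a.mem_stepSubgroup_of_exists S _ _ (by rw [Braid.perm_half, DInf.toPerm_s]) fun t => ?_
  obtain ⟨_ | t, h⟩ := t
  · simp only [Option.elim_none] at h
    subst h
    refine ⟨_, ⟨none, rfl⟩, rfl, ?_, 1, 1, ?_, map_one _⟩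
    · exact PlT.eq_of_sides_subset fun A hA => by obtain ⟨x, -⟩ := PlT.nonempty _ A hA; exact x.elim0
    · rw [map_one, map_one, mul_one]
      exact a.transport_self_one ⟨none, rfl⟩
  · simp only [Option.elim_some] at h
    subst h
    refine ⟨_, ⟨some t.op, t.leaves_op⟩, rfl, PlT.s_smul_toPlT t rfl t.leaves_op,
      natRevPerm t.leaves, expHalf (algebraMap ℚ K (1 / 2) * a.μ)
        (DK.T K (Finset.Ico 0 t.leaves) (Finset.Ico 0 t.leaves)), ?_, ?_⟩
    · change a.treeElt t.op * a.rep t.leaves (Braid.half t.leaves) * (a.treeElt t)⁻¹ =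
        a.halfTwist t.leaves
      rw [mul_inv_eq_iff_eq_mul, ← treeElt_op, Braid.half, map_halfWord,
        halfWord_congr fun i hi => a.rep_σ hi]
    · rw [map_expHalf, DK.toLieP_T_Ico, expHalf_zero]

/-- The braids of trivial permutation which are mapped to identities. -/
noncomputable def trivialSubgroup (S : Type v) (n : ℕ) : Subgroup (Braid n) :=
  (Braid.perm n).ker ⊓ (a.stepSubgroup S n).comap (MonoidHom.inr DInf (Braid n))

/-- A conjugate c b c⁻¹ is factored with b as an endomorphism of the middle object, which is
possible because its permutation is trivial. Its image is an honest identity there, so it can be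
deleted, and c⁻¹ and c then compose to a trivial braid. -/
instance (n : ℕ) : (a.trivialSubgroup S n).Normal where
  conj_mem b hb c := by
    refine ⟨(inferInstance : (Braid.perm n).ker.Normal).conj_mem b hb.1 c, ?_⟩
    intro t t' s s' f h hf
    have hb1 : Braid.perm n b = 1 := hb.1
    have hb2 : (1, b) ∈ a.stepSubgroup S n := hb.2
    obtain ⟨s₁, f₁, f₂, h₁, h₂, rfl⟩ := LabCat.exists_factor S f t c⁻¹ (c * b) hf
    obtain ⟨s₂, f₃, f₄, h₃, h₄, rfl⟩ := LabCat.exists_factor S f₂ t b c h₂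
    have hs : s₁ = s₂ := by
      funext i
      have := f₃.lab i
      rw [h₃] at this
      change s₂ (Braid.perm n b i) = s₁ i at this
      rw [hb1] at this
      exact this.symm
    subst hs
    have h5 := (hb2 t t s₁ s₁ f₃ (one_smul DInf _) h₃).eq_id
    have h6 := a.isEqToHom_one (t := t) (t' := t') (by rw [← h]; exact (one_smul DInf _).symm)
      (CategoryStruct.comp (obj := PaB S) f₁ f₄)
      ((congrArg₂ (fun x y : Braid n => x * y) h₄ h₁).trans (mul_inv_cancel c))
    have h7 : (a.contract S).map (CategoryStruct.comp (obj := PaB S) f₁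
        (CategoryStruct.comp (obj := PaB S) f₃ f₄)) =
        (a.contract S).map (CategoryStruct.comp (obj := PaB S) f₁ f₄) :=
      (Functor.map_comp _ _ _).trans ((congrArg _ ((Functor.map_comp _ _ _).trans
        ((congrArg (fun x => x ≫ _) h5).trans (Category.id_comp _)))).trans
          (Functor.map_comp _ _ _).symm)
    exact (congrArg IsEqToHom h7).mpr h6

theorem mem_trivialSubgroup_of_mk {n : ℕ} {b : Braid n} (h : Gamma0.mk n b = 1) :
    b ∈ a.trivialSubgroup S n := by
  have hle : Subgroup.normalClosure ({Braid.rho n ^ n, Braid.sphere n} : Set (Braid n)) ≤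
      a.trivialSubgroup S n := by
    refine Subgroup.normalClosure_le_normal fun b hb => ⟨?_, ?_⟩
    · have := congrArg (Gamma0.perm n) (Gamma0.mk_eq_one_of_mem hb)
      rwa [Gamma0.perm_mk, map_one] at this
    · rcases hb with rfl | rfl
      · have h1 := pow_mem (a.rho_mem (S := S) n) n
        intro t t' s s' f h hf
        -- The power comes paired with r^n rather than with 1, but r^n has trivial permutation and
        -- so acts trivially on trees with n leaves.
        refine h1 t t' s s' f (Eq.trans ?_ h) hf
        refine (PlT.smul_eq_of_toPerm ?_ _).trans (one_smul DInf _).symm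
        change DInf.toPerm n ((.r 1) ^ n) = 1
        rw [← DInf.perm_toGamma, map_pow, DInf.toGamma_r, ← map_pow,
          Gamma0.mk_eq_one_of_mem (by simp), map_one]
      · have h1 := mul_mem (a.rho_mem (S := S) n) (a.downWord_mem (S := S) n)
        rw [Prod.mk_mul_mk, mul_inv_cancel] at h1
        exact h1
  exact hle ((QuotientGroup.eq_one_iff b).1 h)

/-- The braids which lift the image of an element of `D` are mapped to identities. -/
theorem mem_stepSubgroup_of_mk {n : ℕ} {γ : DInf} {b : Braid n}
    (h : Gamma0.mk n b = DInf.toGamma n γ) : (γ, b) ∈ a.stepSubgroup S n := by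
  -- The elements of D with at least one lift to a braid having the property form a subgroup
  -- containing r and s. Another lift differs from it by an element of the normal closure of the
  -- relators.
  let H : Subgroup DInf := ((a.stepSubgroup S n) ⊓ ((Gamma0.mk n).comp (MonoidHom.snd _ _)).eqLocus
    ((DInf.toGamma n).comp (MonoidHom.fst _ _))).map (MonoidHom.fst _ _)
  have hγ : γ ∈ H := DInf.closure_eq_top (H := H)
    (Subgroup.mem_map.2 ⟨(.r 1, Braid.rho n), ⟨a.rho_mem n, (DInf.toGamma_r n).symm⟩, rfl⟩)
    (Subgroup.mem_map.2 ⟨(.sr 0, Braid.half n), ⟨a.half_mem n, (DInf.toGamma_s n).symm⟩, rfl⟩) γ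
  obtain ⟨⟨_, c⟩, ⟨h1, h2⟩, rfl⟩ := hγ
  have h2 : Gamma0.mk n c = DInf.toGamma n _ := h2
  have h3 : (1, c⁻¹ * b) ∈ a.stepSubgroup S n :=
    (a.mem_trivialSubgroup_of_mk (by rw [map_mul, map_inv, h, h2]; exact inv_mul_cancel _)).2
  have h4 := mul_mem h1 h3
  rw [Prod.mk_mul_mk, mul_one, mul_inv_cancel_left] at h4
  exact h4

end Associator

end DihedralSteps

/-! ### Factorization through full functors and through quotient categories. -/

section Factorization

variable {A B D : Type*} [Category A] [Category B] [Category D]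

theorem CategoryTheory.Functor.eq_of_comp_eq_of_full {P : A ⥤ B} [P.Full]
    (hP : Function.Surjective P.obj) {G G' : B ⥤ D} (h : P ⋙ G = P ⋙ G') : G = G' := by
  refine Functor.hext (fun X => ?_) fun X Y f => ?_
  · obtain ⟨X, rfl⟩ := hP X
    exact Functor.congr_obj h X
  · obtain ⟨X, rfl⟩ := hP X
    obtain ⟨Y, rfl⟩ := hP Y
    obtain ⟨f, rfl⟩ := P.map_surjective f
    exact (Functor.hcongr_hom h f)

/-- Factorization of a functor through a full functor which is surjective on objects. -/
theorem CategoryTheory.Functor.exists_factor {P : A ⥤ B} [P.Full]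
    (hP : Function.Surjective P.obj) (F : A ⥤ D)
    (hobj : ∀ X X', P.obj X = P.obj X' → F.obj X = F.obj X')
    (hmap : ∀ {X Y X' Y'} (f : X ⟶ Y) (f' : X' ⟶ Y'), P.obj X = P.obj X' → P.obj Y = P.obj Y' →
      P.map f ≍ P.map f' → F.map f ≍ F.map f') : ∃ G : B ⥤ D, P ⋙ G = F := by
  choose σ hσ using hP
  -- Heterogeneous equality compares lifts of `f` between different preimages of its ends; by `hmap`
  -- they all give the same value.
  have key : ∀ {X Y : B} (f : X ⟶ Y), ∃ g : F.obj (σ X) ⟶ F.obj (σ Y),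
      ∀ {X' Y'} (f' : X' ⟶ Y'), P.obj X' = X → P.obj Y' = Y → P.map f' ≍ f → g ≍ F.map f' := by
    intro X Y f
    obtain ⟨f₀, hf₀⟩ := P.map_surjective (eqToHom (hσ X) ≫ f ≫ eqToHom (hσ Y).symm)
    have h0 : P.map f₀ ≍ f := by
      rw [hf₀]
      simp
    exact ⟨F.map f₀, fun f' hX hY hf' => hmap f₀ f' ((hσ X).trans hX.symm) ((hσ Y).trans hY.symm)
      (h0.trans hf'.symm)⟩
  choose m hm using @key
  refine ⟨{ obj := fun X => F.obj (σ X), map := fun f => m f, map_id := fun X => ?_,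
            map_comp := fun {X Y Z} f g => ?_ }, Functor.hext (fun X => hobj _ _ (hσ _))
              fun X Y f => hm (P.map f) f rfl rfl HEq.rfl⟩
  · refine eq_of_heq ((hm (𝟙 X) (𝟙 (σ X)) (hσ X) (hσ X) ?_).trans ?_)
    · rw [P.map_id, hσ]
    · rw [F.map_id]
  · have h1 : ∀ {X Y : B} (f : X ⟶ Y), ∃ f' : σ X ⟶ σ Y, P.map f' ≍ f := fun {X Y} f => by
      obtain ⟨f₀, hf₀⟩ := P.map_surjective (eqToHom (hσ X) ≫ f ≫ eqToHom (hσ Y).symm)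
      exact ⟨f₀, by rw [hf₀]; simp⟩
    obtain ⟨f', hf'⟩ := h1 f
    obtain ⟨g', hg'⟩ := h1 g
    have ef := eq_of_heq (hm f f' (hσ X) (hσ Y) hf')
    have eg := eq_of_heq (hm g g' (hσ Y) (hσ Z) hg')
    have efg := eq_of_heq (hm (f ≫ g) (f' ≫ g') (hσ X) (hσ Z) (by
      rw [P.map_comp]
      congr 1
      · exact hσ X
      · exact hσ Y
      · exact hσ Z))
    rw [efg, F.map_comp, ← ef, ← eg]

namespace QuotCat

variable {G : Type w} [Group G] {C : Type v} [Category.{u} C] [MulAction G C] (A : CatAction G C)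
  {E : Type*} [Category E]

/-- The universal property of the quotient category. -/
theorem exists_lift (F : C ⥤ E) (hobj : ∀ (g : G) (X : C), F.obj (g • X) = F.obj X)
    (hmap : ∀ (g : G) (X : C), F.map (A.i g X) = eqToHom (hobj g X).symm) :
    ∃ κ : QuotCat A ⥤ E, proj A ⋙ κ = F := by
  let o : A.QuotObj → E := Quotient.lift F.obj (by
    rintro _ X ⟨g, rfl⟩
    exact hobj g X)
  let φ : A.QuotObj ⥤q E :=
    { obj := o
      map := fun {X Y} f => show o X ⟶ o Y from match X, Y, f with
        | _, _, .mk f => F.map f }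
  have hgen : ∀ {X Y : C} (f : X ⟶ Y), (Paths.lift φ).map (A.gen f) = F.map f := fun f =>
    Paths.lift_toPath φ _
  have heq : ∀ {X Y : A.QuotObj} (h : X = Y), (Paths.lift φ).map (eqToHom (C := Paths A.QuotObj) h) =
      eqToHom (congrArg o h) := by
    rintro X _ rfl
    exact (Paths.lift φ).map_id X
  let κ := CategoryTheory.Quotient.lift A.Rel (Paths.lift φ) (by
    intro X Y f g h
    cases h with
    | id X => rw [hgen, F.map_id]; exact ((Paths.lift φ).map_id (A.cls X)).symm
    | comp f g =>
      rw [hgen, F.map_comp]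
      refine Eq.trans ?_ ((Paths.lift φ).map_comp _ _).symm
      rw [hgen, hgen]
      rfl
    | act g X =>
      rw [hgen, hmap, heq]
      rfl)
  refine ⟨{ obj := fun X => o X, map := fun f => κ.map f, map_id := fun X => κ.map_id _,
            map_comp := fun f g => κ.map_comp _ _ }, Functor.hext (fun X => rfl) fun X Y f =>
              heq_of_eq (hgen f)⟩

/-- Every morphism of the quotient is the class of a path of morphisms of `C`, so two functors which
agree on these are equal, by induction on the path. -/
theorem functor_eq_of_proj_comp_eq {κ κ' : QuotCat A ⥤ E} (h : proj A ⋙ κ = proj A ⋙ κ') :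
    κ = κ' := by
  have hobj : ∀ X, κ.obj X = κ'.obj X := fun X => by
    obtain ⟨X, rfl⟩ := Quotient.exists_rep X
    exact Functor.congr_obj h X
  refine Functor.hext hobj fun X Y f => ?_
  obtain ⟨p, rfl⟩ := Functor.map_surjective (C := Paths A.QuotObj) (X := (X : Paths A.QuotObj))
    (Y := (Y : Paths A.QuotObj)) (CategoryTheory.Quotient.functor A.Rel) f
  have key : ∀ {X Y : A.QuotObj} (p : Quiver.Path X Y),
      κ.map (X := X) (Y := Y) ((CategoryTheory.Quotient.functor A.Rel).map
        (X := (X : Paths A.QuotObj)) (Y := (Y : Paths A.QuotObj)) p) ≍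
      κ'.map (X := X) (Y := Y) ((CategoryTheory.Quotient.functor A.Rel).map
        (X := (X : Paths A.QuotObj)) (Y := (Y : Paths A.QuotObj)) p) := by
    intro X Y p
    induction p with
    | nil =>
      refine (heq_of_eq (κ.map_id X)).trans (HEq.trans ?_ (heq_of_eq (κ'.map_id X)).symm)
      rw [hobj X]
    | cons p e ih =>
      obtain ⟨f⟩ := e
      have h2 := Functor.hcongr_hom h f
      have hc := fun G : QuotCat A ⥤ E => G.map_comp (X := X)
        ((CategoryTheory.Quotient.functor A.Rel).map (X := (X : Paths A.QuotObj)) p)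
        ((proj A).map f)
      refine (heq_of_eq (hc κ)).trans (HEq.trans ?_ (heq_of_eq (hc κ')).symm)
      congr 1
      · exact hobj _
      · exact hobj _
      · exact hobj _
  exact key p

end QuotCat

end Factorization

/-! ### Existence and uniqueness of k_Φ. -/

section ContractionFactorization

theorem IsEqToHom.comp_heq {C : Type u} [Category.{v} C] {W X Y Z : C} {e : W ⟶ X} {f : X ⟶ Y}
    {e' : Y ⟶ Z} (h : IsEqToHom e) (h' : IsEqToHom e') : e ≫ f ≫ e' ≍ f := by
  obtain ⟨rfl, rfl⟩ := h
  obtain ⟨rfl, rfl⟩ := h'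
  simp

theorem IsEqToHom.of_heq {C : Type u} [Category.{v} C] {X Y X' Y' : C} {f : X ⟶ Y} {f' : X' ⟶ Y'}
    (h : IsEqToHom f) (hX : X' = X) (hY : Y' = Y) (hf : f' ≍ f) : IsEqToHom f' := by
  subst hX hY
  rwa [eq_of_heq hf]

theorem Gamma0.mk_inv_mul_eq_one {n : ℕ} {b c : Braid n} (h : mk n b = mk n c) :
    mk n (b⁻¹ * c) = 1 := by
  rw [map_mul, map_inv, h, inv_mul_cancel]

theorem Gamma0.perm_eq_one_of_mk {n : ℕ} {b : Braid n} (h : mk n b = 1) : Braid.perm n b = 1 := by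
  rw [← perm_mk, h, map_one]

variable {K : Type u} [CommRing K] [Algebra ℚ K] (a : Associator K) (S : Type v)

/-- The functor `PaB_S → PaDih_S~`. -/
def toDihTilde : PaB S ⥤ PaDihTilde S :=
  LabCat.functor braidToGamma (fun _ => Paren.toPlT) S

theorem toDihTilde_obj_surjective : Function.Surjective (toDihTilde S).obj := by
  rintro ⟨n, T, s⟩
  obtain ⟨t, rfl⟩ := Paren.toPlT_surjective n T
  exact ⟨LabObj.mk n t s, rfl⟩

instance : (toDihTilde S).Full where
  map_surjective {X Y} f := by
    let f₀ : LabCat.Hom ((toDihTilde S).obj X) ((toDihTilde S).obj Y) gammaGroups := f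
    obtain ⟨b, hb⟩ := QuotientGroup.mk'_surjective _ f₀.elt
    refine ⟨⟨f₀.len, b, fun i => ?_⟩, LabCat.Hom.ext hb⟩
    refine Eq.trans ?_ (f₀.lab i)
    rw [← hb]
    rfl

variable {S}

theorem LabObj.eq_mk_of_toDihTilde_eq {n : ℕ} {t : Paren n} {s : Fin n → S} {X : PaB S}
    (h : (toDihTilde S).obj (LabObj.mk n t s) = (toDihTilde S).obj X) :
    ∃ t' : Paren n, X = LabObj.mk n t' s ∧ t.toPlT = t'.toPlT := by
  obtain ⟨m, t', s'⟩ := X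
  obtain ⟨rfl, h1, h2⟩ := LabObj.mk.inj h
  obtain rfl := eq_of_heq h2
  exact ⟨t', rfl, eq_of_heq h1⟩

theorem LabCat.elt_eq_of_heq {P : PermGroups.{w}} {T : ℕ → Type} {n : ℕ} {t t' u u' : T n}
    {s r : Fin n → S} (ht : t = t') (hu : u = u')
    {f : Hom (LabObj.mk n t s) (LabObj.mk n u r) P}
    {f' : Hom (LabObj.mk n t' s) (LabObj.mk n u' r) P} (h : f ≍ f') : f.elt = f'.elt := by
  subst ht hu
  rw [eq_of_heq h]

namespace Associator

theorem contract_obj_eq {X X' : PaB S} (h : (toDihTilde S).obj X = (toDihTilde S).obj X') :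
    (a.contract S).obj X = (a.contract S).obj X' :=
  congrArg (actDihGr K S).cls h

/-- The braids b and c of the two morphisms have the same class in Γ_{0,n}. Hence f' is f preceded
by the braid b⁻¹c and followed by a trivial braid, both of which become identities. -/
theorem contract_map_heq {X Y X' Y' : PaB S} (f : X ⟶ Y) (f' : X' ⟶ Y')
    (hX : (toDihTilde S).obj X = (toDihTilde S).obj X')
    (hY : (toDihTilde S).obj Y = (toDihTilde S).obj Y')
    (h : (toDihTilde S).map f ≍ (toDihTilde S).map f') :
    (a.contract S).map f ≍ (a.contract S).map f' := by
  obtain ⟨n, t, s⟩ := X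
  obtain ⟨m, u, r⟩ := Y
  obtain rfl : n = m := LabCat.Hom.len f
  obtain ⟨t', rfl, ht⟩ := LabObj.eq_mk_of_toDihTilde_eq hX
  obtain ⟨u', rfl, hu⟩ := LabObj.eq_mk_of_toDihTilde_eq hY
  let b : LabCat.Hom (LabObj.mk n t s) (LabObj.mk n u r) braidGroups := f
  let c : LabCat.Hom (LabObj.mk n t' s) (LabObj.mk n u' r) braidGroups := f'
  have hbc : Gamma0.mk n b.elt = Gamma0.mk n c.elt := LabCat.elt_eq_of_heq ht hu h
  have h1 : Gamma0.mk n (b.elt⁻¹ * c.elt) = 1 := Gamma0.mk_inv_mul_eq_one hbc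
  have h2 : Braid.perm n (b.elt⁻¹ * c.elt) = 1 := Gamma0.perm_eq_one_of_mk h1
  let e : LabCat.Hom (LabObj.mk n t' s) (LabObj.mk n t s) braidGroups :=
    ⟨rfl, b.elt⁻¹ * c.elt, fun i => congrArg (fun p => s (p i)) h2⟩
  let e' : LabCat.Hom (LabObj.mk n u r) (LabObj.mk n u' r) braidGroups :=
    ⟨rfl, 1, fun i => by rw [map_one]; rfl⟩
  have hf : f' = CategoryStruct.comp (obj := PaB S) e (CategoryStruct.comp (obj := PaB S) f e') := by
    refine LabCat.Hom.ext ?_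
    have key : ∀ x y : Braid n, y = 1 * x * (x⁻¹ * y) := fun x y => by
      rw [one_mul, mul_inv_cancel_left]
    exact key b.elt c.elt
  have he : IsEqToHom ((a.contract S).map (X := LabObj.mk n t' s) (Y := LabObj.mk n t s) e) :=
    a.mem_stepSubgroup_of_mk (γ := 1) (h1.trans (map_one _).symm) t' t s s e
      ((one_smul DInf _).trans ht.symm) rfl
  have he' := a.isEqToHom_one hu e' rfl
  rw [hf]
  exact ((heq_of_eq ((Functor.map_comp _ _ _).trans (congrArg _ (Functor.map_comp _ _ _)))).trans
    (he.comp_heq he')).symm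

theorem isEqToHom_contract_of_act {X X' : PaB S} (g : DInf)
    (hX : (toDihTilde S).obj X' = g • (toDihTilde S).obj X) (f : X ⟶ X')
    (h : (toDihTilde S).map f ≍ (actDih S).i g ((toDihTilde S).obj X)) :
    IsEqToHom ((a.contract S).map f) := by
  obtain ⟨n, t, s⟩ := X
  obtain ⟨m, t', s'⟩ := X'
  obtain ⟨hn, h1, h2⟩ := LabObj.mk.inj hX
  change m = n at hn
  subst hn
  obtain rfl : s' = fun i => s ((DInf.toPerm m g)⁻¹ i) := eq_of_heq h2
  let b : LabCat.Hom (LabObj.mk m t s) (LabObj.mk m t' _) braidGroups := f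
  exact a.mem_stepSubgroup_of_mk (γ := g) (LabCat.elt_eq_of_heq rfl (eq_of_heq h1) h) t t' s _ b
    (eq_of_heq h1).symm rfl

variable (S) in
/-- The contraction of the functor `j_Φ` factors through the contraction of `PaB_S`. -/
theorem exists_contraction_comp_eq :
    ∃ κ : PaDih S ⥤ PaDihGr K S, contraction S ⋙ κ = a.contract S := by
  -- There are two stages: the relators of Γ_{0,n} and the choice of a root are forgotten first, and
  -- the action of D is divided out afterwards.
  obtain ⟨G, hG⟩ := Functor.exists_factor (toDihTilde_obj_surjective S) (a.contract S)
    (fun _ _ => a.contract_obj_eq) (fun f f' => a.contract_map_heq f f')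
  have hobj : ∀ X, G.obj ((toDihTilde S).obj X) = (actDihGr K S).cls ((toDihTilde S).obj X) :=
    fun X => Functor.congr_obj hG X
  have hobj' : ∀ (g : DInf) (X : PaDihTilde S), G.obj (g • X) = G.obj X := by
    intro g X
    obtain ⟨Y, hY⟩ := toDihTilde_obj_surjective S (g • X)
    obtain ⟨X, rfl⟩ := toDihTilde_obj_surjective S X
    rw [← hY, hobj, hobj, hY]
    exact (actDihGr K S).cls_smul g _
  obtain ⟨κ, hκ⟩ := QuotCat.exists_lift (actDih S) G hobj' (fun g X => by
    obtain ⟨Y, hY⟩ := toDihTilde_obj_surjective S (g • X)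
    obtain ⟨X, rfl⟩ := toDihTilde_obj_surjective S X
    obtain ⟨f, hf⟩ := (toDihTilde S).map_surjective
      ((actDih S).i g ((toDihTilde S).obj X) ≫ eqToHom hY.symm)
    have hf' : (toDihTilde S).map f ≍ (actDih S).i g ((toDihTilde S).obj X) := by
      rw [hf]
      simp
    have h1 : IsEqToHom (G.map ((toDihTilde S).map f)) :=
      (a.isEqToHom_contract_of_act g hY f hf').of_heq (Functor.congr_obj hG _)
        (Functor.congr_obj hG _) (Functor.hcongr_hom hG f)
    refine (h1.of_heq rfl (congrArg G.obj hY.symm) ?_).2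
    congr 1
    · exact hY.symm
    · exact hf'.symm)
  exact ⟨κ, (congrArg (fun F => toDihTilde S ⋙ F) hκ).trans hG⟩

end Associator

end ContractionFactorization

theorem mainTheorem10 {K : Type u} [CommRing K] [Algebra ℚ K] (a : Associator K) (S : Type v) :
    ∃ j : StrictBraidedFunctor S a, (∀ j' : StrictBraidedFunctor S a, j' = j) ∧
      ∃! κ : PaDih S ⥤ PaDihGr K S, (∀ X : DihObj S, κ.obj X = X) ∧
        contraction S ⋙ κ = j.toFunctor ⋙ contractionGr K S := by
  obtain ⟨κ, hκ⟩ := a.exists_contraction_comp_eq S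
  refine ⟨a.strictFunctor S, fun j' => StrictBraidedFunctor.eq_of_strict _ _, κ, ⟨fun X => ?_, hκ⟩,
    fun κ' h => ?_⟩
  -- Every object is the contraction of a parenthesized word, so the factorization itself forces the
  -- functor to be the identity on objects.
  · obtain ⟨X, rfl⟩ := Quotient.exists_rep X
    obtain ⟨Y, rfl⟩ := toDihTilde_obj_surjective S X
    exact Functor.congr_obj hκ Y
  · exact QuotCat.functor_eq_of_proj_comp_eq _ (Functor.eq_of_comp_eq_of_full
      (toDihTilde_obj_surjective S) (h.2.trans hκ.symm))
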